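/- Let $g:\mathbb N\to\mathbb R_+$ satisfy $g(0)=0$, $g(k)>0$ for $k>0$ and $\sup_k|g(k+1)-g(k)|<\infty$. Put $g(k)!=g(1)\cdots g(k)$, $g(0)!=1$, $Z(\lambda)=\sum_{k\ge 0}\lambda^k/g(k)!$, let $\lambda^*\in(0,\infty]$ be the radius of convergence of $Z$ and, for $0<\lambda<\lambda^*$, let $\mu_\lambda(k)=\lambda^k/(g(k)!\,Z(\lambda))$, $k\ge 0$. Let $\langle\cdot\rangle_\lambda$ denote expectation with respect to the homogeneous product measure with marginals $\mu_\lambda$, and let $R(\lambda)=\sum_k k\,\mu_\lambda(k)$ be the density at fugacity $\lambda$; write $\rho\mapsto\lambda(\rho)$ for the inverse function of $R$ on $(0,\lambda^*)$. Let $\lambda_\pm:[0,\infty)\to(0,\lambda^*)$ be differentiable with bounded derivative and, for $y\in[-1,1]$, let $\bar\lambda(y,t)=\tfrac12[\lambda_+(t)-\lambda_-(t)]y+\tfrac12[\lambda_+(t)+\lambda_-(t)]$. Let $\alpha>0$ and, for $N\ge 1$, let $(\eta_t)_{t\ge 0}$ be the zero-range process on $\mathbb N^{\{-N,\dots,N\}}$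 with time-dependent generator $$L_{N,t}f(\eta)=\frac{N^{2+\alpha}}2\Big\{\sum_{x=-N}^N g(\eta(x))\sum_{\sigma=\pm1}[f(\eta^{x,x+\sigma})-f(\eta)]+\sum_{\sigma=\pm}\lambda_\sigma(t)[f(\eta^{\sigma N,+})-f(\eta)]\Big\},$$ where $\eta^{x,y}$ is $\eta$ with one particle moved from $x$ to $y$ (the particle is destroyed if $y=\pm(N+1)$) and $\eta^{x,+}$ is $\eta$ with one particle added at $x$. Assume that there is a constant $C$ such that for all $N\ge 1$ the relative entropy of the law of $\eta_0$ with respect to the product measure $\prod_{x=-N}^N\mu_{\bar\lambda(x/N,0)}$ is at most $CN$. (i) Let $\varphi$ be a local function (a real function of the occupation numbers of finitely many sites) such that $\langle e^{\gamma|\varphi|}\rangle_\lambda<\infty$ for all $\gamma>0$ and all $\lambda\in(0,\lambda^*)$; this holds for every bounded local function and, if $\lambda^*=\infty$, for every local function of at most linear growth. Put $\hat\varphi(\lambda)=\langle\varphi\rangle_\lambda$ and let $\theta_x$ be the space shift by $x$. Then, for every bounded measurable function $G$ on $[-1,1]$ that is continuous almost everywhere and every $t>0$, $$\lim_{N\to\infty}\mathbb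 E\left(\int_0^t ds\left|\frac1N\sum_x G\big(\tfrac xN\big)\,\theta_x\varphi(\eta_s)-\int_{-1}^1G(y)\,\hat\varphi(\bar\lambda(y,s))\,dy\right|\right)=0,$$ where, if $\varphi$ depends on the sites $-\ell,\dots,\ell$ only, the sum runs over the integers $x$ with $-N+\ell\le x\le N-\ell$, for which $\theta_x\varphi$ is well defined on $\{-N,\dots,N\}$. (ii) For every $s\ge 0$ the profile $\rho(y,s)=R(\bar\lambda(y,s))$ is the unique solution on $[-1,1]$, among functions with values in $R((0,\lambda^*))$, of the nonlinear Laplace equation $\partial_{yy}\lambda(\rho(y,s))=0$ with $\lambda(\rho(\pm1,s))=\lambda_\pm(s)$. If $Z(\lambda)<\infty$ for all $\lambda>0$, then the empirical density follows it: for all $G$ and $t$ as in (i), $$\lim_{N\to\infty}\mathbb E\left(\int_0^t ds\left|\frac1N\sum_{x=-N}^N G\big(\tfrac xN\big)\,\eta_s(x)-\int_{-1}^1G(y)\,\rho(y,s)\,dy\right|\right)=0.$$ -/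

import Mathlib

open MeasureTheory ProbabilityTheory Filter Topology Set
open scoped NNReal ENNReal

noncomputable section

namespace ZeroRange

/-- The sites `{-N, …, N}`. -/
abbrev Box (N : ℕ) : Type := ↥(Finset.Icc (-(N : ℤ)) (N : ℤ))

/-- Particle configurations on `{-N, …, N}`. -/
abbrev Config (N : ℕ) : Type := Box N → ℕ

/-- The leftmost site `-N`. -/
def leftEnd (N : ℕ) : Box N := ⟨-(N : ℤ), by simp⟩

/-- The rightmost site `N`. -/
def rightEnd (N : ℕ) : Box N := ⟨(N : ℤ), by simp⟩

/-- One particle is added at `x`. -/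
def addAt {N : ℕ} (η : Config N) (x : Box N) : Config N :=
  Function.update η x (η x + 1)

/-- One particle is removed at `x` (only used with rate `g (η x)`, which vanishes if `η x = 0`). -/
def removeAt {N : ℕ} (η : Config N) (x : Box N) : Config N :=
  Function.update η x (η x - 1)

/-- A particle moves from `x` to `y`; it is destroyed if `y` lies outside `{-N, …, N}`. -/
def jump {N : ℕ} (η : Config N) (x : Box N) (y : ℤ) : Config N :=
  if h : y ∈ Finset.Icc (-(N : ℤ)) (N : ℤ) then addAt (removeAt η x) ⟨y, h⟩ else removeAt η x

/-- The generator, sped up by `N ^ (2 + α)`, with creation rates (fugacities) `a` at `-N` and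
`b` at `N`. -/
def generator (g : ℕ → ℝ) (α : ℝ) (N : ℕ) (a b : ℝ) (f : Config N → ℝ) (η : Config N) : ℝ :=
  (N : ℝ) ^ (2 + α) / 2 *
    ((∑ x : Box N, g (η x) *
        ((f (jump η x ((x : ℤ) + 1)) - f η) + (f (jump η x ((x : ℤ) - 1)) - f η)))
      + (a * (f (addAt η (leftEnd N)) - f η) + b * (f (addAt η (rightEnd N)) - f η)))

/-- `η` is, under `P`, the zero-range process with boundary fugacities `lamL s`, `lamR s` at
time `s`: a process with càdlàg paths in the (discrete, countable) configuration space that solves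
the martingale problem of the time dependent generator, with finitely supported test functions. -/
structure IsZeroRangeProcess (g : ℕ → ℝ) (α : ℝ) (lamL lamR : ℝ → ℝ) (N : ℕ)
    {Ω : Type*} [MeasurableSpace Ω] (P : Measure Ω) (η : ℝ≥0 → Ω → Config N) : Prop where
  measurable : ∀ s, Measurable (η s)
  right_cont : ∀ ω s, ContinuousWithinAt (fun r => η r ω) (Ici s) s
  left_lim : ∀ ω s, ∃ ξ : Config N, Tendsto (fun r => η r ω) (𝓝[<] s) (𝓝 ξ)
  martingale : ∀ f : Config N → ℝ, f.support.Finite →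
    Martingale
      (fun (s : ℝ≥0) (ω : Ω) => f (η s ω) - f (η 0 ω)
        - ∫ r in (0 : ℝ)..s, generator g α N (lamL r) (lamR r) f (η r.toNNReal ω))
      (Filtration.natural η fun s => (measurable s).stronglyMeasurable) P

/-- The weight `lam ^ k / g(k)!`, where `g(k)! = g(1) ⋯ g(k)`. -/
def weight (g : ℕ → ℝ) (lam : ℝ) (k : ℕ) : ℝ :=
  lam ^ k / ∏ j ∈ Finset.Icc 1 k, g j

/-- The normalization `Z(lam)`. -/
def partitionFn (g : ℕ → ℝ) (lam : ℝ) : ℝ := ∑' k, weight g lam k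

/-- The one-site measure `μ_lam(k) = lam ^ k / (g(k)! Z(lam))`. -/
def siteMeasure (g : ℕ → ℝ) (lam : ℝ) : Measure ℕ :=
  Measure.sum fun k => ENNReal.ofReal (weight g lam k / partitionFn g lam) • Measure.dirac k

/-- The fugacities `0 < lam < lam*`, where `lam* ∈ (0, ∞]` is the radius of convergence of `Z`. -/
def fugacities (g : ℕ → ℝ) : Set ℝ :=
  {lam | 0 < lam ∧ ∃ lam', lam < lam' ∧ Summable (weight g lam')}

/-- Linear interpolation on `[-1, 1]`, with value `a` at `-1` and `b` at `1`. -/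
def interp (a b y : ℝ) : ℝ := (b - a) / 2 * y + (b + a) / 2

/-- The inhomogeneous product measure on `{-N, …, N}` with fugacity `interp a b (x / N)` at `x`. -/
def refMeasure (g : ℕ → ℝ) (N : ℕ) (a b : ℝ) : Measure (Config N) :=
  Measure.pi fun x : Box N => siteMeasure g (interp a b (((x : ℤ) : ℝ) / N))

/-- The homogeneous product measure of fugacity `lam`, on a window `{-ℓ, …, ℓ}`. -/
def homMeasure (g : ℕ → ℝ) (ℓ : ℕ) (lam : ℝ) : Measure (Config ℓ) :=
  Measure.pi fun _ : Box ℓ => siteMeasure g lam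

/-- The average of the local function `φ` (a function of the occupation numbers in
`{-ℓ, …, ℓ}`) at fugacity `lam`. -/
def localAverage (g : ℕ → ℝ) {ℓ : ℕ} (φ : Config ℓ → ℝ) (lam : ℝ) : ℝ :=
  ∫ ξ, φ ξ ∂(homMeasure g ℓ lam)

/-- The local function `φ` has finite exponential moments of every order at every fugacity. This
holds for bounded `φ`, and for `φ` of linear growth if `Z` is finite everywhere. -/
def HasExpMoments (g : ℕ → ℝ) {ℓ : ℕ} (φ : Config ℓ → ℝ) : Prop :=
  ∀ γ > 0, ∀ lam ∈ fugacities g,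
    Integrable (fun ξ => Real.exp (γ * |φ ξ|)) (homMeasure g ℓ lam)

/-- The number of particles at `z`, for `z` in `{-N, …, N}` (and `0` elsewhere). -/
def occ {N : ℕ} (η : Config N) (z : ℤ) : ℕ :=
  if h : z ∈ Finset.Icc (-(N : ℤ)) (N : ℤ) then η ⟨z, h⟩ else 0

/-- The shifted local function `θ_x φ`, meaningful if `{x - ℓ, …, x + ℓ} ⊆ {-N, …, N}`. -/
def shift {ℓ N : ℕ} (φ : Config ℓ → ℝ) (x : ℤ) (η : Config N) : ℝ :=
  φ fun z : Box ℓ => occ η (x + (z : ℤ))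

/-- `(1 / N) ∑ₓ G(x / N) θ_x φ(η)`, over all `x` for which `θ_x φ` is well defined. -/
def spatialAverage {ℓ N : ℕ} (G : ℝ → ℝ) (φ : Config ℓ → ℝ) (η : Config N) : ℝ :=
  1 / (N : ℝ) * ∑ x ∈ Finset.Icc (-(N : ℤ) + ℓ) ((N : ℤ) - ℓ), G ((x : ℝ) / N) * shift φ x η

/-- The empirical density `(1 / N) ∑ₓ G(x / N) η(x)`, over `x ∈ {-N, …, N}`. -/
def empiricalDensity {N : ℕ} (G : ℝ → ℝ) (η : Config N) : ℝ :=
  1 / (N : ℝ) * ∑ x : Box N, G (((x : ℤ) : ℝ) / N) * (η x : ℝ)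

/-- The mean number of particles per site at fugacity `lam`. -/
def meanDensity (g : ℕ → ℝ) (lam : ℝ) : ℝ := ∫ k, (k : ℝ) ∂(siteMeasure g lam)

/-- The fugacity `λ(ρ)` as a function of the density: the inverse function of `meanDensity g`. -/
def fugacity (g : ℕ → ℝ) (ρ : ℝ) : ℝ := Function.invFunOn (meanDensity g) (fugacities g) ρ

/-- `ρ` takes equilibrium densities as values and solves `∂_yy λ(ρ(y)) = 0` on `[-1, 1]` with
boundary values `λ(ρ(-1)) = a` and `λ(ρ(1)) = b`. -/
structure SolvesLaplace (g : ℕ → ℝ) (a b : ℝ) (ρ : ℝ → ℝ) : Prop where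
  mem : ∀ y ∈ Icc (-1 : ℝ) 1, ρ y ∈ meanDensity g '' fugacities g
  smooth : ContDiffOn ℝ 2 (fun y => fugacity g (ρ y)) (Icc (-1) 1)
  laplace : ∀ y ∈ Ioo (-1 : ℝ) 1, iteratedDeriv 2 (fun y => fugacity g (ρ y)) y = 0
  left : fugacity g (ρ (-1)) = a
  right : fugacity g (ρ 1) = b

/-- Bounded measurable test functions on `[-1, 1]` that are continuous almost everywhere. -/
structure IsTestFunction (G : ℝ → ℝ) : Prop where
  measurable : Measurable G
  bounded : ∃ M, ∀ y ∈ Icc (-1 : ℝ) 1, |G y| ≤ M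
  continuous_ae : ∀ᵐ y ∂(volume.restrict (Icc (-1 : ℝ) 1)), ContinuousWithinAt G (Icc (-1) 1) y

end ZeroRange

end

open ZeroRange

namespace ZeroRange

variable {g : ℕ → ℝ}

/-! ### One-site measures -/

theorem gFactorial_pos (hgpos : ∀ k, 0 < k → 0 < g k) (k : ℕ) :
    0 < ∏ j ∈ Finset.Icc 1 k, g j :=
  Finset.prod_pos fun j hj => hgpos j (by simp at hj; omega)

theorem weight_pos (hgpos : ∀ k, 0 < k → 0 < g k) {lam : ℝ} (h : 0 < lam) (k : ℕ) :
    0 < weight g lam k :=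
  div_pos (pow_pos h k) (gFactorial_pos hgpos k)

theorem weight_nonneg (hgpos : ∀ k, 0 < k → 0 < g k) {lam : ℝ} (h : 0 ≤ lam) (k : ℕ) :
    0 ≤ weight g lam k :=
  div_nonneg (pow_nonneg h k) (gFactorial_pos hgpos k).le

@[simp] theorem weight_zero_right (lam : ℝ) : weight g lam 0 = 1 := by simp [weight]

theorem weight_succ_mul (hgpos : ∀ k, 0 < k → 0 < g k) (lam : ℝ) (k : ℕ) :
    weight g lam (k + 1) * g (k + 1) = lam * weight g lam k := by
  have h1 := (gFactorial_pos hgpos k).ne'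
  have h2 := (hgpos (k + 1) k.succ_pos).ne'
  unfold weight
  rw [Finset.prod_Icc_succ_top (by omega), pow_succ]
  field_simp

theorem weight_mono (hgpos : ∀ k, 0 < k → 0 < g k) {lam lam' : ℝ} (h : 0 ≤ lam)
    (h' : lam ≤ lam') (k : ℕ) : weight g lam k ≤ weight g lam' k :=
  div_le_div_of_nonneg_right (pow_le_pow_left₀ h h' k) (gFactorial_pos hgpos k).le

theorem weight_mul (lam r : ℝ) (k : ℕ) : weight g (lam * r) k = weight g lam k * r ^ k := by
  unfold weight; rw [mul_pow]; ring

theorem fugacities_summable (hgpos : ∀ k, 0 < k → 0 < g k) {lam : ℝ} (h : lam ∈ fugacities g) :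
    Summable (weight g lam) := by
  obtain ⟨h0, l, hl, hs⟩ := h
  exact hs.of_nonneg_of_le (weight_nonneg hgpos h0.le) (weight_mono hgpos h0.le hl.le)

theorem fugacities_ordConnected {a b c : ℝ} (ha : 0 < a) (hb : b ∈ fugacities g)
    (hc : c ∈ Icc a b) : c ∈ fugacities g := by
  obtain ⟨h0, l, hl, hs⟩ := hb
  exact ⟨ha.trans_le hc.1, l, hc.2.trans_lt hl, hs⟩

theorem one_le_partitionFn (hgpos : ∀ k, 0 < k → 0 < g k) {lam : ℝ} (h0 : 0 ≤ lam)
    (h : Summable (weight g lam)) : 1 ≤ partitionFn g lam := by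
  have := h.le_tsum 0 (fun k _ => weight_nonneg hgpos h0 k)
  simpa [partitionFn] using this

/-- The one-site probabilities `μ_lam(k)`. -/
noncomputable def siteProb (g : ℕ → ℝ) (lam : ℝ) (k : ℕ) : ℝ := weight g lam k / partitionFn g lam

theorem siteProb_pos (hgpos : ∀ k, 0 < k → 0 < g k) {lam : ℝ} (h : lam ∈ fugacities g) (k : ℕ) :
    0 < siteProb g lam k :=
  div_pos (weight_pos hgpos h.1 k)
    (zero_lt_one.trans_le (one_le_partitionFn hgpos h.1.le (fugacities_summable hgpos h)))

theorem hasSum_siteProb (hgpos : ∀ k, 0 < k → 0 < g k) {lam : ℝ} (h : lam ∈ fugacities g) :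
    HasSum (siteProb g lam) 1 := by
  have hs := fugacities_summable hgpos h
  have := hs.hasSum.div_const (partitionFn g lam)
  have h1 := one_le_partitionFn hgpos h.1.le hs
  rw [show (∑' k, weight g lam k) = partitionFn g lam from rfl, div_self (by positivity)] at this
  exact this

theorem siteProb_succ_mul (hgpos : ∀ k, 0 < k → 0 < g k) (lam : ℝ) (k : ℕ) :
    siteProb g lam (k + 1) * g (k + 1) = lam * siteProb g lam k := by
  unfold siteProb
  rw [div_mul_eq_mul_div, weight_succ_mul hgpos, mul_div_assoc]

theorem siteProb_le (hgpos : ∀ k, 0 < k → 0 < g k) {lam b : ℝ} (h0 : 0 < lam) (hlb : lam ≤ b)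
    (hb : b ∈ fugacities g) (k : ℕ) :
    siteProb g lam k ≤ partitionFn g b * siteProb g b k := by
  have hs := fugacities_summable hgpos hb
  have h1 := one_le_partitionFn hgpos hb.1.le hs
  have hs' : Summable (weight g lam) :=
    hs.of_nonneg_of_le (weight_nonneg hgpos h0.le) (weight_mono hgpos h0.le hlb)
  have h2 := one_le_partitionFn hgpos h0.le hs'
  unfold siteProb
  rw [mul_div_cancel₀ _ (by positivity)]
  exact (div_le_self (weight_nonneg hgpos h0.le k) h2).trans (weight_mono hgpos h0.le hlb k)

theorem partitionFn_mono (hgpos : ∀ k, 0 < k → 0 < g k) {lam b : ℝ} (h0 : 0 ≤ lam) (hlb : lam ≤ b)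
    (hs : Summable (weight g b)) : partitionFn g lam ≤ partitionFn g b :=
  Summable.tsum_le_tsum (weight_mono hgpos h0 hlb)
    (hs.of_nonneg_of_le (weight_nonneg hgpos h0) (weight_mono hgpos h0 hlb)) hs

theorem inv_siteProb_le (hgpos : ∀ k, 0 < k → 0 < g k) {a lam b : ℝ} (ha : 0 < a) (hal : a ≤ lam)
    (hlb : lam ≤ b) (hb : b ∈ fugacities g) (k : ℕ) :
    (siteProb g lam k)⁻¹ ≤ partitionFn g b / weight g a k := by
  unfold siteProb
  rw [inv_div]
  have hs := fugacities_summable hgpos hb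
  have h1 := one_le_partitionFn hgpos hb.1.le hs
  exact div_le_div₀ (by positivity) (partitionFn_mono hgpos (ha.le.trans hal) hlb hs)
    (weight_pos hgpos ha k) (weight_mono hgpos ha.le hal k)

theorem siteMeasure_singleton (lam : ℝ) (k : ℕ) :
    siteMeasure g lam {k} = ENNReal.ofReal (siteProb g lam k) := by
  unfold siteMeasure siteProb
  rw [Measure.sum_apply _ (measurableSet_singleton k), tsum_eq_single k]
  · simp
  · intro j hj
    simp [hj]

theorem isProbabilityMeasure_siteMeasure (hgpos : ∀ k, 0 < k → 0 < g k) {lam : ℝ}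
    (h : lam ∈ fugacities g) : IsProbabilityMeasure (siteMeasure g lam) := by
  constructor
  have := hasSum_siteProb hgpos h
  calc _ = ∑' k, ENNReal.ofReal (siteProb g lam k) := by
        simp [siteMeasure, Measure.sum_apply, siteProb]
    _ = ENNReal.ofReal 1 := by
        rw [← this.tsum_eq, ENNReal.ofReal_tsum_of_nonneg (fun k => (siteProb_pos hgpos h k).le)
          this.summable]
    _ = 1 := by simp

/-- Exponential moments of the occupation number. -/
theorem hasSum_siteProb_mul_pow {lam r : ℝ}
    (hs : Summable (weight g (lam * r))) :
    HasSum (fun k => siteProb g lam k * r ^ k) (partitionFn g (lam * r) / partitionFn g lam) := by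
  have := hs.hasSum.div_const (partitionFn g lam)
  refine this.congr_fun fun k => ?_
  rw [weight_mul, siteProb]; ring

theorem exists_hasDerivAt_partitionFn (hgpos : ∀ k, 0 < k → 0 < g k) {b : ℝ}
    (hb : b ∈ fugacities g) :
    ∃ K, 0 ≤ K ∧ ∀ lam, 0 < lam → lam ≤ b → ∃ d, |d| ≤ K ∧ HasDerivAt (partitionFn g) d lam := by
  obtain ⟨hb0, l, hl, hs⟩ := hb
  set m := (b + l) / 2 with hm
  have hbm : b < m := by rw [hm]; linarith
  have hml : m < l := by rw [hm]; linarith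
  have hm0 : 0 < m := hb0.trans hbm
  set A : ℕ → ℝ := fun k => (∏ j ∈ Finset.Icc 1 k, g j)⁻¹ with hA
  have hApos : ∀ k, 0 < A k := fun k => inv_pos.2 (gFactorial_pos hgpos k)
  have hw : ∀ x k, weight g x k = A k * x ^ k := fun x k => by
    simp only [weight, hA]; rw [div_eq_inv_mul]
  have hu : Summable fun k : ℕ => A k * (k * m ^ (k - 1)) := by
    have hl0 : 0 < l := hm0.trans hml
    obtain ⟨C, hC⟩ : ∃ C, ∀ k : ℕ, (k : ℝ) * (m / l) ^ k ≤ C := by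
      have := tendsto_self_mul_const_pow_of_lt_one (r := m / l) (by positivity)
        ((div_lt_one (hm0.trans hml)).2 hml)
      obtain ⟨C, hC⟩ := this.bddAbove_range
      exact ⟨C, fun k => hC ⟨k, rfl⟩⟩
    refine (hs.mul_left (C / m)).of_nonneg_of_le (fun k => mul_nonneg (hApos k).le (by positivity)) ?_
    intro k
    rw [hw]
    have h1 : (k : ℝ) * m ^ (k - 1) ≤ C / m * l ^ k := by
      rcases k with _ | k
      · have := hC 0
        have hC0 : 0 ≤ C := by simpa using this
        simp; positivity
      · have := hC (k + 1)
        rw [div_pow, ← mul_div_assoc, div_le_iff₀ (by positivity)] at this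
        rw [div_mul_eq_mul_div, le_div_iff₀ hm0]
        calc _ = ((k + 1 : ℕ) : ℝ) * m ^ (k + 1) := by simp [pow_succ]; ring
          _ ≤ _ := this
    calc _ ≤ A k * (C / m * l ^ k) := mul_le_mul_of_nonneg_left h1 (hApos k).le
      _ = _ := by ring
  refine ⟨∑' k : ℕ, A k * (k * m ^ (k - 1)),
    tsum_nonneg fun k => mul_nonneg (hApos k).le (by positivity), ?_⟩
  intro lam h0 hlb
  have key : HasDerivAt (fun x => ∑' k, A k * x ^ k) (∑' k : ℕ, A k * (k * lam ^ (k - 1))) lam := by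
    refine hasDerivAt_tsum_of_isPreconnected (t := Ioo 0 m) (y₀ := lam) hu isOpen_Ioo
      isPreconnected_Ioo (g := fun k x => A k * x ^ k)
      (g' := fun k x => A k * (k * x ^ (k - 1))) ?_ ?_ ⟨h0, hlb.trans_lt hbm⟩ ?_
      ⟨h0, hlb.trans_lt hbm⟩
    · intro k y _
      exact (hasDerivAt_pow k y).const_mul (A k)
    · intro k y hy
      have hy0 := hy.1.le
      rw [Real.norm_of_nonneg (mul_nonneg (hApos k).le (by positivity))]
      exact mul_le_mul_of_nonneg_left (mul_le_mul_of_nonneg_left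
        (pow_le_pow_left₀ hy.1.le hy.2.le _) (by positivity)) (hApos k).le
    · simp only [← hw]
      exact hs.of_nonneg_of_le (weight_nonneg hgpos h0.le)
        (weight_mono hgpos h0.le (hlb.trans hl.le))
  refine ⟨∑' k : ℕ, A k * (k * lam ^ (k - 1)), ?_, ?_⟩
  rotate_left
  · have : partitionFn g = fun x => ∑' k, A k * x ^ k := by
      ext x; simp [partitionFn, hw]
    rw [this]
    exact key
  · rw [abs_of_nonneg (tsum_nonneg fun k => mul_nonneg (hApos k).le (by positivity))]
    have hle : ∀ k : ℕ, A k * (k * lam ^ (k - 1)) ≤ A k * (k * m ^ (k - 1)) := fun k =>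
      mul_le_mul_of_nonneg_left (mul_le_mul_of_nonneg_left
        (pow_le_pow_left₀ h0.le (hlb.trans hbm.le) _) (by positivity)) (hApos k).le
    exact Summable.tsum_le_tsum hle
      (hu.of_nonneg_of_le (fun k => mul_nonneg (hApos k).le (by positivity)) hle) hu

theorem continuousAt_partitionFn (hgpos : ∀ k, 0 < k → 0 < g k) {lam : ℝ}
    (h : lam ∈ fugacities g) : ContinuousAt (partitionFn g) lam := by
  obtain ⟨K, -, hK⟩ := exists_hasDerivAt_partitionFn hgpos h
  obtain ⟨d, -, hd⟩ := hK lam h.1 le_rfl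
  exact hd.continuousAt

theorem continuousAt_siteProb (hgpos : ∀ k, 0 < k → 0 < g k) {lam : ℝ}
    (h : lam ∈ fugacities g) (k : ℕ) : ContinuousAt (fun l => siteProb g l k) lam := by
  have h1 := one_le_partitionFn hgpos h.1.le (fugacities_summable hgpos h)
  unfold siteProb weight
  exact ((continuous_pow k).continuousAt.div_const _).div (continuousAt_partitionFn hgpos h)
    (by positivity)

/-- The logarithmic derivative of `μ_lam(k)` in `lam` grows at most linearly in `k`. -/
theorem exists_hasDerivAt_siteProb (hgpos : ∀ k, 0 < k → 0 < g k) {a b : ℝ} (ha : 0 < a)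
    (hb : b ∈ fugacities g) :
    ∃ K : ℝ, 0 ≤ K ∧ ∀ lam, a ≤ lam → lam ≤ b → ∀ k : ℕ, ∃ d : ℝ, |d| ≤ K * (k + 1) ∧
      HasDerivAt (fun l => siteProb g l k) (siteProb g lam k * d) lam := by
  obtain ⟨K, hK0, hK⟩ := exists_hasDerivAt_partitionFn hgpos hb
  refine ⟨a⁻¹ + K, by positivity, fun lam hal hlb k => ?_⟩
  have hl0 : 0 < lam := ha.trans_le hal
  obtain ⟨d, hd, hder⟩ := hK lam hl0 hlb
  have hZ := one_le_partitionFn hgpos hl0.le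
    (fugacities_summable hgpos (fugacities_ordConnected ha hb ⟨hal, hlb⟩))
  refine ⟨k / lam - d / partitionFn g lam, ?_, ?_⟩
  · have h1 : |(k : ℝ) / lam| ≤ a⁻¹ * k := by
      rw [abs_of_nonneg (by positivity), div_eq_mul_inv, mul_comm]
      exact mul_le_mul_of_nonneg_right (inv_anti₀ ha hal) (by positivity)
    have h2 : |d / partitionFn g lam| ≤ K := by
      rw [abs_div, abs_of_nonneg (zero_le_one.trans hZ)]
      exact (div_le_self (abs_nonneg _) hZ).trans hd
    have h3 : 0 ≤ a⁻¹ := by positivity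
    have h4 : 0 ≤ K * k := by positivity
    calc _ ≤ |(k : ℝ) / lam| + |d / partitionFn g lam| := abs_sub _ _
      _ ≤ a⁻¹ * k + K := add_le_add h1 h2
      _ ≤ _ := by nlinarith
  · have hw : HasDerivAt (fun l => weight g l k) (weight g lam k * (k / lam)) lam := by
      have := (hasDerivAt_pow k lam).div_const (∏ j ∈ Finset.Icc 1 k, g j)
      refine this.congr_deriv ?_
      unfold weight
      rcases k with _ | k
      · simp
      · simp only [Nat.add_sub_cancel, pow_succ]; field_simp
    refine (hw.div hder (by positivity)).congr_deriv ?_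
    unfold siteProb
    field_simp

theorem interp_mem_Icc {a b u v y : ℝ} (hu : u ∈ Icc a b) (hv : v ∈ Icc a b)
    (hy : y ∈ Icc (-1 : ℝ) 1) : interp u v y ∈ Icc a b := by
  have h : interp u v y = (1 - y) / 2 * u + (1 + y) / 2 * v := by unfold interp; ring
  have h1 : 0 ≤ (1 - y) / 2 := by linarith [hy.2]
  have h2 : 0 ≤ (1 + y) / 2 := by linarith [hy.1]
  rw [h]
  constructor <;> nlinarith [hu.1, hu.2, hv.1, hv.2]


variable {g : ℕ → ℝ}

/-! ### The density as a function of the fugacity -/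

theorem summable_siteProb_mul_self (hgpos : ∀ k, 0 < k → 0 < g k) {lam : ℝ}
    (h : lam ∈ fugacities g) : Summable fun k : ℕ => siteProb g lam k * k := by
  obtain ⟨h0, l, hl, hs⟩ := id h
  have hr : 1 < l / lam := (one_lt_div h0).2 hl
  have h1 : Summable (weight g (lam * (l / lam))) := by rwa [mul_div_cancel₀ _ h0.ne']
  have h2 := ((hasSum_siteProb_mul_pow (g := g) h1).summable).mul_left ((l / lam - 1)⁻¹)
  refine h2.of_nonneg_of_le
    (fun k => mul_nonneg (siteProb_pos hgpos h k).le (Nat.cast_nonneg k)) fun k => ?_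
  have hb := one_add_mul_le_pow (a := l / lam - 1) (by linarith) k
  rw [add_sub_cancel] at hb
  have hp : 0 < l / lam - 1 := by linarith
  have : (k : ℝ) ≤ (l / lam - 1)⁻¹ * (l / lam) ^ k := by
    rw [inv_mul_eq_div, le_div_iff₀ hp]; linarith
  calc _ ≤ siteProb g lam k * ((l / lam - 1)⁻¹ * (l / lam) ^ k) :=
        mul_le_mul_of_nonneg_left this (siteProb_pos hgpos h k).le
    _ = _ := by ring

theorem integral_siteMeasure (hgpos : ∀ k, 0 < k → 0 < g k) {lam : ℝ} (h : lam ∈ fugacities g)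
    {F : ℕ → ℝ} (hF : Integrable F (siteMeasure g lam)) :
    ∫ k, F k ∂(siteMeasure g lam) = ∑' k, siteProb g lam k * F k := by
  rw [integral_countable hF]
  refine tsum_congr fun k => ?_
  rw [measureReal_def, siteMeasure_singleton, ENNReal.toReal_ofReal (siteProb_pos hgpos h k).le,
    smul_eq_mul]

theorem integrable_siteMeasure (hgpos : ∀ k, 0 < k → 0 < g k) {lam : ℝ} (h : lam ∈ fugacities g)
    {F : ℕ → ℝ} (hF0 : ∀ k, 0 ≤ F k) (hF : Summable fun k => siteProb g lam k * F k) :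
    Integrable F (siteMeasure g lam) := by
  refine ⟨(measurable_of_countable F).aestronglyMeasurable, ?_⟩
  rw [hasFiniteIntegral_iff_ofReal (ae_of_all _ hF0), lintegral_countable']
  have : ∀ k, ENNReal.ofReal (F k) * siteMeasure g lam {k}
      = ENNReal.ofReal (siteProb g lam k * F k) := fun k => by
    rw [siteMeasure_singleton, mul_comm, ENNReal.ofReal_mul (siteProb_pos hgpos h k).le]
  simp only [this]
  rw [← ENNReal.ofReal_tsum_of_nonneg
    (fun k => mul_nonneg (siteProb_pos hgpos h k).le (hF0 k)) hF]
  exact ENNReal.ofReal_lt_top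

theorem meanDensity_eq_tsum (hgpos : ∀ k, 0 < k → 0 < g k) {lam : ℝ} (h : lam ∈ fugacities g) :
    meanDensity g lam = ∑' k : ℕ, siteProb g lam k * k :=
  integral_siteMeasure hgpos h
    (integrable_siteMeasure hgpos h (fun k => Nat.cast_nonneg k)
      (summable_siteProb_mul_self hgpos h))

theorem strictMonoOn_meanDensity (hgpos : ∀ k, 0 < k → 0 < g k) :
    StrictMonoOn (meanDensity g) (fugacities g) := by
  intro lam h lam' h' hlt
  have hl0 := h.1
  set r := lam' / lam with hr
  have hr1 : 1 < r := (one_lt_div hl0).2 hlt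
  have hlr : lam * r = lam' := mul_div_cancel₀ _ hl0.ne'
  set R := meanDensity g lam with hR
  have hZ := one_le_partitionFn hgpos h.1.le (fugacities_summable hgpos h)
  have hZ' := one_le_partitionFn hgpos h'.1.le (fugacities_summable hgpos h')
  have hμ : ∀ k, siteProb g lam k * r ^ k
      = partitionFn g lam' / partitionFn g lam * siteProb g lam' k := fun k => by
    unfold siteProb
    rw [← hlr, weight_mul, hlr]
    field_simp
  have s1 : HasSum (fun k : ℕ => siteProb g lam k * (k - R)) 0 := by
    have h1 := (summable_siteProb_mul_self hgpos h).hasSum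
    rw [← meanDensity_eq_tsum hgpos h, ← hR] at h1
    have h2 := h1.sub ((hasSum_siteProb hgpos h).mul_right R)
    rw [one_mul, sub_self] at h2
    exact h2.congr_fun fun k => by ring
  have s2 : HasSum (fun k : ℕ => siteProb g lam' k * (k - R)) (meanDensity g lam' - R) := by
    have h1 := (summable_siteProb_mul_self hgpos h').hasSum
    rw [← meanDensity_eq_tsum hgpos h'] at h1
    have h2 := h1.sub ((hasSum_siteProb hgpos h').mul_right R)
    rw [one_mul] at h2
    exact h2.congr_fun fun k => by ring
  have s3 : HasSum (fun k : ℕ => siteProb g lam k * ((k - R) * (r ^ (k : ℝ) - r ^ R)))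
      (partitionFn g lam' / partitionFn g lam * (meanDensity g lam' - R)) := by
    have h2 := (s2.mul_left (partitionFn g lam' / partitionFn g lam)).sub (s1.mul_right (r ^ R))
    rw [zero_mul, sub_zero] at h2
    refine h2.congr_fun fun k => ?_
    rw [Real.rpow_natCast]
    linear_combination ((k : ℝ) - R) * hμ k
  have hterm : ∀ x : ℝ, x ≠ R → 0 < (x - R) * (r ^ x - r ^ R) := fun x hx => by
    rcases lt_or_gt_of_ne hx with hx | hx
    · exact mul_pos_of_neg_of_neg (sub_neg.2 hx)
        (sub_neg.2 (Real.rpow_lt_rpow_of_exponent_lt hr1 hx))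
    · exact mul_pos (sub_pos.2 hx) (sub_pos.2 (Real.rpow_lt_rpow_of_exponent_lt hr1 hx))
  have hnn : ∀ k : ℕ, 0 ≤ siteProb g lam k * ((k - R) * (r ^ (k : ℝ) - r ^ R)) := fun k => by
    refine mul_nonneg (siteProb_pos hgpos h k).le ?_
    by_cases hk : (k : ℝ) = R
    · simp [hk]
    · exact (hterm _ hk).le
  obtain ⟨j, hj⟩ : ∃ j : ℕ, (j : ℝ) ≠ R := by
    by_cases h0 : ((0 : ℕ) : ℝ) = R
    · exact ⟨1, by rw [← h0]; norm_num⟩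
    · exact ⟨0, h0⟩
  have hpos := s3.summable.tsum_pos hnn j (mul_pos (siteProb_pos hgpos h j) (hterm _ hj))
  rw [s3.tsum_eq] at hpos
  have := pos_of_mul_pos_right hpos (by positivity)
  linarith

theorem fugacity_meanDensity (hgpos : ∀ k, 0 < k → 0 < g k) {lam : ℝ} (h : lam ∈ fugacities g) :
    fugacity g (meanDensity g lam) = lam :=
  (strictMonoOn_meanDensity hgpos).injOn.leftInvOn_invFunOn h

theorem meanDensity_fugacity {ρ : ℝ} (h : ρ ∈ meanDensity g '' fugacities g) :
    meanDensity g (fugacity g ρ) = ρ :=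
  Function.invFunOn_eq h

/-! ### The nonlinear Laplace equation -/

theorem eqOn_interp_of_iteratedDeriv_two_eq_zero {u : ℝ → ℝ} {a b : ℝ}
    (hu : ContDiffOn ℝ 2 u (Icc (-1) 1)) (h2 : ∀ y ∈ Ioo (-1 : ℝ) 1, iteratedDeriv 2 u y = 0)
    (ha : u (-1) = a) (hb : u 1 = b) : EqOn u (interp a b) (Icc (-1) 1) := by
  have huo : ContDiffOn ℝ 2 u (Ioo (-1) 1) := hu.mono Ioo_subset_Icc_self
  have hd : DifferentiableOn ℝ u (Ioo (-1) 1) := huo.differentiableOn (by norm_num)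
  have hd2 : DifferentiableOn ℝ (deriv u) (Ioo (-1) 1) :=
    ((contDiffOn_succ_iff_deriv_of_isOpen (n := 1) isOpen_Ioo).1
      (by simpa [one_add_one_eq_two] using huo)).2.2.differentiableOn (by norm_num)
  obtain ⟨c, hc⟩ : ∃ c, ∀ y ∈ Ioo (-1 : ℝ) 1, deriv u y = c := by
    refine ⟨deriv u 0, fun y hy => ?_⟩
    refine isOpen_Ioo.is_const_of_deriv_eq_zero isPreconnected_Ioo hd2 (fun z hz => ?_) hy
      (by norm_num)
    have := h2 z hz
    rwa [iteratedDeriv_succ, iteratedDeriv_one] at this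
  obtain ⟨e, he⟩ : ∃ e, ∀ y ∈ Ioo (-1 : ℝ) 1, u y - c * y = e := by
    refine ⟨u 0 - c * 0, fun y hy => ?_⟩
    refine isOpen_Ioo.is_const_of_deriv_eq_zero isPreconnected_Ioo (f := fun y => u y - c * y)
      (hd.sub (by fun_prop)) (fun z hz => ?_) hy (by norm_num)
    have hz' : DifferentiableAt ℝ u z := (hd z hz).differentiableAt (isOpen_Ioo.mem_nhds hz)
    have := hz'.hasDerivAt.sub ((hasDerivAt_id z).const_mul c)
    rw [show (fun y => u y - c * y) = u - fun y => c * id y from rfl, this.deriv, hc z hz]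
    simp
  have hcl : EqOn u (fun y => c * y + e) (Icc (-1) 1) := by
    have h := (show EqOn u (fun y => c * y + e) (Ioo (-1) 1) from fun y hy => by
      have := he y hy; simp only; linarith)
    refine h.of_subset_closure hu.continuousOn (by fun_prop) Ioo_subset_Icc_self ?_
    rw [closure_Ioo (by norm_num)]
  have e1 := hcl (show (-1 : ℝ) ∈ Icc (-1 : ℝ) 1 by norm_num)
  have e2 := hcl (show (1 : ℝ) ∈ Icc (-1 : ℝ) 1 by norm_num)
  simp only at e1 e2
  intro y hy
  rw [hcl hy]
  simp only [interp]
  rw [← ha, ← hb, e1, e2]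
  ring

theorem interp_mem_fugacities {a b y : ℝ} (ha : a ∈ fugacities g) (hb : b ∈ fugacities g)
    (hy : y ∈ Icc (-1 : ℝ) 1) : interp a b y ∈ fugacities g := by
  have hm : max a b ∈ fugacities g := by rcases max_choice a b with h | h <;> rwa [h]
  exact fugacities_ordConnected (a := min a b) (lt_min ha.1 hb.1) hm
    (interp_mem_Icc ⟨min_le_left _ _, le_max_left _ _⟩ ⟨min_le_right _ _, le_max_right _ _⟩ hy)

theorem solvesLaplace_iff_eqOn (hgpos : ∀ k, 0 < k → 0 < g k) {a b : ℝ} (ha : a ∈ fugacities g)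
    (hb : b ∈ fugacities g) :
    SolvesLaplace g a b (fun y => meanDensity g (interp a b y)) ∧
      ∀ ρ, SolvesLaplace g a b ρ →
        EqOn ρ (fun y => meanDensity g (interp a b y)) (Icc (-1) 1) := by
  have key : EqOn (fun y => fugacity g (meanDensity g (interp a b y))) (interp a b)
      (Icc (-1) 1) := fun y hy => fugacity_meanDensity hgpos (interp_mem_fugacities ha hb hy)
  have hcd : ContDiff ℝ 2 (interp a b) := by unfold interp; fun_prop
  refine ⟨⟨fun y hy => ⟨_, interp_mem_fugacities ha hb hy, rfl⟩,
    hcd.contDiffOn.congr key, fun y hy => ?_, ?_, ?_⟩, fun ρ hρ y hy => ?_⟩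
  · have : (fun y => fugacity g (meanDensity g (interp a b y))) =ᶠ[𝓝 y] interp a b :=
      Filter.eventuallyEq_of_mem (Icc_mem_nhds hy.1 hy.2) key
    rw [this.iteratedDeriv_eq, iteratedDeriv_succ, iteratedDeriv_one]
    have h1 : deriv (interp a b) = fun _ => (b - a) / 2 := by
      ext z
      have : HasDerivAt (interp a b) ((b - a) / 2) z := by
        unfold interp
        simpa using ((hasDerivAt_id z).const_mul ((b - a) / 2)).add_const ((b + a) / 2)
      exact this.deriv
    rw [h1, deriv_const]
  · refine (key (by norm_num)).trans ?_
    unfold interp; ring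
  · refine (key (by norm_num)).trans ?_
    unfold interp; ring
  · have := eqOn_interp_of_iteratedDeriv_two_eq_zero hρ.smooth hρ.laplace hρ.left hρ.right hy
    simp only at this
    rw [← meanDensity_fugacity (hρ.mem y hy), this]


/-! ### Product weights on `ι → ℕ` and resampling of coordinates -/

theorem tsum_mul_mul_mul {X : Type*} (W A B : X → ℝ≥0∞) :
    ∑' q : X × X, W q.1 * W q.2 * (A q.1 * B q.2)
      = (∑' η, W η * A η) * ∑' η, W η * B η := by
  rw [ENNReal.tsum_prod (f := fun η ζ => W η * W ζ * (A η * B ζ)), ← ENNReal.tsum_mul_right]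
  refine tsum_congr fun η => ?_
  rw [← ENNReal.tsum_mul_left]
  exact tsum_congr fun ζ => by ring

section Product

variable {ι : Type*} [DecidableEq ι]

/-- A probability weight on `ι → ℕ` under which coordinates may be exchanged between two independent
copies, as under a product measure. -/
structure IsProductWeight (W : (ι → ℕ) → ℝ≥0∞) : Prop where
  tsum_eq_one : ∑' η, W η = 1
  piecewise_mul : ∀ (S : Finset ι) (η ζ : ι → ℕ),
    W (S.piecewise ζ η) * W (S.piecewise η ζ) = W η * W ζ

/-- The exchange of the coordinates in `S` between two configurations. -/
def exchange (S : Finset ι) : (ι → ℕ) × (ι → ℕ) ≃ (ι → ℕ) × (ι → ℕ) where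
  toFun q := (S.piecewise q.2 q.1, S.piecewise q.1 q.2)
  invFun q := (S.piecewise q.2 q.1, S.piecewise q.1 q.2)
  left_inv q := by
    ext i <;> by_cases hi : i ∈ S <;> simp [Finset.piecewise, hi]
  right_inv q := by
    ext i <;> by_cases hi : i ∈ S <;> simp [Finset.piecewise, hi]

variable {W : (ι → ℕ) → ℝ≥0∞}

theorem IsProductWeight.tsum_exchange (hW : IsProductWeight W) (S : Finset ι)
    (F : (ι → ℕ) → (ι → ℕ) → ℝ≥0∞) :
    ∑' q : (ι → ℕ) × (ι → ℕ), W q.1 * W q.2 * F (S.piecewise q.2 q.1) (S.piecewise q.1 q.2)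
      = ∑' q : (ι → ℕ) × (ι → ℕ), W q.1 * W q.2 * F q.1 q.2 := by
  rw [← (exchange S).tsum_eq (fun q => W q.1 * W q.2 * F q.1 q.2)]
  refine tsum_congr fun q => ?_
  simp only [exchange, Equiv.coe_fn_mk]
  rw [hW.piecewise_mul]

theorem IsProductWeight.tsum_fst (hW : IsProductWeight W) (A : (ι → ℕ) → ℝ≥0∞) :
    ∑' q : (ι → ℕ) × (ι → ℕ), W q.1 * W q.2 * A q.1 = ∑' η, W η * A η := by
  simpa [hW.tsum_eq_one] using tsum_mul_mul_mul W A 1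

/-- Functions of disjoint sets of coordinates are independent. -/
theorem IsProductWeight.tsum_mul (hW : IsProductWeight W) {S T : Finset ι} (hST : Disjoint S T)
    {A B : (ι → ℕ) → ℝ≥0∞} (hA : DependsOn A S) (hB : DependsOn B T) :
    ∑' η, W η * (A η * B η) = (∑' η, W η * A η) * ∑' η, W η * B η := by
  rw [← hW.tsum_fst (fun η => A η * B η), mul_comm, ← tsum_mul_mul_mul W B A,
    ← hW.tsum_exchange S (fun η _ => A η * B η)]
  refine tsum_congr fun q => ?_
  congr 1
  rw [mul_comm]
  congr 1
  · refine hB fun i hi => ?_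
    have : i ∉ S := fun h => Finset.disjoint_left.1 hST h hi
    simp [Finset.piecewise, this]
  · refine hA fun i hi => ?_
    have : i ∈ S := hi
    simp [Finset.piecewise, this]

theorem IsProductWeight.tsum_prod (hW : IsProductWeight W) {κ : Type*}
    (I : Finset κ) {S : κ → Finset ι} {A : κ → (ι → ℕ) → ℝ≥0∞}
    (hA : ∀ i ∈ I, DependsOn (A i) (S i))
    (hS : ∀ i ∈ I, ∀ j ∈ I, i ≠ j → Disjoint (S i) (S j)) :
    ∑' η, W η * ∏ i ∈ I, A i η = ∏ i ∈ I, ∑' η, W η * A i η := by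
  classical
  induction I using Finset.induction_on with
  | empty => simp [hW.tsum_eq_one]
  | insert i I hi ih =>
    simp only [Finset.prod_insert hi]
    rw [← ih (fun j hj => hA j (Finset.mem_insert_of_mem hj))
      (fun j hj k hk => hS j (Finset.mem_insert_of_mem hj) k (Finset.mem_insert_of_mem hk))]
    refine hW.tsum_mul (S := S i) (T := I.biUnion S) ?_ (hA i (Finset.mem_insert_self _ _)) ?_
    · rw [Finset.disjoint_biUnion_right]
      intro j hj
      exact hS i (Finset.mem_insert_self _ _) j (Finset.mem_insert_of_mem hj)
        (fun h => hi (h ▸ hj))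
    · intro η ζ h
      refine Finset.prod_congr rfl fun j hj => hA j (Finset.mem_insert_of_mem hj) fun k hk => ?_
      exact h k (Finset.mem_coe.2 (Finset.mem_biUnion.2 ⟨j, hj, hk⟩))

/-- The mean change of the density `f` when the coordinates in `S` are resampled. -/
noncomputable def resampling (W : (ι → ℕ) → ℝ≥0∞) (f : (ι → ℕ) → ℝ) (S : Finset ι) : ℝ≥0∞ :=
  ∑' q : (ι → ℕ) × (ι → ℕ), W q.1 * W q.2 * ENNReal.ofReal |f (S.piecewise q.2 q.1) - f q.1|

theorem IsProductWeight.resampling_insert_le (hW : IsProductWeight W) (f : (ι → ℕ) → ℝ)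
    {S : Finset ι} {x : ι} (hx : x ∉ S) :
    resampling W f (insert x S) ≤ resampling W f {x} + resampling W f S := by
  unfold resampling
  rw [← hW.tsum_exchange {x}
    (fun η ζ => ENNReal.ofReal |f (S.piecewise ζ η) - f η|), ← ENNReal.tsum_add]
  refine ENNReal.tsum_le_tsum fun q => ?_
  rw [← mul_add]
  gcongr
  rw [← ENNReal.ofReal_add (abs_nonneg _) (abs_nonneg _)]
  refine ENNReal.ofReal_le_ofReal ?_
  have : S.piecewise (({x} : Finset ι).piecewise q.1 q.2) (({x} : Finset ι).piecewise q.2 q.1)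
      = (insert x S).piecewise q.2 q.1 := by
    ext i
    by_cases hi : i = x
    · subst hi; simp [Finset.piecewise, hx]
    · by_cases hiS : i ∈ S <;> simp [Finset.piecewise, hi, hiS]
  rw [this, add_comm]
  exact abs_sub_le _ _ _

theorem IsProductWeight.resampling_le_sum (hW : IsProductWeight W) (f : (ι → ℕ) → ℝ)
    (S : Finset ι) : resampling W f S ≤ ∑ x ∈ S, resampling W f {x} := by
  induction S using Finset.induction_on with
  | empty => simp [resampling]
  | insert x S hx ih =>
    rw [Finset.sum_insert hx]
    exact (hW.resampling_insert_le f hx).trans (by gcongr)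

theorem IsProductWeight.resampling_le_two (hW : IsProductWeight W) {f : (ι → ℕ) → ℝ}
    (hf0 : ∀ η, 0 ≤ f η) (hf : ∑' η, W η * ENNReal.ofReal (f η) = 1) (S : Finset ι) :
    resampling W f S ≤ 2 := by
  have h : resampling W f S ≤ ∑' q : (ι → ℕ) × (ι → ℕ), (W q.1 * W q.2 *
      ENNReal.ofReal (f (S.piecewise q.2 q.1)) + W q.1 * W q.2 * ENNReal.ofReal (f q.1)) := by
    refine ENNReal.tsum_le_tsum fun q => ?_
    rw [← mul_add, ← ENNReal.ofReal_add (hf0 _) (hf0 _)]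
    gcongr
    rw [abs_le]
    constructor <;> linarith [hf0 (S.piecewise q.2 q.1), hf0 q.1]
  refine h.trans ?_
  rw [ENNReal.tsum_add, hW.tsum_exchange S (fun η _ => ENNReal.ofReal (f η)),
    hW.tsum_fst (fun η => ENNReal.ofReal (f η)), hf, one_add_one_eq_two]

/-- Replacement of the coordinates in `S` by independent ones. -/
theorem IsProductWeight.tsum_le_add_resampling (hW : IsProductWeight W) {f : (ι → ℕ) → ℝ}
    (hf0 : ∀ η, 0 ≤ f η) (hf : ∑' η, W η * ENNReal.ofReal (f η) = 1) {S : Finset ι}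
    {Φ : (ι → ℕ) → ℝ≥0∞} (hΦ : DependsOn Φ S) {B : ℝ≥0∞} (hB : ∀ η, Φ η ≤ B) :
    ∑' η, W η * (ENNReal.ofReal (f η) * Φ η) ≤ ∑' η, W η * Φ η + B * resampling W f S := by
  have h1 : ∑' η, W η * Φ η
      = ∑' q : (ι → ℕ) × (ι → ℕ), W q.1 * W q.2 * (ENNReal.ofReal (f q.1) * Φ q.2) := by
    rw [tsum_mul_mul_mul W (fun η => ENNReal.ofReal (f η)) Φ, hf, one_mul]
  rw [h1, ← hW.tsum_fst (fun η => ENNReal.ofReal (f η) * Φ η), resampling, ← ENNReal.tsum_mul_left,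
    ← hW.tsum_exchange S (fun η _ => ENNReal.ofReal (f η) * Φ η), ← ENNReal.tsum_add]
  refine ENNReal.tsum_le_tsum fun q => ?_
  have h2 : Φ (S.piecewise q.2 q.1) = Φ q.2 := hΦ fun i hi => by
    have : i ∈ S := hi
    simp [Finset.piecewise, this]
  have h3 : ENNReal.ofReal (f (S.piecewise q.2 q.1))
      ≤ ENNReal.ofReal (f q.1) + ENNReal.ofReal |f (S.piecewise q.2 q.1) - f q.1| := by
    rw [← ENNReal.ofReal_add (hf0 _) (abs_nonneg _)]
    refine ENNReal.ofReal_le_ofReal ?_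
    linarith [le_abs_self (f (S.piecewise q.2 q.1) - f q.1)]
  rw [h2]
  calc _ ≤ W q.1 * W q.2 * ((ENNReal.ofReal (f q.1)
          + ENNReal.ofReal |f (S.piecewise q.2 q.1) - f q.1|) * Φ q.2) := by gcongr
    _ = W q.1 * W q.2 * (ENNReal.ofReal (f q.1) * Φ q.2)
        + Φ q.2 * (W q.1 * W q.2 * ENNReal.ofReal |f (S.piecewise q.2 q.1) - f q.1|) := by ring
    _ ≤ _ := by gcongr; exact hB _

theorem abs_sub_le_sum_abs_sub_succ (u : ℕ → ℝ) {m i j : ℕ} (hi : i ≤ m) (hj : j ≤ m) :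
    |u i - u j| ≤ ∑ k ∈ Finset.range m, |u (k + 1) - u k| := by
  wlog hij : j ≤ i generalizing i j
  · rw [abs_sub_comm]; exact this hj hi (le_of_not_ge hij)
  rw [← Finset.sum_Ico_sub u hij]
  refine (Finset.abs_sum_le_sum_abs _ _).trans
    (Finset.sum_le_sum_of_subset_of_nonneg ?_ fun _ _ _ => abs_nonneg _)
  intro k hk
  simp only [Finset.mem_Ico, Finset.mem_range] at *
  omega

theorem piecewise_singleton_eq_update (x : ι) (η ζ : ι → ℕ) :
    ({x} : Finset ι).piecewise ζ η = Function.update η x (ζ x) := by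
  ext i
  by_cases hi : i = x
  · subst hi; simp
  · simp [hi]

/-- Resampling one coordinate is controlled by the change of `f` when a particle is added there. -/
theorem IsProductWeight.resampling_singleton_le (hW : IsProductWeight W) {f : (ι → ℕ) → ℝ}
    (hf0 : ∀ η, 0 ≤ f η) (hf : ∑' η, W η * ENNReal.ofReal (f η) = 1) (x : ι) {M : ℕ → ℝ≥0∞}
    (hM : ∀ j, ∑' η, W η * (if η x = j then 1 else 0) = M j)
    (hM0 : ∀ j, M j ≠ 0) (hMt : ∀ j, M j ≠ ∞) (m : ℕ) :
    resampling W f {x} ≤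
      (∑ j ∈ Finset.range m, (M j)⁻¹) *
        ∑' η, W η * ENNReal.ofReal |f (Function.update η x (η x + 1)) - f η|
      + 2 * (∑' η, W η * (ENNReal.ofReal (f η) * (if m < η x then 1 else 0))
        + ∑' η, W η * (if m < η x then 1 else 0)) := by
  set τ : (ι → ℕ) → ℝ≥0∞ := fun η => if m < η x then 1 else 0 with hτ
  set D : ℕ → (ι → ℕ) → ℝ≥0∞ := fun j η =>
    ENNReal.ofReal |f (Function.update η x (j + 1)) - f (Function.update η x j)| with hD
  have hpt : ∀ q : (ι → ℕ) × (ι → ℕ), W q.1 * W q.2 *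
      ENNReal.ofReal |f (({x} : Finset ι).piecewise q.2 q.1) - f q.1| ≤
      W q.1 * W q.2 * (∑ j ∈ Finset.range m, D j q.1)
      + (W q.1 * W q.2 * (ENNReal.ofReal (f q.1) * (τ q.1 + τ q.2))
        + W q.1 * W q.2 *
          (ENNReal.ofReal (f (({x} : Finset ι).piecewise q.2 q.1)) *
            (τ (({x} : Finset ι).piecewise q.1 q.2) + τ (({x} : Finset ι).piecewise q.2 q.1)))) := by
    intro q
    rw [← mul_add, ← mul_add]
    gcongr
    have e1 : τ (({x} : Finset ι).piecewise q.1 q.2) = τ q.1 := by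
      simp [hτ]
    have e2 : τ (({x} : Finset ι).piecewise q.2 q.1) = τ q.2 := by
      simp [hτ]
    rw [e1, e2]
    by_cases h : q.1 x ≤ m ∧ q.2 x ≤ m
    · refine le_add_right ?_
      simp only [hD]
      rw [← ENNReal.ofReal_sum_of_nonneg fun _ _ => abs_nonneg _]
      refine ENNReal.ofReal_le_ofReal ?_
      have := abs_sub_le_sum_abs_sub_succ (fun k => f (Function.update q.1 x k)) h.2 h.1
      simpa [piecewise_singleton_eq_update] using this
    · have h1 : 1 ≤ τ q.1 + τ q.2 := by
        simp only [hτ]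
        by_cases h' : m < q.1 x
        · simp [h']
        · have : m < q.2 x := by
            by_contra h''
            exact h ⟨by omega, by omega⟩
          simp [this]
      refine le_add_left ?_
      rw [← add_mul, ← ENNReal.ofReal_add (hf0 _) (hf0 _)]
      calc _ ≤ ENNReal.ofReal (f q.1 + f (({x} : Finset ι).piecewise q.2 q.1)) * 1 := by
            rw [mul_one]
            refine ENNReal.ofReal_le_ofReal ?_
            rw [abs_le]
            constructor <;> linarith [hf0 (({x} : Finset ι).piecewise q.2 q.1), hf0 q.1]
        _ ≤ _ := by gcongr
  refine (ENNReal.tsum_le_tsum hpt).trans ?_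
  rw [ENNReal.tsum_add, ENNReal.tsum_add]
  refine add_le_add ?_ ?_
  · rw [hW.tsum_fst (fun η => ∑ j ∈ Finset.range m, D j η), Finset.sum_mul]
    simp only [Finset.mul_sum]
    rw [Summable.tsum_finsetSum (fun _ _ => ENNReal.summable)]
    refine Finset.sum_le_sum fun j _ => ?_
    have e : ∑' η, W η * ENNReal.ofReal |f (Function.update η x (η x + 1)) - f η|
        = ∑' q : (ι → ℕ) × (ι → ℕ), W q.1 * W q.2 *
          ENNReal.ofReal |f (Function.update q.1 x (q.2 x + 1))
            - f (Function.update q.1 x (q.2 x))| := by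
      rw [← hW.tsum_fst (fun η => ENNReal.ofReal |f (Function.update η x (η x + 1)) - f η|),
        ← hW.tsum_exchange {x}
          (fun η _ => ENNReal.ofReal |f (Function.update η x (η x + 1)) - f η|)]
      refine tsum_congr fun q => ?_
      simp [piecewise_singleton_eq_update]
    rw [e, ← one_mul (∑' η, W η * D j η), ← ENNReal.inv_mul_cancel (hM0 j) (hMt j), mul_assoc]
    gcongr
    rw [← hM j, mul_comm, ← tsum_mul_mul_mul W (D j)]
    refine ENNReal.tsum_le_tsum fun q => ?_
    gcongr
    by_cases hj : q.2 x = j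
    · simp [hD, hj]
    · simp [hj]
  · rw [hW.tsum_exchange {x} (fun η ζ => ENNReal.ofReal (f η) * (τ ζ + τ η)), two_mul]
    have e : ∑' q : (ι → ℕ) × (ι → ℕ), W q.1 * W q.2 * (ENNReal.ofReal (f q.1) * (τ q.1 + τ q.2))
        = ∑' η, W η * (ENNReal.ofReal (f η) * τ η) + ∑' η, W η * τ η := by
      simp only [mul_add]
      rw [ENNReal.tsum_add, hW.tsum_fst (fun η => ENNReal.ofReal (f η) * τ η),
        tsum_mul_mul_mul W (fun η => ENNReal.ofReal (f η)) τ, hf, one_mul]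
    refine add_le_add e.le (le_of_eq ?_)
    rw [← e]
    exact tsum_congr fun q => by rw [add_comm (τ q.2)]

/-- Reindexing by the configuration before a particle is added at `x`. -/
theorem tsum_update_succ {R : Type*} [AddCommMonoid R] [TopologicalSpace R] (x : ι)
    {F : (ι → ℕ) → R} (hF : ∀ η, η x = 0 → F η = 0) :
    ∑' η : ι → ℕ, F (Function.update η x (η x + 1)) = ∑' η, F η := by
  have hinj : Function.Injective fun η : ι → ℕ => Function.update η x (η x + 1) := by
    intro η ζ h
    ext y
    have := congrFun h y
    by_cases hy : y = x
    · subst hy; simpa using this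
    · simpa [hy] using this
  refine hinj.tsum_eq fun η hη => ?_
  have hx : η x ≠ 0 := fun h => hη (hF η h)
  refine ⟨Function.update η x (η x - 1), ?_⟩
  ext y
  by_cases hy : y = x
  · subst hy; simp; omega
  · simp [hy]

end Product


/-! ### Relative entropy of weights on a countable space -/

open InformationTheory in
/-- The relative entropy of the weight `p` with respect to the positive weight `ν`. -/
noncomputable def relEntropy {X : Type*} (p ν : X → ℝ) : ℝ≥0∞ :=
  ∑' η, ENNReal.ofReal (ν η * klFun (p η / ν η))

open InformationTheory in
theorem mul_le_klFun_add_exp {u : ℝ} (hu : 0 ≤ u) (a : ℝ) :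
    u * a ≤ klFun u + Real.exp a - 1 := by
  rcases hu.eq_or_lt with rfl | hu
  · simp only [zero_mul, klFun_zero]; linarith [Real.exp_pos a]
  · have h := Real.add_one_le_exp (a - Real.log u)
    rw [Real.exp_sub, Real.exp_log hu, le_div_iff₀ hu] at h
    rw [klFun_apply]
    nlinarith

/-- The entropy inequality. -/
theorem tsum_mul_le_relEntropy_add {X : Type*} {p ν V : X → ℝ} (hν : ∀ η, 0 < ν η)
    (hp : ∀ η, 0 ≤ p η) (hν1 : ∑' η, ENNReal.ofReal (ν η) = 1)
    (hp1 : ∑' η, ENNReal.ofReal (p η) = 1) (hV : ∀ η, 0 ≤ V η) {c : ℝ} (hc0 : 0 ≤ c)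
    (hc : ∑' η, ENNReal.ofReal (ν η * Real.exp (V η)) ≤ ENNReal.ofReal (Real.exp c)) :
    ∑' η, ENNReal.ofReal (p η * V η) ≤ relEntropy p ν + ENNReal.ofReal c := by
  have key : ∑' η, ENNReal.ofReal (p η * V η) + ∑' η, ENNReal.ofReal (ν η)
      ≤ relEntropy p ν + (ENNReal.ofReal (Real.exp (-c)) * ∑' η, ENNReal.ofReal
        (ν η * Real.exp (V η))) + ENNReal.ofReal c * ∑' η, ENNReal.ofReal (p η) := by
    unfold relEntropy
    rw [← ENNReal.tsum_mul_left, ← ENNReal.tsum_mul_left, ← ENNReal.tsum_add, ← ENNReal.tsum_add,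
      ← ENNReal.tsum_add]
    refine ENNReal.tsum_le_tsum fun η => ?_
    have h0 := hν η
    have h1 := hp η
    have h2 := hV η
    have h3 : 0 ≤ p η / ν η := by positivity
    have h4 := InformationTheory.klFun_nonneg h3
    rw [← ENNReal.ofReal_mul (by positivity), ← ENNReal.ofReal_mul (by positivity),
      ← ENNReal.ofReal_add (by positivity) (by positivity),
      ← ENNReal.ofReal_add (by positivity) (by positivity),
      ← ENNReal.ofReal_add (by positivity) (by positivity)]
    refine ENNReal.ofReal_le_ofReal ?_
    have h5 := mul_le_mul_of_nonneg_left (mul_le_klFun_add_exp h3 (V η - c)) h0.le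
    have h6 : ν η * (p η / ν η * (V η - c)) = p η * (V η - c) := by field_simp
    have h7 : Real.exp (V η - c) = Real.exp (-c) * Real.exp (V η) := by
      rw [← Real.exp_add]; ring_nf
    rw [h6, h7] at h5
    linarith
  have h8 : ENNReal.ofReal (Real.exp (-c)) * ∑' η, ENNReal.ofReal (ν η * Real.exp (V η)) ≤ 1 := by
    calc _ ≤ ENNReal.ofReal (Real.exp (-c)) * ENNReal.ofReal (Real.exp c) := by gcongr
      _ = 1 := by rw [← ENNReal.ofReal_mul (Real.exp_pos _).le, ← Real.exp_add]; simp
  rw [hν1, hp1, mul_one] at key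
  have : ∑' η, ENNReal.ofReal (p η * V η) + 1 ≤ relEntropy p ν + ENNReal.ofReal c + 1 := by
    refine key.trans ?_
    rw [add_assoc, add_assoc, add_comm (ENNReal.ofReal c)]
    gcongr
  exact (ENNReal.add_le_add_iff_right ENNReal.one_ne_top).1 this

theorem abs_sub_le_sq_sqrt_sub {u v θ : ℝ} (hu : 0 ≤ u) (hv : 0 ≤ v) (hθ : 0 < θ) :
    |u - v| ≤ θ⁻¹ * (√u - √v) ^ 2 + θ * (u + v) := by
  have h1 : u - v = (√u - √v) * (√u + √v) := by
    nlinarith [Real.sq_sqrt hu, Real.sq_sqrt hv]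
  have h2 : (√u + √v) ^ 2 ≤ 2 * (u + v) := by
    nlinarith [Real.sq_sqrt hu, Real.sq_sqrt hv, sq_nonneg (√u - √v)]
  have h4 : (0 : ℝ) < θ⁻¹ := inv_pos.2 hθ
  have h5 : θ⁻¹ * θ = 1 := inv_mul_cancel₀ hθ.ne'
  have h3 : ∀ d s : ℝ, |d * s| ≤ θ⁻¹ * d ^ 2 + θ * (s ^ 2 / 2) := fun d s => by
    rw [abs_le]
    constructor <;>
    nlinarith [mul_nonneg h4.le (sq_nonneg (d - θ * s)), mul_nonneg h4.le (sq_nonneg (d + θ * s)),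
      mul_nonneg h4.le (sq_nonneg d), mul_nonneg hθ.le (sq_nonneg s),
      mul_self_nonneg s, mul_self_nonneg d]
  rw [h1]
  refine (h3 _ _).trans ?_
  gcongr
  linarith

/-! ### The product measures -/

section ProdProb

variable {ι : Type*} [Fintype ι] {g : ℕ → ℝ}

/-- The weights of the inhomogeneous product measure with fugacity `lam x` at `x`. -/
noncomputable def prodProb (g : ℕ → ℝ) (lam : ι → ℝ) (η : ι → ℕ) : ℝ :=
  ∏ x, siteProb g (lam x) (η x)

theorem prodProb_pos (hgpos : ∀ k, 0 < k → 0 < g k) {lam : ι → ℝ}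
    (hlam : ∀ x, lam x ∈ fugacities g) (η : ι → ℕ) : 0 < prodProb g lam η :=
  Finset.prod_pos fun x _ => siteProb_pos hgpos (hlam x) _

theorem pi_siteMeasure_singleton (hgpos : ∀ k, 0 < k → 0 < g k) {lam : ι → ℝ}
    (hlam : ∀ x, lam x ∈ fugacities g) (η : ι → ℕ) :
    (Measure.pi fun x => siteMeasure g (lam x)) {η} = ENNReal.ofReal (prodProb g lam η) := by
  have := fun x => isProbabilityMeasure_siteMeasure hgpos (hlam x)
  rw [Measure.pi_singleton, prodProb,
    ENNReal.ofReal_prod_of_nonneg fun x _ => (siteProb_pos hgpos (hlam x) _).le]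
  simp only [siteMeasure_singleton]

theorem lintegral_pi_siteMeasure (hgpos : ∀ k, 0 < k → 0 < g k) {lam : ι → ℝ}
    (hlam : ∀ x, lam x ∈ fugacities g) (F : (ι → ℕ) → ℝ≥0∞) :
    ∫⁻ η, F η ∂(Measure.pi fun x => siteMeasure g (lam x))
      = ∑' η, ENNReal.ofReal (prodProb g lam η) * F η := by
  rw [lintegral_countable']
  exact tsum_congr fun η => by rw [pi_siteMeasure_singleton hgpos hlam, mul_comm]

theorem tsum_prodProb (hgpos : ∀ k, 0 < k → 0 < g k) {lam : ι → ℝ}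
    (hlam : ∀ x, lam x ∈ fugacities g) : ∑' η, ENNReal.ofReal (prodProb g lam η) = 1 := by
  have := fun x => isProbabilityMeasure_siteMeasure hgpos (hlam x)
  have := lintegral_pi_siteMeasure hgpos hlam fun _ => 1
  simpa using this.symm

theorem tsum_prodProb_eval (hgpos : ∀ k, 0 < k → 0 < g k) {lam : ι → ℝ}
    (hlam : ∀ x, lam x ∈ fugacities g) (x : ι) (H : ℕ → ℝ≥0∞) :
    ∑' η, ENNReal.ofReal (prodProb g lam η) * H (η x)
      = ∑' k, ENNReal.ofReal (siteProb g (lam x) k) * H k := by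
  have := fun x => isProbabilityMeasure_siteMeasure hgpos (hlam x)
  rw [← lintegral_pi_siteMeasure hgpos hlam fun η => H (η x),
    (measurePreserving_eval (fun x => siteMeasure g (lam x)) x).lintegral_comp
      (measurable_of_countable H), lintegral_countable']
  exact tsum_congr fun k => by rw [siteMeasure_singleton, mul_comm]

variable [DecidableEq ι]

theorem isProductWeight_prodProb (hgpos : ∀ k, 0 < k → 0 < g k) {lam : ι → ℝ}
    (hlam : ∀ x, lam x ∈ fugacities g) :
    IsProductWeight fun η => ENNReal.ofReal (prodProb g lam η) where
  tsum_eq_one := tsum_prodProb hgpos hlam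
  piecewise_mul S η ζ := by
    rw [← ENNReal.ofReal_mul (prodProb_pos hgpos hlam _).le,
      ← ENNReal.ofReal_mul (prodProb_pos hgpos hlam _).le]
    unfold prodProb
    rw [← Finset.prod_mul_distrib, ← Finset.prod_mul_distrib]
    congr 1
    refine Finset.prod_congr rfl fun x _ => ?_
    by_cases hx : x ∈ S
    · simp [Finset.piecewise, hx, mul_comm]
    · simp [Finset.piecewise, hx]

theorem prodProb_update_succ_mul (hgpos : ∀ k, 0 < k → 0 < g k) (lam : ι → ℝ) (η : ι → ℕ) (x : ι) :
    prodProb g lam (Function.update η x (η x + 1)) * g (η x + 1) = lam x * prodProb g lam η := by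
  unfold prodProb
  rw [← Finset.mul_prod_erase _ _ (Finset.mem_univ x),
    ← Finset.mul_prod_erase _ (fun y => siteProb g (lam y) (η y)) (Finset.mem_univ x)]
  have : ∏ y ∈ Finset.univ.erase x, siteProb g (lam y) (Function.update η x (η x + 1) y)
      = ∏ y ∈ Finset.univ.erase x, siteProb g (lam y) (η y) :=
    Finset.prod_congr rfl fun y hy => by
      rw [Function.update_of_ne (Finset.ne_of_mem_erase hy)]
  rw [this, Function.update_self]
  linear_combination (∏ y ∈ Finset.univ.erase x, siteProb g (lam y) (η y)) *
    siteProb_succ_mul hgpos (lam x) (η x)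

theorem tsum_prodProb_exp_le (hgpos : ∀ k, 0 < k → 0 < g k) {lam : ι → ℝ} {b γ : ℝ}
    (hlam : ∀ x, lam x ∈ fugacities g) (hlb : ∀ x, lam x ≤ b)
    (hs : Summable (weight g (b * Real.exp γ))) :
    ∑' η, ENNReal.ofReal (prodProb g lam η * Real.exp (γ * ∑ x, (η x : ℝ))) ≤
      ENNReal.ofReal (Real.exp (Fintype.card ι * Real.log (partitionFn g (b * Real.exp γ)))) := by
  have e1 : ∀ η : ι → ℕ, ENNReal.ofReal (prodProb g lam η * Real.exp (γ * ∑ x, (η x : ℝ)))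
      = ENNReal.ofReal (prodProb g lam η) * ∏ x, ENNReal.ofReal (Real.exp (γ * η x)) := fun η => by
    rw [ENNReal.ofReal_mul (prodProb_pos hgpos hlam η).le, Finset.mul_sum, Real.exp_sum,
      ENNReal.ofReal_prod_of_nonneg fun x _ => (Real.exp_pos _).le]
  simp only [e1]
  rw [(isProductWeight_prodProb hgpos hlam).tsum_prod Finset.univ (S := fun x => {x})
    (A := fun x η => ENNReal.ofReal (Real.exp (γ * η x)))
    (fun x _ η ζ h => by simp only; rw [h x (by simp)])
    (fun x _ y _ h => by simpa using h)]
  by_cases hι : IsEmpty ι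
  · simp
  obtain ⟨x₀⟩ := not_isEmpty_iff.1 hι
  have hb0 : 0 ≤ b * Real.exp γ :=
    mul_nonneg ((hlam x₀).1.le.trans (hlb x₀)) (Real.exp_pos _).le
  have hZ := one_le_partitionFn hgpos hb0 hs
  rw [Real.exp_nat_mul, Real.exp_log (by positivity), ENNReal.ofReal_pow (by positivity)]
  refine Finset.prod_le_pow_card _ _ _ fun x _ => ?_
  rw [tsum_prodProb_eval hgpos hlam x fun k => ENNReal.ofReal (Real.exp (γ * k))]
  have hs' : Summable (weight g (lam x * Real.exp γ)) :=
    hs.of_nonneg_of_le (weight_nonneg hgpos (mul_nonneg (hlam x).1.le (Real.exp_pos _).le))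
      (weight_mono hgpos (mul_nonneg (hlam x).1.le (Real.exp_pos _).le)
        (mul_le_mul_of_nonneg_right (hlb x) (Real.exp_pos _).le))
  have h1 := hasSum_siteProb_mul_pow hs'
  have e2 : ∀ k : ℕ, ENNReal.ofReal (siteProb g (lam x) k) * ENNReal.ofReal (Real.exp (γ * k))
      = ENNReal.ofReal (siteProb g (lam x) k * Real.exp γ ^ k) := fun k => by
    rw [← ENNReal.ofReal_mul (siteProb_pos hgpos (hlam x) k).le, ← Real.exp_nat_mul, mul_comm γ]
  simp only [e2]
  rw [← ENNReal.ofReal_tsum_of_nonneg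
    (fun k => mul_nonneg (siteProb_pos hgpos (hlam x) k).le (by positivity)) h1.summable, h1.tsum_eq]
  refine ENNReal.ofReal_le_ofReal ?_
  have hZl := one_le_partitionFn hgpos (hlam x).1.le (fugacities_summable hgpos (hlam x))
  have hm := partitionFn_mono hgpos (mul_nonneg (hlam x).1.le (Real.exp_pos _).le)
    (mul_le_mul_of_nonneg_right (hlb x) (Real.exp_pos γ).le) hs
  have h0 : 0 ≤ partitionFn g (lam x * Real.exp γ) := zero_le_one.trans
    (one_le_partitionFn hgpos (mul_nonneg (hlam x).1.le (Real.exp_pos _).le) hs')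
  exact (div_le_self h0 hZl).trans hm

end ProdProb


/-! ### Joint measurability of right-continuous processes -/

theorem measurable_uncurry_of_rightContinuous {Ω E : Type*} [MeasurableSpace Ω]
    [TopologicalSpace E] [TopologicalSpace.PseudoMetrizableSpace E] [MeasurableSpace E]
    [BorelSpace E] {X : ℝ≥0 → Ω → E} (hm : ∀ s, Measurable (X s))
    (hr : ∀ ω s, ContinuousWithinAt (fun r => X r ω) (Ici s) s) :
    Measurable fun q : ℝ≥0 × Ω => X q.1 q.2 := by
  set d : ℕ → ℝ≥0 → ℝ≥0 := fun n r => ((⌊r * (n + 1)⌋₊ : ℝ≥0) + 1) / (n + 1) with hd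
  have hle : ∀ n r, r ≤ d n r := fun n r => by
    rw [hd, le_div_iff₀ (by positivity)]
    exact (Nat.lt_floor_add_one _).le
  have hup : ∀ n r, d n r ≤ r + 1 / (n + 1) := fun n r => by
    rw [hd]
    simp only
    rw [add_div]
    gcongr
    rw [div_le_iff₀ (by positivity)]
    exact Nat.floor_le (by positivity)
  have hlim : ∀ r, Tendsto (fun n => d n r) atTop (𝓝[≥] r) := fun r => by
    refine tendsto_nhdsWithin_iff.2 ⟨?_, Eventually.of_forall fun n => hle n r⟩
    have h1 : Tendsto (fun n : ℕ => r + 1 / ((n : ℝ≥0) + 1)) atTop (𝓝 (r + 0)) :=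
      tendsto_const_nhds.add (tendsto_one_div_add_atTop_nhds_zero_nat (𝕜 := ℝ≥0))
    rw [add_zero] at h1
    exact tendsto_of_tendsto_of_tendsto_of_le_of_le tendsto_const_nhds h1
      (fun n => hle n r) (fun n => hup n r)
  refine measurable_of_tendsto_metrizable (f := fun n q => X (d n q.1) q.2) (fun n => ?_) ?_
  · have h1 : Measurable fun q : ℕ × Ω => X (((q.1 : ℝ≥0) + 1) / (n + 1)) q.2 :=
      measurable_from_prod_countable_right fun k => hm (((k : ℝ≥0) + 1) / (n + 1))
    have h2 : Measurable fun q : ℝ≥0 × Ω => (⌊q.1 * (n + 1)⌋₊, q.2) :=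
      (Nat.measurable_floor.comp (measurable_fst.mul_const _)).prodMk measurable_snd
    have h3 := h1.comp h2
    simp only [Function.comp_def] at h3
    simpa only [hd] using h3
  · rw [tendsto_pi_nhds]
    intro q
    exact (hr q.2 q.1).tendsto.comp (hlim q.1)

/-! ### The generator on finitely supported functions -/

section Generator

variable {N : ℕ}

/-- The total number of particles. -/
noncomputable def total (η : Config N) : ℕ := ∑ x, η x

theorem total_update (η : Config N) (x : Box N) (k : ℕ) :
    total (Function.update η x k) + η x = total η + k := by
  unfold total
  rw [Finset.sum_update_of_mem (Finset.mem_univ x), ← Finset.add_sum_erase _ η (Finset.mem_univ x),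
    Finset.sdiff_singleton_eq_erase]
  ring

theorem total_addAt (η : Config N) (x : Box N) : total (addAt η x) = total η + 1 := by
  have := total_update η x (η x + 1)
  unfold addAt; omega

theorem total_le_total_removeAt (η : Config N) (x : Box N) : total η ≤ total (removeAt η x) + 1 := by
  have := total_update η x (η x - 1)
  unfold removeAt; omega

theorem total_le_total_jump (η : Config N) (x : Box N) (y : ℤ) :
    total η ≤ total (jump η x y) + 1 := by
  have := total_le_total_removeAt η x
  unfold jump
  split_ifs
  · rw [total_addAt]; omega
  · exact this

theorem apply_le_total (η : Config N) (x : Box N) : η x ≤ total η :=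
  Finset.single_le_sum (f := η) (fun _ _ => Nat.zero_le _) (Finset.mem_univ x)

theorem finite_total_le (M : ℕ) : {η : Config N | total η ≤ M}.Finite := by
  refine (Set.Finite.pi' (t := fun _ : Box N => Set.Iic M) fun _ => Set.finite_Iic M).subset ?_
  intro η hη x
  exact (apply_le_total η x).trans hη

variable {g : ℕ → ℝ} {α : ℝ}

theorem generator_eq_zero {F : Config N → ℝ} {M : ℕ} (hF : ∀ η, M < total η → F η = 0) (a b : ℝ)
    {η : Config N} (hη : M + 1 < total η) : generator g α N a b F η = 0 := by
  unfold generator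
  have h0 : F η = 0 := hF η (by omega)
  have h1 : ∀ x y, F (jump η x y) = 0 := fun x y =>
    hF _ (by have := total_le_total_jump η x y; omega)
  have h2 : ∀ x, F (addAt η x) = 0 := fun x => hF _ (by rw [total_addAt]; omega)
  simp [h0, h1, h2]

theorem generator_eq_add (a b : ℝ) (F : Config N → ℝ) (η : Config N) :
    generator g α N a b F η = generator g α N 0 0 F η
      + a * ((N : ℝ) ^ (2 + α) / 2 * (F (addAt η (leftEnd N)) - F η))
      + b * ((N : ℝ) ^ (2 + α) / 2 * (F (addAt η (rightEnd N)) - F η)) := by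
  unfold generator; ring

theorem generator_sum {κ : Type*} (S : Finset κ) (a b : ℝ) (c : κ → ℝ) (F : κ → Config N → ℝ)
    (η : Config N) :
    generator g α N a b (fun ξ => ∑ i ∈ S, c i * F i ξ) η
      = ∑ i ∈ S, c i * generator g α N a b (F i) η := by
  classical
  induction S using Finset.induction_on with
  | empty => simp [generator]
  | insert i S hi ih =>
    simp only [Finset.sum_insert hi]
    rw [← ih]
    unfold generator
    have : ∀ x : Box N, g (η x) * ((c i * F i (jump η x ((x : ℤ) + 1)) +
          ∑ j ∈ S, c j * F j (jump η x ((x : ℤ) + 1)) - (c i * F i η + ∑ j ∈ S, c j * F j η)) +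
        (c i * F i (jump η x ((x : ℤ) - 1)) + ∑ j ∈ S, c j * F j (jump η x ((x : ℤ) - 1))
          - (c i * F i η + ∑ j ∈ S, c j * F j η)))
      = c i * (g (η x) * ((F i (jump η x ((x : ℤ) + 1)) - F i η)
          + (F i (jump η x ((x : ℤ) - 1)) - F i η)))
        + g (η x) * ((∑ j ∈ S, c j * F j (jump η x ((x : ℤ) + 1)) - ∑ j ∈ S, c j * F j η)
          + (∑ j ∈ S, c j * F j (jump η x ((x : ℤ) - 1)) - ∑ j ∈ S, c j * F j η)) :=
      fun x => by ring
    simp only [this]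
    rw [Finset.sum_add_distrib, ← Finset.mul_sum]
    ring

theorem exists_total_le_of_finite_support {F : Config N → ℝ} (hF : F.support.Finite) :
    ∃ M, ∀ η, M < total η → F η = 0 := by
  obtain ⟨M, hM⟩ := (hF.image total).bddAbove
  refine ⟨M, fun η h => ?_⟩
  by_contra h0
  exact absurd (hM ⟨η, h0, rfl⟩) (by omega)

end Generator

/-! ### The law of the process and the forward equation -/

section Law

variable {N : ℕ} {Ω : Type*} [MeasurableSpace Ω]

/-- The law of the process at time `s`. -/
noncomputable def law (P : Measure Ω) (η : ℝ≥0 → Ω → Config N) (s : ℝ) (ζ : Config N) : ℝ :=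
  (P.map (η s.toNNReal)).real {ζ}

theorem law_nonneg (P : Measure Ω) (η : ℝ≥0 → Ω → Config N) (s : ℝ) (ζ : Config N) :
    0 ≤ law P η s ζ := measureReal_nonneg

theorem law_max_zero (P : Measure Ω) (η : ℝ≥0 → Ω → Config N) (s : ℝ) (ζ : Config N) :
    law P η (max s 0) ζ = law P η s ζ := by
  unfold law
  congr 3
  ext
  simp

variable {g : ℕ → ℝ} {α : ℝ} {lamL lamR : ℝ → ℝ} {P : Measure Ω}
  {η : ℝ≥0 → Ω → Config N}

theorem ofReal_law (P : Measure Ω) [IsProbabilityMeasure P] (η : ℝ≥0 → Ω → Config N) (s : ℝ)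
    (ζ : Config N) : ENNReal.ofReal (law P η s ζ) = (P.map (η s.toNNReal)) {ζ} :=
  ofReal_measureReal

theorem lintegral_law (P : Measure Ω) [IsProbabilityMeasure P] (η : ℝ≥0 → Ω → Config N) (s : ℝ)
    (hm : Measurable (η s.toNNReal)) (F : Config N → ℝ≥0∞) :
    ∫⁻ ω, F (η s.toNNReal ω) ∂P = ∑' ζ, ENNReal.ofReal (law P η s ζ) * F ζ := by
  rw [← lintegral_map (measurable_of_countable F) hm, lintegral_countable']
  exact tsum_congr fun ζ => by rw [ofReal_law, mul_comm]

theorem tsum_law (P : Measure Ω) [IsProbabilityMeasure P] (η : ℝ≥0 → Ω → Config N) (s : ℝ)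
    (hm : Measurable (η s.toNNReal)) : ∑' ζ, ENNReal.ofReal (law P η s ζ) = 1 := by
  have := lintegral_law P η s hm fun _ => 1
  simpa using this.symm

theorem integral_law (P : Measure Ω) [IsProbabilityMeasure P] (η : ℝ≥0 → Ω → Config N) (s : ℝ)
    (hm : Measurable (η s.toNNReal)) {F : Config N → ℝ} {C : ℝ} (hC : ∀ ζ, |F ζ| ≤ C) :
    ∫ ω, F (η s.toNNReal ω) ∂P = ∑' ζ, law P η s ζ * F ζ := by
  have : IsProbabilityMeasure (P.map (η s.toNNReal)) := Measure.isProbabilityMeasure_map hm.aemeasurable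
  rw [← integral_map hm.aemeasurable (measurable_of_countable F).aestronglyMeasurable,
    integral_countable]
  · rfl
  · exact Integrable.of_bound (measurable_of_countable F).aestronglyMeasurable C
      (ae_of_all _ hC)

theorem IsZeroRangeProcess.measurable_uncurry (hη : IsZeroRangeProcess g α lamL lamR N P η) :
    Measurable fun q : ℝ × Ω => η q.1.toNNReal q.2 :=
  (measurable_uncurry_of_rightContinuous hη.measurable hη.right_cont).comp
    ((measurable_real_toNNReal.comp measurable_fst).prodMk measurable_snd)

/-- The rate of change of the expectation of `F`. -/
noncomputable def forwardRate (g : ℕ → ℝ) (α : ℝ) {N : ℕ} (p : Config N → ℝ) (a b : ℝ)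
    (F : Config N → ℝ) : ℝ := ∑' ξ, p ξ * generator g α N a b F ξ

theorem forwardRate_eq_sum {F : Config N → ℝ} {M : ℕ} (hF : ∀ η, M < total η → F η = 0)
    (p : Config N → ℝ) (a b : ℝ) : forwardRate g α p a b F
      = ∑ ξ ∈ (finite_total_le (N := N) (M + 1)).toFinset, p ξ * generator g α N a b F ξ := by
  refine tsum_eq_sum fun ξ hξ => ?_
  simp only [Finite.mem_toFinset, mem_ofPred_eq, not_le] at hξ
  rw [generator_eq_zero hF a b hξ, mul_zero]

theorem continuous_forwardRate {F : Config N → ℝ} (hF : F.support.Finite)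
    {p : ℝ → Config N → ℝ} (hp : ∀ ζ, Continuous fun s => p s ζ) {aL aR : ℝ → ℝ}
    (haL : Continuous aL) (haR : Continuous aR) :
    Continuous fun s => forwardRate g α (p s) (aL s) (aR s) F := by
  obtain ⟨M, hM⟩ := exists_total_le_of_finite_support hF
  simp only [forwardRate_eq_sum hM]
  refine continuous_finsetSum _ fun ξ _ => (hp ξ).mul ?_
  simp only [generator_eq_add (aL _) (aR _)]
  fun_prop

theorem IsZeroRangeProcess.law_sub_eq_integral [IsProbabilityMeasure P]
    (hη : IsZeroRangeProcess g α lamL lamR N P η)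
    {aL aR : ℝ → ℝ} (haL : Continuous aL) (haR : Continuous aR) (hL : ∀ r, 0 ≤ r → aL r = lamL r)
    (hR : ∀ r, 0 ≤ r → aR r = lamR r) (ζ : Config N) {t : ℝ} (ht : 0 ≤ t) :
    IntegrableOn (fun r => forwardRate g α (law P η r) (aL r) (aR r) (Pi.single ζ 1))
      (Icc 0 t) ∧
    law P η t ζ - law P η 0 ζ
      = ∫ r in (0 : ℝ)..t, forwardRate g α (law P η r) (aL r) (aR r) (Pi.single ζ 1) := by
  classical
  set F : Config N → ℝ := Pi.single ζ 1 with hF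
  have hFs : F.support.Finite := (Set.finite_singleton ζ).subset Pi.support_single_subset
  obtain ⟨M, hM⟩ := exists_total_le_of_finite_support hFs
  have hF1 : ∀ ξ, |F ξ| ≤ 1 := fun ξ => by
    by_cases h : ξ = ζ
    · subst h; simp [hF]
    · simp [hF, h]
  have hFlaw : ∀ s : ℝ, ∫ ω, F (η s.toNNReal ω) ∂P = law P η s ζ := fun s => by
    rw [integral_law P η s (hη.measurable _) hF1, tsum_eq_single ζ]
    · simp [hF]
    · intro ξ hξ; simp [hF, hξ]
  set Ψ : ℝ → Config N → ℝ := fun r ξ => generator g α N (aL r) (aR r) F ξ with hΨ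
  have hΨm : Measurable fun q : ℝ × Ω => Ψ q.1 (η q.1.toNNReal q.2) := by
    simp only [hΨ, generator_eq_add (aL _) (aR _)]
    have hm := hη.measurable_uncurry
    have hc : ∀ A : Config N → ℝ, Measurable fun q : ℝ × Ω => A (η q.1.toNNReal q.2) := fun A =>
      (measurable_of_countable A).comp hm
    exact ((hc _).add ((haL.measurable.comp measurable_fst).mul
        (hc fun ξ => (N : ℝ) ^ (2 + α) / 2 * (F (addAt ξ (leftEnd N)) - F ξ)))).add
      ((haR.measurable.comp measurable_fst).mul
        (hc fun ξ => (N : ℝ) ^ (2 + α) / 2 * (F (addAt ξ (rightEnd N)) - F ξ)))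
  have hbd : ∃ C, ∀ r ∈ Icc 0 t, ∀ ξ, |Ψ r ξ| ≤ C := by
    have hfin := finite_total_le (N := N) (M + 1)
    have hcont : Continuous fun r => ∑ ξ ∈ hfin.toFinset, |Ψ r ξ| := by
      refine continuous_finsetSum _ fun ξ _ => ?_
      simp only [hΨ, generator_eq_add (aL _) (aR _)]
      fun_prop
    obtain ⟨C, hC⟩ := (isCompact_Icc (a := (0 : ℝ)) (b := t)).bddAbove_image hcont.continuousOn
    refine ⟨C, fun r hr ξ => ?_⟩
    have h1 := hC ⟨r, hr, rfl⟩
    by_cases hξ : total ξ ≤ M + 1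
    · exact (Finset.single_le_sum (f := fun ξ => |Ψ r ξ|) (fun _ _ => abs_nonneg _)
        (hfin.mem_toFinset.2 hξ)).trans h1
    · rw [hΨ]
      simp only
      rw [generator_eq_zero hM _ _ (by omega), abs_zero]
      exact (Finset.sum_nonneg fun _ _ => abs_nonneg _).trans h1
  obtain ⟨C, hC⟩ := hbd
  have hint : Integrable (fun q : ℝ × Ω => Ψ q.1 (η q.1.toNNReal q.2))
      ((volume.restrict (Icc 0 t)).prod P) := by
    refine Integrable.of_bound hΨm.aestronglyMeasurable C ?_
    have : ∀ᵐ r ∂(volume.restrict (Icc 0 t)), r ∈ Icc 0 t := ae_restrict_mem measurableSet_Icc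
    filter_upwards [Measure.quasiMeasurePreserving_fst.ae this] with q hq
    exact hC _ hq _
  have hrate : ∀ r ∈ Icc 0 t, ∫ ω, Ψ r (η r.toNNReal ω) ∂P
      = forwardRate g α (law P η r) (aL r) (aR r) F := fun r hr =>
    integral_law P η r (hη.measurable _) (hC r hr)
  refine ⟨?_, ?_⟩
  · have := hint.integral_prod_left
    exact (integrable_congr ((ae_restrict_iff' measurableSet_Icc).2
      (ae_of_all _ fun r hr => hrate r hr))).1 this
  · have hmart := hη.martingale F hFs
    set t' : ℝ≥0 := t.toNNReal with ht'
    have htt : (t' : ℝ) = t := Real.coe_toNNReal t ht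
    have h1 := hmart.setIntegral_eq (zero_le (a := t')) MeasurableSet.univ
    simp only [Measure.restrict_univ, NNReal.coe_zero, intervalIntegral.integral_same, sub_self,
      integral_zero, htt] at h1
    have hpath : ∀ ω, ∫ r in (0 : ℝ)..t, generator g α N (lamL r) (lamR r) F (η r.toNNReal ω)
        = ∫ r in Icc 0 t, Ψ r (η r.toNNReal ω) := fun ω => by
      rw [intervalIntegral.integral_of_le ht, ← integral_Icc_eq_integral_Ioc]
      refine setIntegral_congr_fun measurableSet_Icc fun r hr => ?_
      simp only [hΨ]
      rw [hL r hr.1, hR r hr.1]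
    simp only [hpath] at h1
    have i1 : Integrable (fun ω => F (η t' ω)) P :=
      Integrable.of_bound ((measurable_of_countable F).comp (hη.measurable t')).aestronglyMeasurable
        1 (ae_of_all _ fun ω => hF1 _)
    have i0 : Integrable (fun ω => F (η 0 ω)) P :=
      Integrable.of_bound ((measurable_of_countable F).comp (hη.measurable 0)).aestronglyMeasurable
        1 (ae_of_all _ fun ω => hF1 _)
    have i2 : Integrable (fun ω => ∫ r in Icc 0 t, Ψ r (η r.toNNReal ω)) P :=
      hint.integral_prod_right
    have i3 : Integrable (fun ω => F (η t' ω) - F (η 0 ω)) P := i1.sub i0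
    rw [integral_sub i3 i2, integral_sub i1 i0] at h1
    have e1 : ∫ ω, F (η t' ω) ∂P = law P η t ζ := hFlaw t
    have e0 : ∫ ω, F (η 0 ω) ∂P = law P η 0 ζ := by
      have := hFlaw 0; rwa [Real.toNNReal_zero] at this
    have hsw : ∫ ω, (∫ r in Icc 0 t, Ψ r (η r.toNNReal ω)) ∂P
        = ∫ r in Icc 0 t, (∫ ω, Ψ r (η r.toNNReal ω) ∂P) :=
      integral_integral_swap (f := fun ω r => Ψ r (η r.toNNReal ω)) hint.swap
    rw [e1, e0, hsw] at h1
    rw [intervalIntegral.integral_of_le ht, ← integral_Icc_eq_integral_Ioc,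
      ← setIntegral_congr_fun measurableSet_Icc hrate]
    linarith

theorem IsZeroRangeProcess.continuous_law [IsProbabilityMeasure P]
    (hη : IsZeroRangeProcess g α lamL lamR N P η)
    {aL aR : ℝ → ℝ} (haL : Continuous aL) (haR : Continuous aR) (hL : ∀ r, 0 ≤ r → aL r = lamL r)
    (hR : ∀ r, 0 ≤ r → aR r = lamR r) (ζ : Config N) : Continuous fun s => law P η s ζ := by
  have hon : ContinuousOn (fun s => law P η s ζ) (Ici 0) := by
    intro s hs
    have hs0 : (0 : ℝ) ≤ s + 1 := by have : (0 : ℝ) ≤ s := hs; linarith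
    obtain ⟨hi, -⟩ := hη.law_sub_eq_integral haL haR hL hR ζ hs0
    have h1 := intervalIntegral.continuousOn_primitive_interval (by rwa [uIcc_of_le hs0])
    rw [uIcc_of_le hs0] at h1
    have h2 : ContinuousOn (fun s => law P η s ζ) (Icc 0 (s + 1)) := by
      refine (h1.add (continuousOn_const (c := law P η 0 ζ))).congr fun r hr => ?_
      have := (hη.law_sub_eq_integral haL haR hL hR ζ hr.1).2
      simp only [Pi.add_apply]
      linarith
    refine (h2 s ⟨hs, by linarith⟩).mono_of_mem_nhdsWithin ?_
    exact mem_nhdsWithin.2 ⟨Iio (s + 1), isOpen_Iio, by simp, fun r hr => ⟨hr.2, (le_of_lt hr.1)⟩⟩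
  have := hon.comp_continuous (f := fun s : ℝ => max s 0) (by fun_prop)
    fun s => mem_Ici.2 (le_max_right _ _)
  simpa only [Function.comp_def, law_max_zero] using this

theorem IsZeroRangeProcess.hasDerivWithinAt_law [IsProbabilityMeasure P]
    (hη : IsZeroRangeProcess g α lamL lamR N P η)
    {aL aR : ℝ → ℝ} (haL : Continuous aL) (haR : Continuous aR) (hL : ∀ r, 0 ≤ r → aL r = lamL r)
    (hR : ∀ r, 0 ≤ r → aR r = lamR r) (ζ : Config N) {s : ℝ} (hs : 0 ≤ s) :
    HasDerivWithinAt (fun s => law P η s ζ)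
      (forwardRate g α (law P η s) (aL s) (aR s) (Pi.single ζ 1)) (Ici s) s := by
  have hcont : Continuous fun r => forwardRate g α (law P η r) (aL r) (aR r) (Pi.single ζ 1) :=
    continuous_forwardRate ((Set.finite_singleton ζ).subset Pi.support_single_subset)
      (fun ξ => hη.continuous_law haL haR hL hR ξ) haL haR
  have h1 := (intervalIntegral.integral_hasDerivAt_right (hcont.intervalIntegrable 0 s)
    (hcont.stronglyMeasurableAtFilter _ _) hcont.continuousAt).const_add (law P η 0 ζ)
  refine h1.hasDerivWithinAt.congr (fun r hr => ?_) ?_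
  · rw [← (hη.law_sub_eq_integral haL haR hL hR ζ (hs.trans hr)).2]; ring
  · rw [← (hη.law_sub_eq_integral haL haR hL hR ζ hs).2]; ring

end Law


/-! ### A regularization of the entropy function with bounded derivative -/

section Regularization

open InformationTheory

/-- Truncation to `[A⁻¹, A]`. -/
noncomputable def clip (A u : ℝ) : ℝ := max A⁻¹ (min u A)

/-- The convex function with derivative `log (clip A u)` that vanishes at `1`. -/
noncomputable def entReg (A u : ℝ) : ℝ := u * Real.log (clip A u) + 1 - clip A u

variable {A : ℝ}

theorem inv_le_self_of_one_le (hA : 1 ≤ A) : A⁻¹ ≤ A := (inv_le_one_of_one_le₀ hA).trans hA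

theorem clip_pos (hA : 1 ≤ A) (u : ℝ) : 0 < clip A u :=
  (inv_pos.2 (zero_lt_one.trans_le hA)).trans_le (le_max_left _ _)

theorem clip_le (hA : 1 ≤ A) (u : ℝ) : clip A u ≤ A :=
  max_le (inv_le_self_of_one_le hA) (min_le_right _ _)

theorem le_clip (u : ℝ) : A⁻¹ ≤ clip A u := le_max_left _ _

theorem clip_le_one_add (hA : 1 ≤ A) {u : ℝ} (hu : 0 ≤ u) : clip A u ≤ 1 + u :=
  max_le ((inv_le_one_of_one_le₀ hA).trans (by linarith)) ((min_le_left _ _).trans (by linarith))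

theorem continuous_clip (A : ℝ) : Continuous (clip A) := by unfold clip; fun_prop

theorem clip_one (hA : 1 ≤ A) : clip A 1 = 1 := by
  unfold clip
  rw [min_eq_left hA, max_eq_right (inv_le_one_of_one_le₀ hA)]

theorem clip_eq_self {u : ℝ} (h1 : A⁻¹ ≤ u) (h2 : u ≤ A) : clip A u = u := by
  unfold clip; rw [min_eq_left h2, max_eq_right h1]

theorem abs_log_clip_le (hA : 1 ≤ A) (u : ℝ) : |Real.log (clip A u)| ≤ Real.log A := by
  have hA0 : 0 < A := zero_lt_one.trans_le hA
  rw [abs_le]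
  constructor
  · rw [← Real.log_inv]
    exact Real.log_le_log (inv_pos.2 hA0) (le_clip u)
  · exact Real.log_le_log (clip_pos hA u) (clip_le hA u)

theorem sub_clip_mul_nonneg (hA : 1 ≤ A) (u v : ℝ) :
    0 ≤ (u - clip A u) * (Real.log (clip A u) - Real.log (clip A v)) := by
  have hA0 : 0 < A := zero_lt_one.trans_le hA
  rcases le_total u A with h | h
  · rcases le_total A⁻¹ u with h' | h'
    · rw [clip_eq_self h' h]; simp
    · have : clip A u = A⁻¹ := by unfold clip; rw [min_eq_left h, max_eq_left h']
      rw [this]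
      refine mul_nonneg_of_nonpos_of_nonpos (by linarith) ?_
      have := Real.log_le_log (inv_pos.2 hA0) (le_clip (A := A) v)
      linarith
  · have : clip A u = A := by
      unfold clip; rw [min_eq_right h, max_eq_right (inv_le_self_of_one_le hA)]
    rw [this]
    refine mul_nonneg (by linarith) ?_
    have := Real.log_le_log (clip_pos hA v) (clip_le hA v)
    linarith

theorem sq_sqrt_sub_le {c d : ℝ} (hc : 0 < c) (hd : 0 < d) :
    (√c - √d) ^ 2 ≤ c * (Real.log c - Real.log d) - c + d := by
  have hsc : 0 < √c := Real.sqrt_pos.2 hc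
  have hsd : 0 < √d := Real.sqrt_pos.2 hd
  have h1 := Real.log_le_sub_one_of_pos (div_pos hsd hsc)
  rw [Real.log_div hsd.ne' hsc.ne', Real.log_sqrt hc.le, Real.log_sqrt hd.le] at h1
  have h2 : c * (√d / √c) = √c * √d := by
    rw [mul_div_assoc', div_eq_iff hsc.ne']
    nlinarith [Real.mul_self_sqrt hc.le]
  have h3 := mul_le_mul_of_nonneg_left h1 hc.le
  rw [mul_sub, mul_sub, h2] at h3
  nlinarith [Real.sq_sqrt hc.le, Real.sq_sqrt hd.le]

/-- The Bregman divergence of `entReg A` controls the square of the increment of `√`. -/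
theorem sq_sqrt_clip_sub_le (hA : 1 ≤ A) (u v : ℝ) :
    (√(clip A u) - √(clip A v)) ^ 2
      ≤ u * (Real.log (clip A u) - Real.log (clip A v)) - clip A u + clip A v := by
  have h1 := sq_sqrt_sub_le (clip_pos hA u) (clip_pos hA v)
  have h2 := sub_clip_mul_nonneg hA u v
  nlinarith

theorem hasDerivAt_entReg (hA : 1 ≤ A) (u : ℝ) :
    HasDerivAt (entReg A) (Real.log (clip A u)) u := by
  have hlow : ∀ u v, entReg A u + Real.log (clip A u) * (v - u) ≤ entReg A v := fun u v => by
    have h := (sq_nonneg _).trans (sq_sqrt_clip_sub_le hA v u)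
    unfold entReg
    nlinarith
  rw [hasDerivAt_iff_isLittleO]
  have hc : Tendsto (fun v => Real.log (clip A v) - Real.log (clip A u)) (𝓝 u) (𝓝 0) := by
    have : ContinuousAt (fun v => Real.log (clip A v)) u :=
      (continuous_clip A).continuousAt.log (clip_pos hA u).ne'
    simpa using this.tendsto.sub_const (Real.log (clip A u))
  refine Asymptotics.IsBigO.trans_isLittleO (g := fun v =>
    (Real.log (clip A v) - Real.log (clip A u)) * (v - u)) ?_ ?_
  · refine Asymptotics.IsBigO.of_bound 1 (Eventually.of_forall fun v => ?_)
    have h1 := hlow u v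
    have h2 := hlow v u
    rw [Real.norm_eq_abs, Real.norm_eq_abs, one_mul, smul_eq_mul]
    refine abs_le_abs_of_nonneg ?_ ?_
    · linarith
    · linarith
  · simpa using ((Asymptotics.isLittleO_one_iff ℝ).2 hc).mul_isBigO
      (Asymptotics.isBigO_refl (fun v : ℝ => v - u) (𝓝 u))

theorem klFun_clip_le_entReg (hA : 1 ≤ A) (u : ℝ) : klFun (clip A u) ≤ entReg A u := by
  have h := sub_clip_mul_nonneg hA u 1
  rw [clip_one hA, Real.log_one, sub_zero] at h
  unfold entReg
  rw [klFun_apply]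
  nlinarith

theorem entReg_nonneg (hA : 1 ≤ A) (u : ℝ) : 0 ≤ entReg A u :=
  (klFun_nonneg (clip_pos hA u).le).trans (klFun_clip_le_entReg hA u)

theorem entReg_le_klFun (hA : 1 ≤ A) {u : ℝ} (hu : 0 ≤ u) : entReg A u ≤ klFun u := by
  unfold entReg
  rw [klFun_apply]
  rcases hu.eq_or_lt with rfl | hu
  · have := clip_pos hA 0
    simp only [zero_mul]; linarith
  · have := (sq_nonneg _).trans (sq_sqrt_sub_le hu (clip_pos hA u))
    nlinarith

theorem tendsto_clip {u : ℝ} (hu : 0 ≤ u) :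
    Tendsto (fun n : ℕ => clip ((n : ℝ) + 1) u) atTop (𝓝 u) := by
  have h1 : Tendsto (fun n : ℕ => ((n : ℝ) + 1)⁻¹) atTop (𝓝 0) := by
    simpa using tendsto_one_div_add_atTop_nhds_zero_nat (𝕜 := ℝ)
  have h2 : Tendsto (fun n : ℕ => min u ((n : ℝ) + 1)) atTop (𝓝 u) := by
    refine tendsto_const_nhds.congr' ?_
    obtain ⟨n₀, hn₀⟩ := exists_nat_ge u
    filter_upwards [eventually_ge_atTop n₀] with n hn
    rw [min_eq_left]
    have : (n₀ : ℝ) ≤ n := by exact_mod_cast hn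
    linarith
  simpa [clip, max_eq_right hu] using h1.max h2

theorem tendsto_entReg {u : ℝ} (hu : 0 ≤ u) :
    Tendsto (fun n : ℕ => entReg ((n : ℝ) + 1) u) atTop (𝓝 (klFun u)) := by
  unfold entReg
  rw [klFun_apply]
  have h := tendsto_clip hu
  rcases hu.eq_or_lt with rfl | hu'
  · simpa using h.const_sub 1
  · exact ((h.log hu'.ne').const_mul u).add_const 1 |>.sub h

/-- The derivative of `ν * entReg A (p / ν)` along a curve. -/
theorem hasDerivWithinAt_mul_entReg (hA : 1 ≤ A) {p ν : ℝ → ℝ} {p' ν' s : ℝ} {S : Set ℝ}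
    (hp : HasDerivWithinAt p p' S s) (hν : HasDerivWithinAt ν ν' S s) (h0 : ν s ≠ 0) :
    HasDerivWithinAt (fun r => ν r * entReg A (p r / ν r))
      (Real.log (clip A (p s / ν s)) * p' + (1 - clip A (p s / ν s)) * ν') S s := by
  have h1 := (hasDerivAt_entReg hA (p s / ν s)).comp_hasDerivWithinAt s (hp.div hν h0)
  refine (hν.mul h1).congr_deriv ?_
  simp only [Function.comp, Pi.div_apply]
  unfold entReg
  field_simp
  ring

end Regularization

/-! ### The cutoff -/

/-- A cutoff of the total particle number between `M` and `2 * M`. -/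
noncomputable def cutoff (M n : ℕ) : ℝ := max 0 (min 1 (2 - (n : ℝ) / M))

theorem cutoff_nonneg (M n : ℕ) : 0 ≤ cutoff M n := le_max_left _ _

theorem cutoff_le_one (M n : ℕ) : cutoff M n ≤ 1 := max_le zero_le_one (min_le_left _ _)

theorem cutoff_eq_one {M n : ℕ} (hM : 0 < M) (h : n ≤ M) : cutoff M n = 1 := by
  have hM' : (0 : ℝ) < M := by exact_mod_cast hM
  have : (n : ℝ) / M ≤ 1 := (div_le_one hM').2 (by exact_mod_cast h)
  unfold cutoff
  rw [min_eq_left (by linarith), max_eq_right zero_le_one]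

theorem cutoff_eq_zero {M n : ℕ} (hM : 0 < M) (h : 2 * M ≤ n) : cutoff M n = 0 := by
  have hM' : (0 : ℝ) < M := by exact_mod_cast hM
  have : (2 : ℝ) ≤ (n : ℝ) / M := by rw [le_div_iff₀ hM']; exact_mod_cast h
  unfold cutoff
  rw [max_eq_left ((min_le_right _ _).trans (by linarith))]

theorem cutoff_succ_le (M n : ℕ) : cutoff M (n + 1) ≤ cutoff M n := by
  unfold cutoff
  gcongr
  linarith

theorem cutoff_sub_succ_le (M n : ℕ) : cutoff M n - cutoff M (n + 1) ≤ (M : ℝ)⁻¹ := by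
  have h : cutoff M n ≤ cutoff M (n + 1) + (M : ℝ)⁻¹ := by
    have hi : (0 : ℝ) ≤ (M : ℝ)⁻¹ := by positivity
    unfold cutoff
    refine max_le (add_nonneg (le_max_left _ _) hi) ?_
    refine le_trans ?_ (add_le_add_left (le_max_right _ _) _)
    rw [← min_add_add_right]
    refine le_min ((min_le_left _ _).trans (by linarith)) ((min_le_right _ _).trans (le_of_eq ?_))
    push_cast
    rw [add_div, one_div]; ring
  linarith

theorem cutoff_sub_succ_mul_le {M : ℕ} (hM : 0 < M) (n : ℕ) :
    (cutoff M n - cutoff M (n + 1)) * ((n : ℝ) + 1) ≤ if M ≤ n then 2 else 0 := by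
  split_ifs with h
  · by_cases h2 : 2 * M ≤ n
    · rw [cutoff_eq_zero hM h2, cutoff_eq_zero hM (by omega)]; norm_num
    · have hM' : (0 : ℝ) < M := by exact_mod_cast hM
      have hn : (n : ℝ) + 1 ≤ 2 * M := by exact_mod_cast (by omega : n + 1 ≤ 2 * M)
      calc _ ≤ (M : ℝ)⁻¹ * (2 * M) := mul_le_mul (cutoff_sub_succ_le M n) hn (by positivity)
            (by positivity)
        _ = 2 := by field_simp
  · rw [cutoff_eq_one hM (by omega), cutoff_eq_one hM (by omega)]; simp


/-! ### Sums over bonds -/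

theorem sum_Icc_int_eq_add_left {a b : ℤ} (h : a ≤ b) (F : ℤ → ℝ) :
    ∑ z ∈ Finset.Icc a b, F z = F a + ∑ z ∈ Finset.Icc (a + 1) b, F z := by
  have : Finset.Icc a b = insert a (Finset.Icc (a + 1) b) := by
    ext z; simp only [Finset.mem_Icc, Finset.mem_insert]; omega
  rw [this, Finset.sum_insert (by simp)]

theorem sum_Icc_int_eq_add_right {a b : ℤ} (h : a ≤ b + 1) (F : ℤ → ℝ) :
    ∑ z ∈ Finset.Icc a (b + 1), F z = (∑ z ∈ Finset.Icc a b, F z) + F (b + 1) := by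
  have : Finset.Icc a (b + 1) = insert (b + 1) (Finset.Icc a b) := by
    ext z; simp only [Finset.mem_Icc, Finset.mem_insert]; omega
  rw [this, Finset.sum_insert (by simp), add_comm]

theorem sum_Icc_int_shift (a b : ℤ) (F : ℤ → ℝ) :
    ∑ z ∈ Finset.Icc a b, F (z + 1) = ∑ z ∈ Finset.Icc (a + 1) (b + 1), F z := by
  refine Finset.sum_bij (fun z _ => z + 1) ?_ ?_ ?_ ?_
  · intro z hz; simp only [Finset.mem_Icc] at *; omega
  · intro z _ w _ h; omega
  · intro z hz; exact ⟨z - 1, by simp only [Finset.mem_Icc] at *; omega, by omega⟩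
  · intro z _; rfl

theorem sum_Icc_int_sub {a b : ℤ} (h : a ≤ b + 1) (F : ℤ → ℝ) :
    ∑ z ∈ Finset.Icc a b, (F (z + 1) - F z) = F (b + 1) - F a := by
  rw [Finset.sum_sub_distrib, sum_Icc_int_shift]
  have h1 := sum_Icc_int_eq_add_right h F
  by_cases hab : a ≤ b
  · have h2 := sum_Icc_int_eq_add_left (by omega : a ≤ b + 1) F
    linarith
  · have : a = b + 1 := by omega
    subst this
    simp

theorem sum_bonds (N : ℕ) (j : ℤ → ℤ → ℝ) :
    ∑ z ∈ Finset.Icc (-(N : ℤ) - 1) N, (j z (z + 1) + j (z + 1) z)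
      = ∑ x ∈ Finset.Icc (-(N : ℤ)) N, (j x (x + 1) + j x (x - 1))
        + (j (-(N : ℤ) - 1) (-(N : ℤ)) + j (N + 1) N) := by
  rw [Finset.sum_add_distrib, Finset.sum_add_distrib]
  have h1 := sum_Icc_int_eq_add_left (a := -(N : ℤ) - 1) (b := N) (by omega) fun z => j z (z + 1)
  have h2 := sum_Icc_int_shift (-(N : ℤ) - 1) N fun z => j z (z - 1)
  have h3 := sum_Icc_int_eq_add_right (a := -(N : ℤ)) (b := N) (by omega) fun z => j z (z - 1)
  simp only [add_sub_cancel_right, sub_add_cancel] at h1 h2 h3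
  rw [h1, h2, h3]
  ring

/-- Entropy production over the bonds of `{-N - 1, …, N + 1}`, for an affine fugacity profile. -/
theorem sum_bonds_log_clip_le {A : ℝ} (hA : 1 ≤ A) (N : ℕ) {lam U : ℤ → ℝ} {δ a₀ : ℝ}
    (ha₀ : 0 ≤ a₀) (hδ : ∀ z, lam (z + 1) - lam z = δ)
    (hlam : ∀ z ∈ Finset.Icc (-(N : ℤ) - 1) (N + 1), a₀ ≤ lam z)
    (hU : U (-(N : ℤ) - 1) = U (N + 1)) :
    ∑ z ∈ Finset.Icc (-(N : ℤ) - 1) N,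
        (lam z * U z * (Real.log (clip A (U (z + 1))) - Real.log (clip A (U z)))
          + lam (z + 1) * U (z + 1) * (Real.log (clip A (U z)) - Real.log (clip A (U (z + 1)))))
      ≤ -(2 * a₀) * ∑ z ∈ Finset.Icc (-(N : ℤ) - 1) N,
          (√(clip A (U (z + 1))) - √(clip A (U z))) ^ 2 := by
  have htel := sum_Icc_int_sub (a := -(N : ℤ) - 1) (b := N) (by omega) fun z => clip A (U z)
  rw [hU, sub_self] at htel
  have hle : ∀ z ∈ Finset.Icc (-(N : ℤ) - 1) N,
      lam z * U z * (Real.log (clip A (U (z + 1))) - Real.log (clip A (U z)))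
        + lam (z + 1) * U (z + 1) * (Real.log (clip A (U z)) - Real.log (clip A (U (z + 1))))
      ≤ -δ * (clip A (U (z + 1)) - clip A (U z))
        + -(2 * a₀) * (√(clip A (U (z + 1))) - √(clip A (U z))) ^ 2 := by
    intro z hz
    rw [Finset.mem_Icc] at hz
    have l1 := hlam z (by rw [Finset.mem_Icc]; omega)
    have l2 := hlam (z + 1) (by rw [Finset.mem_Icc]; omega)
    have b1 := mul_le_mul_of_nonneg_left (sq_sqrt_clip_sub_le hA (U z) (U (z + 1)))
      (ha₀.trans l1)
    have b2 := mul_le_mul_of_nonneg_left (sq_sqrt_clip_sub_le hA (U (z + 1)) (U z))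
      (ha₀.trans l2)
    have b3 := mul_le_mul_of_nonneg_right l1
      (sq_nonneg (√(clip A (U (z + 1))) - √(clip A (U z))))
    have b4 := mul_le_mul_of_nonneg_right l2
      (sq_nonneg (√(clip A (U (z + 1))) - √(clip A (U z))))
    have e := hδ z
    rw [← e]
    have e2 : (√(clip A (U z)) - √(clip A (U (z + 1)))) ^ 2
      = (√(clip A (U (z + 1))) - √(clip A (U z))) ^ 2 := by ring
    rw [e2] at b1
    linarith
  refine (Finset.sum_le_sum hle).trans ?_
  rw [Finset.sum_add_distrib, ← Finset.mul_sum, ← Finset.mul_sum, htel]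
  simp

/-! ### The forward equation in terms of densities -/

section Forward

variable {N : ℕ}

/-- One particle is added at `z`, if `z` is in `{-N, …, N}`. -/
noncomputable def plusAt (ξ : Config N) (z : ℤ) : Config N :=
  if h : z ∈ Finset.Icc (-(N : ℤ)) (N : ℤ) then addAt ξ ⟨z, h⟩ else ξ

theorem plusAt_coe (ξ : Config N) (x : Box N) : plusAt ξ (x : ℤ) = addAt ξ x := by
  unfold plusAt; rw [dif_pos x.2]

theorem plusAt_of_notMem (ξ : Config N) {z : ℤ} (h : z ∉ Finset.Icc (-(N : ℤ)) (N : ℤ)) :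
    plusAt ξ z = ξ := by
  unfold plusAt; rw [dif_neg h]

theorem jump_addAt (ξ : Config N) (x : Box N) (y : ℤ) : jump (addAt ξ x) x y = plusAt ξ y := by
  have : removeAt (addAt ξ x) x = ξ := by
    unfold removeAt addAt; simp
  unfold jump plusAt
  rw [this]

theorem total_plusAt (ξ : Config N) (z : ℤ) :
    total (plusAt ξ z) = total ξ + if z ∈ Finset.Icc (-(N : ℤ)) (N : ℤ) then 1 else 0 := by
  unfold plusAt
  split_ifs with h
  · rw [total_addAt]
  · simp

/-- The stationary fugacity profile: linear between the reservoirs at `-(N + 1)` and `N + 1`. -/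
noncomputable def profile (N : ℕ) (a b : ℝ) (z : ℤ) : ℝ := interp a b ((z : ℝ) / (N + 1))

theorem profile_left (N : ℕ) (a b : ℝ) : profile N a b (-(N : ℤ) - 1) = a := by
  have h : ((N : ℝ) + 1) ≠ 0 := by positivity
  unfold profile interp
  push_cast
  field_simp
  ring

theorem profile_right (N : ℕ) (a b : ℝ) : profile N a b (N + 1) = b := by
  have h : ((N : ℝ) + 1) ≠ 0 := by positivity
  unfold profile interp
  push_cast
  field_simp
  ring

theorem profile_succ_sub (N : ℕ) (a b : ℝ) (z : ℤ) :
    profile N a b (z + 1) - profile N a b z = (b - a) / 2 / (N + 1) := by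
  unfold profile interp
  push_cast
  ring

theorem profile_mem_Icc {N : ℕ} {a b u v : ℝ} (hu : u ∈ Icc a b) (hv : v ∈ Icc a b) {z : ℤ}
    (hz : z ∈ Finset.Icc (-(N : ℤ) - 1) (N + 1)) : profile N u v z ∈ Icc a b := by
  have h : (0 : ℝ) < (N : ℝ) + 1 := by positivity
  rw [Finset.mem_Icc] at hz
  refine interp_mem_Icc hu hv ⟨?_, ?_⟩
  · rw [le_div_iff₀ h]; have : (-(N : ℝ) - 1) ≤ z := by exact_mod_cast hz.1
    linarith
  · rw [div_le_one h]; exact_mod_cast hz.2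

/-- The weights of the stationary product measure. -/
noncomputable def refProb (g : ℕ → ℝ) (N : ℕ) (a b : ℝ) (η : Config N) : ℝ :=
  prodProb g (fun x : Box N => profile N a b x) η

theorem profile_box_mem_Icc {a b u v : ℝ} (hu : u ∈ Icc a b) (hv : v ∈ Icc a b) (x : Box N) :
    profile N u v x ∈ Icc a b :=
  profile_mem_Icc hu hv (by have := Finset.mem_Icc.1 x.2; rw [Finset.mem_Icc]; omega)

theorem summable_of_total {B : Config N → ℝ} {M : ℕ} (hB : ∀ η, M < total η → B η = 0) :
    Summable B := by
  refine summable_of_hasFiniteSupport ((finite_total_le M).subset fun η hη => ?_)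
  by_contra h
  exact hη (hB η (not_le.1 h))

variable {g : ℕ → ℝ} {α : ℝ}

theorem refProb_addAt_mul (hgpos : ∀ k, 0 < k → 0 < g k) (a b : ℝ) (ξ : Config N) (x : Box N) :
    refProb g N a b (addAt ξ x) * g (ξ x + 1) = profile N a b x * refProb g N a b ξ := by
  unfold refProb addAt
  convert prodProb_update_succ_mul hgpos _ ξ x

theorem addAt_apply_self (ξ : Config N) (x : Box N) : addAt ξ x x = ξ x + 1 := by
  unfold addAt; simp

/-- Summation over the configuration that remains when a particle is taken away from `x`. -/
theorem tsum_mul_rate_eq (hg0 : g 0 = 0) (hgpos : ∀ k, 0 < k → 0 < g k) (a b : ℝ)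
    (f B : Config N → ℝ) (x : Box N) :
    ∑' η, refProb g N a b η * f η * g (η x) * B η
      = ∑' ξ, refProb g N a b ξ * (profile N a b x * f (addAt ξ x) * B (addAt ξ x)) := by
  have h := tsum_update_succ (R := ℝ) x
    (F := fun η => refProb g N a b η * f η * g (η x) * B η) fun η h => by
      rw [h, hg0]; ring
  rw [← h]
  refine tsum_congr fun ξ => ?_
  have h1 := refProb_addAt_mul hgpos a b ξ x
  have h2 := addAt_apply_self ξ x
  unfold addAt at *
  rw [h2]
  linear_combination f (Function.update ξ x (ξ x + 1)) * B (Function.update ξ x (ξ x + 1)) * h1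

theorem forwardRate_eq_tsum_bonds (hg0 : g 0 = 0) (hgpos : ∀ k, 0 < k → 0 < g k) (a b : ℝ)
    {p f : Config N → ℝ} (hpf : ∀ η, p η = refProb g N a b η * f η) {F : Config N → ℝ} {M : ℕ}
    (hF : ∀ η, M < total η → F η = 0) :
    forwardRate g α p a b F = (N : ℝ) ^ (2 + α) / 2 * ∑' ξ, refProb g N a b ξ *
      ∑ z ∈ Finset.Icc (-(N : ℤ) - 1) N,
        (profile N a b z * f (plusAt ξ z) * (F (plusAt ξ (z + 1)) - F (plusAt ξ z))
          + profile N a b (z + 1) * f (plusAt ξ (z + 1)) *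
            (F (plusAt ξ z) - F (plusAt ξ (z + 1)))) := by
  set ν := refProb g N a b with hν
  set lam := profile N a b with hlam
  set j : Config N → ℤ → ℤ → ℝ := fun ξ z w =>
    lam z * f (plusAt ξ z) * (F (plusAt ξ w) - F (plusAt ξ z)) with hj
  have hjump : ∀ (x : Box N) (y : ℤ), ∑' η, ν η * f η * g (η x) * (F (jump η x y) - F η)
      = ∑' ξ, ν ξ * j ξ x y := fun x y => by
    rw [hν, tsum_mul_rate_eq hg0 hgpos a b f (fun η => F (jump η x y) - F η) x]
    simp only [hj, plusAt_coe, jump_addAt, hlam]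
  have hs1 : ∀ (x : Box N) (y : ℤ),
      Summable fun η => ν η * f η * g (η x) * (F (jump η x y) - F η) := fun x y => by
    refine summable_of_total (M := M + 1) fun η hη => ?_
    rw [hF η (by omega), hF _ (by have := total_le_total_jump η x y; omega)]; simp
  have hs2 : ∀ z w : ℤ, Summable fun ξ => ν ξ * j ξ z w := fun z w => by
    refine summable_of_total (M := M) fun η hη => ?_
    simp only [hj]
    rw [hF _ (by rw [total_plusAt]; omega), hF _ (by rw [total_plusAt]; omega)]; simp
  have hleft : ∀ ξ, a * (ν ξ * f ξ * (F (addAt ξ (leftEnd N)) - F ξ))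
      = ν ξ * j ξ (-(N : ℤ) - 1) (-(N : ℤ)) := fun ξ => by
    simp only [hj, hlam]
    rw [profile_left, plusAt_of_notMem ξ (z := -(N : ℤ) - 1) (by simp),
      show plusAt ξ (-(N : ℤ)) = addAt ξ (leftEnd N) from plusAt_coe ξ (leftEnd N)]
    ring
  have hright : ∀ ξ, b * (ν ξ * f ξ * (F (addAt ξ (rightEnd N)) - F ξ))
      = ν ξ * j ξ (N + 1) N := fun ξ => by
    simp only [hj, hlam]
    rw [profile_right, plusAt_of_notMem ξ (z := (N : ℤ) + 1) (by simp),
      show plusAt ξ (N : ℤ) = addAt ξ (rightEnd N) from plusAt_coe ξ (rightEnd N)]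
    ring
  unfold forwardRate
  have e1 : ∀ η, p η * generator g α N a b F η = (N : ℝ) ^ (2 + α) / 2 *
      ((∑ x : Box N, (ν η * f η * g (η x) * (F (jump η x ((x : ℤ) + 1)) - F η)
          + ν η * f η * g (η x) * (F (jump η x ((x : ℤ) - 1)) - F η)))
        + (ν η * j η (-(N : ℤ) - 1) (-(N : ℤ)) + ν η * j η (N + 1) N)) := fun η => by
    rw [← hleft, ← hright, hpf]
    unfold generator
    have : ∑ x : Box N, (ν η * f η * g (η x) * (F (jump η x ((x : ℤ) + 1)) - F η)
          + ν η * f η * g (η x) * (F (jump η x ((x : ℤ) - 1)) - F η))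
        = ν η * f η * ∑ x : Box N, g (η x) *
          ((F (jump η x ((x : ℤ) + 1)) - F η) + (F (jump η x ((x : ℤ) - 1)) - F η)) := by
      rw [Finset.mul_sum]
      exact Finset.sum_congr rfl fun x _ => by ring
    rw [this]
    ring
  simp only [e1]
  rw [tsum_mul_left]
  congr 1
  have hsb : Summable fun η => ∑ x : Box N,
      (ν η * f η * g (η x) * (F (jump η x ((x : ℤ) + 1)) - F η)
        + ν η * f η * g (η x) * (F (jump η x ((x : ℤ) - 1)) - F η)) :=
    summable_sum fun x _ => (hs1 x _).add (hs1 x _)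
  rw [hsb.tsum_add ((hs2 _ _).add (hs2 _ _)), (hs2 _ _).tsum_add (hs2 _ _),
    Summable.tsum_finsetSum fun x _ => (hs1 x _).add (hs1 x _)]
  have e2 : ∀ ξ, ν ξ * ∑ z ∈ Finset.Icc (-(N : ℤ) - 1) N, (j ξ z (z + 1) + j ξ (z + 1) z)
      = ∑ x : Box N, (ν ξ * j ξ x (x + 1) + ν ξ * j ξ x (x - 1))
        + (ν ξ * j ξ (-(N : ℤ) - 1) (-(N : ℤ)) + ν ξ * j ξ (N + 1) N) := fun ξ => by
    rw [sum_bonds N (j ξ), ← Finset.sum_coe_sort (Finset.Icc (-(N : ℤ)) N), mul_add, Finset.mul_sum,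
      mul_add]
    simp only [mul_add]
  change _ = ∑' ξ, ν ξ * ∑ z ∈ Finset.Icc (-(N : ℤ) - 1) N, (j ξ z (z + 1) + j ξ (z + 1) z)
  simp only [e2]
  rw [Summable.tsum_add (summable_sum fun x _ => (hs2 _ _).add (hs2 _ _))
    ((hs2 _ _).add (hs2 _ _)), (hs2 _ _).tsum_add (hs2 _ _),
    Summable.tsum_finsetSum fun x _ => (hs2 _ _).add (hs2 _ _)]
  congr 1
  refine Finset.sum_congr rfl fun x _ => ?_
  rw [(hs1 _ _).tsum_add (hs1 _ _), (hs2 _ _).tsum_add (hs2 _ _), hjump, hjump]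

end Forward


/-! ### Entropy production with a cutoff -/

section Production

theorem sum_bonds_cutoff (N : ℕ) (lam U L F : ℤ → ℝ) {χ e : ℝ}
    (hF : ∀ z ∈ Finset.Icc (-(N : ℤ)) N, F z = χ * L z)
    (hFl : F (-(N : ℤ) - 1) = χ * L (-(N : ℤ) - 1) + e) (hFr : F (N + 1) = χ * L (N + 1) + e) :
    ∑ z ∈ Finset.Icc (-(N : ℤ) - 1) N,
        (lam z * U z * (F (z + 1) - F z) + lam (z + 1) * U (z + 1) * (F z - F (z + 1)))
      = χ * ∑ z ∈ Finset.Icc (-(N : ℤ) - 1) N,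
          (lam z * U z * (L (z + 1) - L z) + lam (z + 1) * U (z + 1) * (L z - L (z + 1)))
        + e * (lam N * U N + lam (-(N : ℤ)) * U (-(N : ℤ))
          - lam (N + 1) * U (N + 1) - lam (-(N : ℤ) - 1) * U (-(N : ℤ) - 1)) := by
  set d : ℤ → ℝ := fun z => F z - χ * L z with hd
  have h0 : ∀ z ∈ Finset.Icc (-(N : ℤ)) N, d z = 0 := fun z hz => by
    simp only [hd]; rw [hF z hz]; ring
  have hl : d (-(N : ℤ) - 1) = e := by simp only [hd]; rw [hFl]; ring
  have hr : d (N + 1) = e := by simp only [hd]; rw [hFr]; ring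
  have h1 : ∀ z, lam z * U z * (F (z + 1) - F z) + lam (z + 1) * U (z + 1) * (F z - F (z + 1))
      = χ * (lam z * U z * (L (z + 1) - L z) + lam (z + 1) * U (z + 1) * (L z - L (z + 1)))
        + (lam z * U z - lam (z + 1) * U (z + 1)) * (d (z + 1) - d z) := fun z => by
    simp only [hd]; ring
  simp only [h1]
  rw [Finset.sum_add_distrib, ← Finset.mul_sum]
  congr 1
  rw [sum_Icc_int_eq_add_left (by omega)]
  have h2 := sum_Icc_int_eq_add_right (a := -(N : ℤ)) (b := (N : ℤ) - 1) (by omega)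
    fun z => (lam z * U z - lam (z + 1) * U (z + 1)) * (d (z + 1) - d z)
  simp only [sub_add_cancel] at h2 ⊢
  rw [h2, Finset.sum_eq_zero, hl, hr, h0 (N : ℤ) (by simp), h0 (-(N : ℤ)) (by simp)]
  · ring
  · intro z hz
    rw [Finset.mem_Icc] at hz
    rw [h0 z (by rw [Finset.mem_Icc]; omega), h0 (z + 1) (by rw [Finset.mem_Icc]; omega)]
    ring

variable {N : ℕ} {g : ℕ → ℝ} {α : ℝ}

/-- The probability of at least `M` particles. -/
noncomputable def tailProb (p : Config N → ℝ) (M : ℕ) : ℝ :=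
  ∑' η, p η * if M ≤ total η then 1 else 0

/-- The Dirichlet form density at `ξ`: the sum over the bonds of the squared increments of the
square root of `f`. -/
noncomputable def bondEnergy (f : Config N → ℝ) (ξ : Config N) : ℝ :=
  ∑ z ∈ Finset.Icc (-(N : ℤ) - 1) N, (√(f (plusAt ξ (z + 1))) - √(f (plusAt ξ z))) ^ 2

theorem bondEnergy_nonneg (f : Config N → ℝ) (ξ : Config N) : 0 ≤ bondEnergy f ξ :=
  Finset.sum_nonneg fun _ _ => sq_nonneg _

theorem le_mul_of_lipschitz (hg0 : g 0 = 0) {K : ℝ} (hK : ∀ k, |g (k + 1) - g k| ≤ K) (k : ℕ) :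
    g k ≤ K * k := by
  induction k with
  | zero => simp [hg0]
  | succ k ih =>
    have := (abs_le.1 (hK k)).2
    push_cast
    linarith

theorem forwardRate_cutoff_le (hg0 : g 0 = 0) (hgpos : ∀ k, 0 < k → 0 < g k) {K : ℝ}
    (hK0 : 0 ≤ K) (hK : ∀ k, g k ≤ K * k) {a₀ b₀ a b : ℝ} (ha₀ : 0 < a₀) (hb₀ : b₀ ∈ fugacities g)
    (ha : a ∈ Icc a₀ b₀) (hb : b ∈ Icc a₀ b₀) {A : ℝ} (hA : 1 ≤ A) {M : ℕ} (hM : 0 < M)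
    {p f : Config N → ℝ} (hp : ∀ η, 0 ≤ p η) (hps : Summable p)
    (hpf : ∀ η, p η = refProb g N a b η * f η) :
    forwardRate g α p a b (fun η => cutoff M (total η) * Real.log (clip A (f η)))
      ≤ -((N : ℝ) ^ (2 + α) * a₀) * (∑ ξ ∈ (finite_total_le (N := N) (2 * M)).toFinset,
          refProb g N a b ξ * (cutoff M (total ξ + 1) * bondEnergy (fun η => clip A (f η)) ξ))
        + (N : ℝ) ^ (2 + α) / 2 * (Real.log A * (4 * K + (a + b))) * tailProb p M := by
  set F : Config N → ℝ := fun η => cutoff M (total η) * Real.log (clip A (f η)) with hF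
  set ν := refProb g N a b with hν
  set lam := profile N a b with hlam
  set Δ : ℕ → ℝ := fun n => cutoff M n - cutoff M (n + 1) with hΔ
  have hlA : 0 ≤ Real.log A := Real.log_nonneg hA
  have hνpos : ∀ η, 0 < ν η := fun η => prodProb_pos hgpos
    (fun x => fugacities_ordConnected ha₀ hb₀ (profile_box_mem_Icc ha hb x)) η
  have hf0 : ∀ η, 0 ≤ f η := fun η => by
    have h1 := hp η
    rw [hpf] at h1
    exact nonneg_of_mul_nonneg_right h1 (hνpos η)
  have hΔ0 : ∀ n, 0 ≤ Δ n := fun n => sub_nonneg.2 (cutoff_succ_le M n)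
  have hΔz : ∀ n, 2 * M ≤ n → Δ n = 0 := fun n h => by
    simp only [hΔ]; rw [cutoff_eq_zero hM h, cutoff_eq_zero hM (by omega)]; ring
  rw [forwardRate_eq_tsum_bonds hg0 hgpos a b hpf (F := F) (M := 2 * M) fun η hη => by
    simp only [hF]; rw [cutoff_eq_zero hM hη.le]; ring]
  have hN0 : (0 : ℝ) ≤ (N : ℝ) ^ (2 + α) / 2 := by positivity
  have hlampos : ∀ z ∈ Finset.Icc (-(N : ℤ) - 1) (N + 1), 0 ≤ lam z := fun z hz =>
    ha₀.le.trans (profile_mem_Icc ha hb hz).1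
  have hbox : ∀ x : Box N, 0 ≤ lam x := fun x => ha₀.le.trans (profile_box_mem_Icc ha hb x).1
  set err : Config N → ℝ := fun ξ => Real.log A * (Δ (total ξ) *
    (lam (rightEnd N) * f (addAt ξ (rightEnd N)) + lam (leftEnd N) * f (addAt ξ (leftEnd N))
      + (a + b) * f ξ)) with herr
  have hpt : ∀ ξ, ∑ z ∈ Finset.Icc (-(N : ℤ) - 1) N,
        (lam z * f (plusAt ξ z) * (F (plusAt ξ (z + 1)) - F (plusAt ξ z))
          + lam (z + 1) * f (plusAt ξ (z + 1)) * (F (plusAt ξ z) - F (plusAt ξ (z + 1))))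
      ≤ -(2 * a₀) * (cutoff M (total ξ + 1) * bondEnergy (fun η => clip A (f η)) ξ) + err ξ := by
    intro ξ
    have hl : plusAt ξ (-(N : ℤ) - 1) = ξ := plusAt_of_notMem ξ (by simp)
    have hr : plusAt ξ ((N : ℤ) + 1) = ξ := plusAt_of_notMem ξ (by simp)
    rw [sum_bonds_cutoff N lam (fun z => f (plusAt ξ z))
      (fun z => Real.log (clip A (f (plusAt ξ z)))) (fun z => F (plusAt ξ z))
      (χ := cutoff M (total ξ + 1)) (e := Δ (total ξ) * Real.log (clip A (f ξ)))]
    · have h1 := sum_bonds_log_clip_le hA N (lam := lam) (U := fun z => f (plusAt ξ z)) ha₀.le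
        (profile_succ_sub N a b) (fun z hz => (profile_mem_Icc ha hb hz).1) (by simp only [hl, hr])
      have h2 := mul_le_mul_of_nonneg_left h1 (cutoff_nonneg M (total ξ + 1))
      refine add_le_add ?_ ?_
      · refine h2.trans (le_of_eq ?_)
        unfold bondEnergy
        ring
      · simp only [hl, hr]
        rw [show plusAt ξ (-(N : ℤ)) = addAt ξ (leftEnd N) from plusAt_coe ξ (leftEnd N),
          show plusAt ξ (N : ℤ) = addAt ξ (rightEnd N) from plusAt_coe ξ (rightEnd N),
          hlam, profile_left, profile_right, ← hlam]
        have hR := mul_nonneg (hbox (rightEnd N)) (hf0 (addAt ξ (rightEnd N)))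
        have hL := mul_nonneg (hbox (leftEnd N)) (hf0 (addAt ξ (leftEnd N)))
        have hab : 0 ≤ (a + b) * f ξ := mul_nonneg (by linarith [ha.1, hb.1]) (hf0 ξ)
        have hlog := abs_log_clip_le hA (f ξ)
        set x := Real.log (clip A (f ξ))
        set y := lam (rightEnd N) * f (addAt ξ (rightEnd N)) with hy
        set y' := lam (leftEnd N) * f (addAt ξ (leftEnd N)) with hy'
        have e1 : lam (N : ℤ) * f (addAt ξ (rightEnd N)) = y := rfl
        have e2 : lam (-(N : ℤ)) * f (addAt ξ (leftEnd N)) = y' := rfl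
        rw [e1, e2]
        calc Δ (total ξ) * x * (y + y' - b * f ξ - a * f ξ)
            ≤ |Δ (total ξ) * x * (y + y' - b * f ξ - a * f ξ)| := le_abs_self _
          _ = Δ (total ξ) * (|x| * |y + y' - b * f ξ - a * f ξ|) := by
              rw [abs_mul, abs_mul, abs_of_nonneg (hΔ0 _)]; ring
          _ ≤ Δ (total ξ) * (Real.log A * (y + y' + (a + b) * f ξ)) := by
              refine mul_le_mul_of_nonneg_left (mul_le_mul hlog ?_ (abs_nonneg _) hlA) (hΔ0 _)
              rw [abs_le]
              constructor <;> linarith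
          _ = _ := by simp only [herr]; ring
    · intro z hz
      simp only [hF]
      rw [total_plusAt, if_pos hz]
    · simp only [hF, hl, hΔ]; ring
    · simp only [hF, hr, hΔ]; ring
  have hs0 : ∀ B : Config N → ℝ, Summable fun ξ => ν ξ * (Δ (total ξ) * B ξ) := fun B =>
    summable_of_total (M := 2 * M) fun ξ hξ => by rw [hΔz _ hξ.le]; ring
  have hs1 : Summable fun ξ => ν ξ * err ξ :=
    summable_of_total (M := 2 * M) fun ξ hξ => by simp only [herr]; rw [hΔz _ hξ.le]; ring
  have hs2 : Summable fun ξ => ν ξ *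
      (cutoff M (total ξ + 1) * bondEnergy (fun η => clip A (f η)) ξ) :=
    summable_of_total (M := 2 * M) fun ξ hξ => by rw [cutoff_eq_zero hM (by omega)]; ring
  have hmain : ∑' ξ, ν ξ * ∑ z ∈ Finset.Icc (-(N : ℤ) - 1) N,
        (lam z * f (plusAt ξ z) * (F (plusAt ξ (z + 1)) - F (plusAt ξ z))
          + lam (z + 1) * f (plusAt ξ (z + 1)) * (F (plusAt ξ z) - F (plusAt ξ (z + 1))))
      ≤ -(2 * a₀) * (∑ ξ ∈ (finite_total_le (N := N) (2 * M)).toFinset,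
          ν ξ * (cutoff M (total ξ + 1) * bondEnergy (fun η => clip A (f η)) ξ))
        + ∑' ξ, ν ξ * err ξ := by
    have h3 : ∑' ξ, ν ξ * (cutoff M (total ξ + 1) * bondEnergy (fun η => clip A (f η)) ξ)
        = ∑ ξ ∈ (finite_total_le (N := N) (2 * M)).toFinset,
          ν ξ * (cutoff M (total ξ + 1) * bondEnergy (fun η => clip A (f η)) ξ) := by
      refine tsum_eq_sum fun ξ hξ => ?_
      simp only [Finite.mem_toFinset, mem_ofPred_eq, not_le] at hξ
      rw [cutoff_eq_zero hM (by omega)]; ring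
    rw [← h3, ← tsum_mul_left, ← (hs2.mul_left _).tsum_add hs1]
    refine Summable.tsum_le_tsum (fun ξ => ?_) ?_ ((hs2.mul_left _).add hs1)
    · refine (mul_le_mul_of_nonneg_left (hpt ξ) (hνpos ξ).le).trans (le_of_eq ?_)
      ring
    · refine summable_of_total (M := 2 * M) fun ξ hξ => ?_
      have : ∀ z, F (plusAt ξ z) = 0 := fun z => by
        simp only [hF]; rw [cutoff_eq_zero hM (by rw [total_plusAt]; omega)]; ring
      simp [this]
  have herrsum : ∑' ξ, ν ξ * err ξ ≤ Real.log A * (4 * K + (a + b)) * tailProb p M := by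
    have htail : ∀ c : ℝ, Summable fun η => c * (p η * if M ≤ total η then 1 else 0) := fun c => by
      refine Summable.mul_left _ (hps.of_nonneg_of_le (fun η => ?_) fun η => ?_)
      · split_ifs <;> simp [hp η]
      · split_ifs <;> simp [hp η]
    have hside : ∀ x : Box N, ∑' ξ, ν ξ * (Δ (total ξ) * (lam x * f (addAt ξ x)))
        ≤ 2 * K * tailProb p M := fun x => by
      have h4 := tsum_mul_rate_eq hg0 hgpos a b f (fun η => Δ (total η - 1)) x
      have h5 : ∑' ξ, ν ξ * (Δ (total ξ) * (lam x * f (addAt ξ x)))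
          = ∑' ξ, ν ξ * (lam x * f (addAt ξ x) * Δ (total (addAt ξ x) - 1)) :=
        tsum_congr fun ξ => by rw [total_addAt, Nat.add_sub_cancel]; ring
      rw [h5, ← h4, tailProb, ← tsum_mul_left]
      refine Summable.tsum_le_tsum (fun η => ?_) ?_ (htail _)
      · rw [← hν, ← hpf]
        have hb : g (η x) * Δ (total η - 1) ≤ 2 * K * if M ≤ total η then 1 else 0 := by
          rcases Nat.eq_zero_or_pos (total η) with h0 | h0
          · have : η x = 0 := by have := apply_le_total η x; omega
            rw [this, hg0, zero_mul]
            split_ifs <;> simp [hK0]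
          · obtain ⟨m, hm⟩ : ∃ m, total η = m + 1 := ⟨total η - 1, by omega⟩
            have hx : (η x : ℝ) ≤ (m : ℝ) + 1 := by
              exact_mod_cast hm ▸ apply_le_total η x
            have h6 := cutoff_sub_succ_mul_le hM m
            rw [hm, Nat.add_sub_cancel]
            calc g (η x) * Δ m ≤ (K * ((m : ℝ) + 1)) * Δ m :=
                  mul_le_mul_of_nonneg_right ((hK _).trans
                    (mul_le_mul_of_nonneg_left hx hK0)) (hΔ0 m)
              _ = K * (Δ m * ((m : ℝ) + 1)) := by ring
              _ ≤ K * (if M ≤ m then 2 else 0) := mul_le_mul_of_nonneg_left h6 hK0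
              _ ≤ _ := by
                  by_cases h7 : M ≤ m
                  · rw [if_pos h7, if_pos (by omega)]; linarith
                  · rw [if_neg h7, mul_zero]
                    split_ifs <;> simp [hK0]
        calc p η * g (η x) * Δ (total η - 1) = p η * (g (η x) * Δ (total η - 1)) := by ring
          _ ≤ p η * (2 * K * if M ≤ total η then 1 else 0) :=
            mul_le_mul_of_nonneg_left hb (hp η)
          _ = _ := by ring
      · refine summable_of_total (M := 2 * M + 1) fun η hη => ?_
        rw [hΔz _ (by omega)]; ring
    have hcen : ∑' ξ, ν ξ * (Δ (total ξ) * f ξ) ≤ tailProb p M := by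
      rw [tailProb]
      refine Summable.tsum_le_tsum (fun η => ?_) (hs0 _) (by simpa using htail 1)
      have h6 := cutoff_sub_succ_le M (total η)
      have hM1 : ((M : ℝ))⁻¹ ≤ 1 := inv_le_one_of_one_le₀ (by exact_mod_cast hM)
      calc ν η * (Δ (total η) * f η) = p η * Δ (total η) := by rw [hpf]; ring
        _ ≤ _ := by
          refine mul_le_mul_of_nonneg_left ?_ (hp η)
          split_ifs with h
          · exact h6.trans hM1
          · simp only [hΔ]
            rw [cutoff_eq_one hM (by omega), cutoff_eq_one hM (by omega)]; simp
    have hsplit : ∑' ξ, ν ξ * err ξ = Real.log A *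
        (∑' ξ, ν ξ * (Δ (total ξ) * (lam (rightEnd N) * f (addAt ξ (rightEnd N))))
        + ∑' ξ, ν ξ * (Δ (total ξ) * (lam (leftEnd N) * f (addAt ξ (leftEnd N))))
        + (a + b) * ∑' ξ, ν ξ * (Δ (total ξ) * f ξ)) := by
      rw [← (hs0 _).tsum_add (hs0 _), ← tsum_mul_left (a := a + b),
        ← ((hs0 _).add (hs0 _)).tsum_add ((hs0 _).mul_left _), ← tsum_mul_left]
      refine tsum_congr fun ξ => ?_
      simp only [herr]; ring
    rw [hsplit, mul_assoc]
    refine mul_le_mul_of_nonneg_left ?_ hlA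
    have h8 := mul_le_mul_of_nonneg_left hcen (show 0 ≤ a + b by linarith [ha.1, hb.1])
    linarith [hside (rightEnd N), hside (leftEnd N)]
  have hfin := mul_le_mul_of_nonneg_left (hmain.trans (add_le_add_right herrsum _)) hN0
  refine hfin.trans (le_of_eq ?_)
  ring

end Production


/-! ### A Grönwall inequality with dissipation -/

theorem gronwall_dissipation {Y Y' D τ : ℝ → ℝ} {C n κ E T : ℝ} (hC : 0 ≤ C) (hn : 0 ≤ n)
    (hκ : 0 ≤ κ) (hE : 0 ≤ E) (hY : ContinuousOn Y (Icc 0 T))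
    (hY' : ∀ s ∈ Ico 0 T, HasDerivWithinAt Y (Y' s) (Ici s) s)
    (hD : Continuous D) (hD0 : ∀ s, 0 ≤ D s) (hτ : Continuous τ) (hτ0 : ∀ s, 0 ≤ τ s)
    (hbound : ∀ s ∈ Ico 0 T, Y' s ≤ C * (Y s + n) - κ * D s + E * τ s) {t : ℝ}
    (ht : t ∈ Icc 0 T) (hYt : 0 ≤ Y t) :
    Y t + κ * ∫ s in (0 : ℝ)..t, D s
      ≤ Real.exp (C * T) * (Y 0 + C * n * T + E * ∫ s in (0 : ℝ)..T, τ s) := by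
  set e := Real.exp (-(C * T)) with he
  have hint : Continuous fun s => C * n + E * τ s - e * κ * D s := by fun_prop
  have hle := image_le_of_deriv_right_le_deriv_boundary
    (f := fun s => Real.exp (-(C * s)) * Y s)
    (f' := fun s => Real.exp (-(C * s)) * -C * Y s + Real.exp (-(C * s)) * Y' s)
    (B := fun s => Y 0 + ∫ r in (0 : ℝ)..s, (C * n + E * τ r - e * κ * D r))
    (B' := fun s => C * n + E * τ s - e * κ * D s) (a := 0) (b := T)
    ((by fun_prop : Continuous fun s : ℝ => Real.exp (-(C * s))).continuousOn.mul hY)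
    (fun s hs => by
      have h1 : HasDerivAt (fun s : ℝ => Real.exp (-(C * s))) (Real.exp (-(C * s)) * -C) s := by
        have := ((hasDerivAt_id s).const_mul C).neg.exp
        simpa using this
      exact h1.hasDerivWithinAt.mul (hY' s hs))
    (by simp)
    ((continuous_const.add (intervalIntegral.continuous_primitive
      (fun a b => hint.intervalIntegrable a b) 0)).continuousOn)
    (fun s _ => ((intervalIntegral.integral_hasDerivAt_right (hint.intervalIntegrable 0 s)
      (hint.stronglyMeasurableAtFilter _ _) hint.continuousAt).const_add (Y 0)).hasDerivWithinAt)
    (fun s hs => by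
      have h1 := hbound s hs
      have hpos := Real.exp_pos (-(C * s))
      have h2 : Real.exp (-(C * s)) ≤ 1 := by
        rw [Real.exp_le_one_iff]; have := mul_nonneg hC hs.1; linarith
      have h3 : e ≤ Real.exp (-(C * s)) := by
        rw [he, Real.exp_le_exp]; have := mul_le_mul_of_nonneg_left hs.2.le hC; linarith
      have h4 := mul_le_mul_of_nonneg_left h1 hpos.le
      have h5 := mul_le_mul_of_nonneg_right h2 (add_nonneg (mul_nonneg hC hn)
        (mul_nonneg hE (hτ0 s)))
      have h6 := mul_le_mul_of_nonneg_right h3 (mul_nonneg hκ (hD0 s))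
      nlinarith)
  have h := hle ht
  have i1 : IntervalIntegrable (fun s => C * n + E * τ s) volume 0 t :=
    (by fun_prop : Continuous fun s => C * n + E * τ s).intervalIntegrable _ _
  have i2 : IntervalIntegrable (fun s => e * κ * D s) volume 0 t :=
    (by fun_prop : Continuous fun s => e * κ * D s).intervalIntegrable _ _
  rw [intervalIntegral.integral_sub i1 i2, intervalIntegral.integral_add
    (continuous_const.intervalIntegrable _ _) ((hτ.const_mul E).intervalIntegrable _ _),
    intervalIntegral.integral_const, intervalIntegral.integral_const_mul,
    intervalIntegral.integral_const_mul, sub_zero, smul_eq_mul] at h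
  have hmono : ∫ s in (0 : ℝ)..t, τ s ≤ ∫ s in (0 : ℝ)..T, τ s :=
    intervalIntegral.integral_mono_interval le_rfl ht.1 ht.2 (ae_of_all _ hτ0)
      (hτ.intervalIntegrable _ _)
  have h7 : e ≤ Real.exp (-(C * t)) := by
    rw [he, Real.exp_le_exp]; have := mul_le_mul_of_nonneg_left ht.2 hC; linarith
  have h8 := mul_le_mul_of_nonneg_right h7 hYt
  have h9 := mul_le_mul_of_nonneg_left hmono hE
  have h10 := mul_le_mul_of_nonneg_left ht.2 (mul_nonneg hC hn)
  have h11 : e * (Y t + κ * ∫ s in (0 : ℝ)..t, D s)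
      ≤ Y 0 + C * n * T + E * ∫ s in (0 : ℝ)..T, τ s := by nlinarith
  have h12 := mul_le_mul_of_nonneg_left h11 (Real.exp_pos (C * T)).le
  rwa [← mul_assoc, he, ← Real.exp_add, add_neg_cancel, Real.exp_zero, one_mul] at h12

/-! ### Time dependence of the reference measures -/

theorem hasDerivWithinAt_prod_of_log {κ : Type*} (S : Finset κ) {u : κ → ℝ → ℝ} {d : κ → ℝ}
    {s : ℝ} {I : Set ℝ} (h : ∀ i ∈ S, HasDerivWithinAt (u i) (u i s * d i) I s) :
    HasDerivWithinAt (fun r => ∏ i ∈ S, u i r) ((∏ i ∈ S, u i s) * ∑ i ∈ S, d i) I s := by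
  classical
  induction S using Finset.induction_on with
  | empty => simpa using hasDerivWithinAt_const s I (1 : ℝ)
  | insert i S hi ih =>
    simp only [Finset.prod_insert hi, Finset.sum_insert hi]
    refine ((h i (Finset.mem_insert_self _ _)).mul
      (ih fun j hj => h j (Finset.mem_insert_of_mem hj))).congr_deriv ?_
    ring

section RefDeriv

variable {g : ℕ → ℝ}

theorem card_box (N : ℕ) : Fintype.card (Box N) = 2 * N + 1 := by
  rw [Fintype.card_coe, Int.card_Icc]; omega

theorem exists_hasDerivWithinAt_refProb (hgpos : ∀ k, 0 < k → 0 < g k) {a₀ b₀ : ℝ} (ha₀ : 0 < a₀)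
    (hb₀ : b₀ ∈ fugacities g) (K' : ℝ) :
    ∃ K₂ : ℝ, 0 ≤ K₂ ∧ ∀ (N : ℕ) (aL aR : ℝ → ℝ) (s dL dR : ℝ), aL s ∈ Icc a₀ b₀ → aR s ∈ Icc a₀ b₀ →
      |dL| ≤ K' → |dR| ≤ K' → HasDerivWithinAt aL dL (Ici s) s →
      HasDerivWithinAt aR dR (Ici s) s → ∀ η : Config N,
      ∃ d : ℝ, |d| ≤ K₂ * (total η + (2 * N + 1)) ∧
        HasDerivWithinAt (fun r => refProb g N (aL r) (aR r) η)
          (refProb g N (aL s) (aR s) η * d) (Ici s) s := by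
  obtain ⟨K, hK0, hK⟩ := exists_hasDerivAt_siteProb hgpos ha₀ hb₀
  refine ⟨K * |K'|, by positivity, fun N aL aR s dL dR hL hR hdL hdR hL' hR' η => ?_⟩
  have hprof : ∀ x : Box N, ∃ e, |e| ≤ |K'| ∧
      HasDerivWithinAt (fun r => profile N (aL r) (aR r) x) e (Ici s) s := fun x => by
    set y : ℝ := ((x : ℤ) : ℝ) / (N + 1) with hy
    refine ⟨interp dL dR y, ?_, ?_⟩
    · rw [abs_le, ← mem_Icc]
      have h := Finset.mem_Icc.1 x.2
      have hN : (0 : ℝ) < (N : ℝ) + 1 := by positivity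
      refine interp_mem_Icc (abs_le.1 (hdL.trans (le_abs_self _)))
        (abs_le.1 (hdR.trans (le_abs_self _))) ⟨?_, ?_⟩
      · rw [hy, le_div_iff₀ hN]
        have : (-(N : ℝ)) ≤ (x : ℤ) := by exact_mod_cast h.1
        linarith
      · rw [hy, div_le_one hN]
        have : ((x : ℤ) : ℝ) ≤ N := by exact_mod_cast h.2
        linarith
    · exact (((hR'.sub hL').div_const 2).mul_const y).add ((hR'.add hL').div_const 2)
  choose e he hder using hprof
  choose d hd hds using fun x : Box N => hK _ (profile_box_mem_Icc hL hR x).1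
    (profile_box_mem_Icc hL hR x).2 (η x)
  refine ⟨∑ x, d x * e x, ?_, ?_⟩
  · calc |∑ x, d x * e x| ≤ ∑ x, |d x * e x| := Finset.abs_sum_le_sum_abs _ _
      _ ≤ ∑ x, K * (η x + 1) * |K'| := Finset.sum_le_sum fun x _ => by
          rw [abs_mul]
          exact mul_le_mul (hd x) (he x) (abs_nonneg _) (by positivity)
      _ = _ := by
          rw [← Finset.sum_mul, ← Finset.mul_sum, Finset.sum_add_distrib]
          simp only [Finset.sum_const, Finset.card_univ, card_box, nsmul_eq_mul, mul_one]
          unfold total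
          push_cast
          ring
  · unfold refProb prodProb
    refine hasDerivWithinAt_prod_of_log (d := fun x : Box N => d x * e x)
      (u := fun (x : Box N) r => siteProb g (profile N (aL r) (aR r) x) (η x)) Finset.univ fun x _ => ?_
    have := (hds x).comp_hasDerivWithinAt s (hder x)
    exact this.congr_deriv (by ring)

theorem continuous_refProb (hgpos : ∀ k, 0 < k → 0 < g k) {N : ℕ} {aL aR : ℝ → ℝ}
    (hL : ∀ s, aL s ∈ fugacities g) (hR : ∀ s, aR s ∈ fugacities g) (hLc : Continuous aL)
    (hRc : Continuous aR) (η : Config N) : Continuous fun s => refProb g N (aL s) (aR s) η := by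
  unfold refProb prodProb
  refine continuous_finsetProd _ fun x _ => continuous_iff_continuousAt.2 fun s => ?_
  have hN : (0 : ℝ) < (N : ℝ) + 1 := by positivity
  have hm := Finset.mem_Icc.1 x.2
  have hmem : profile N (aL s) (aR s) x ∈ fugacities g := by
    refine interp_mem_fugacities (hL s) (hR s) ⟨?_, ?_⟩
    · rw [le_div_iff₀ hN]
      have : (-(N : ℝ)) ≤ (x : ℤ) := by exact_mod_cast hm.1
      linarith
    · rw [div_le_one hN]
      have : ((x : ℤ) : ℝ) ≤ N := by exact_mod_cast hm.2
      linarith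
  have h2 : Continuous fun s => profile N (aL s) (aR s) x := by unfold profile interp; fun_prop
  exact ContinuousAt.comp (f := fun s => profile N (aL s) (aR s) x)
    (g := fun l => siteProb g l (η x)) (continuousAt_siteProb hgpos hmem (η x)) h2.continuousAt

end RefDeriv

open InformationTheory in
/-- The entropy inequality for the truncated density. -/
theorem sum_mul_total_le {N : ℕ} {A γ c₀ n : ℝ} (hA : 1 ≤ A) (hγ : 0 < γ) (hc₀ : 0 ≤ c₀) (hn : 0 ≤ n)
    (S : Finset (Config N)) {χ ν f : Config N → ℝ} (hχ0 : ∀ η, 0 ≤ χ η) (hχ1 : ∀ η, χ η ≤ 1)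
    (hν : ∀ η, 0 ≤ ν η) (hf : ∀ η, 0 ≤ f η) (hν1 : ∑ η ∈ S, ν η ≤ 1)
    (hf1 : ∑ η ∈ S, ν η * f η ≤ 1)
    (hexp : ∑ η ∈ S, ν η * Real.exp (γ * total η) ≤ Real.exp c₀) :
    ∑ η ∈ S, χ η * (ν η * ((total η + n) * (1 + clip A (f η))))
      ≤ γ⁻¹ * ((∑ η ∈ S, χ η * (ν η * entReg A (f η))) + 2 + 3 * c₀) + 3 * n := by
  have hpt : ∀ η, χ η * (ν η * ((total η + n) * (1 + clip A (f η))))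
      ≤ γ⁻¹ * (χ η * (ν η * entReg A (f η)) + 2 * Real.exp (-c₀) * (ν η * Real.exp (γ * total η))
        + c₀ * (2 * ν η + ν η * f η)) + n * (2 * ν η + ν η * f η) := fun η => by
    have hc := clip_pos hA (f η)
    have hc1 := clip_le_one_add hA (hf η)
    have h1 := mul_le_klFun_add_exp hc.le (γ * total η - c₀)
    have h2 := mul_le_klFun_add_exp zero_le_one (γ * total η - c₀)
    have h3 := klFun_clip_le_entReg hA (f η)
    rw [klFun_one] at h2
    have h4 : Real.exp (γ * total η - c₀) = Real.exp (-c₀) * Real.exp (γ * total η) := by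
      rw [← Real.exp_add]; ring_nf
    rw [h4] at h1 h2
    set X := Real.exp (-c₀) * Real.exp (γ * total η) with hX
    have hX0 : 0 ≤ X := by positivity
    have he0 := entReg_nonneg hA (f η)
    have h5 : γ * (total η * (1 + clip A (f η))) ≤ entReg A (f η) + 2 * X
        + c₀ * (2 + f η) := by nlinarith
    have h6 : total η * (1 + clip A (f η)) ≤ γ⁻¹ * (entReg A (f η) + 2 * X + c₀ * (2 + f η)) := by
      rw [inv_mul_eq_div, le_div_iff₀ hγ]; linarith
    have hχν : 0 ≤ χ η * ν η := mul_nonneg (hχ0 η) (hν η)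
    have hle : χ η * ν η ≤ ν η := mul_le_of_le_one_left (hν η) (hχ1 η)
    have hfη := hf η
    have h7 : n * (1 + clip A (f η)) ≤ n * (2 + f η) :=
      mul_le_mul_of_nonneg_left (by linarith) hn
    calc χ η * (ν η * ((total η + n) * (1 + clip A (f η))))
        = χ η * ν η * (total η * (1 + clip A (f η)) + n * (1 + clip A (f η))) := by ring
      _ ≤ χ η * ν η * (γ⁻¹ * (entReg A (f η) + 2 * X + c₀ * (2 + f η)) + n * (2 + f η)) :=
          mul_le_mul_of_nonneg_left (add_le_add h6 h7) hχν
      _ = γ⁻¹ * (χ η * (ν η * entReg A (f η)))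
          + χ η * ν η * (γ⁻¹ * (2 * X + c₀ * (2 + f η)) + n * (2 + f η)) := by ring
      _ ≤ γ⁻¹ * (χ η * (ν η * entReg A (f η)))
          + ν η * (γ⁻¹ * (2 * X + c₀ * (2 + f η)) + n * (2 + f η)) := by
          gcongr
      _ = _ := by rw [hX]; ring
  refine (Finset.sum_le_sum fun η _ => hpt η).trans ?_
  rw [Finset.sum_add_distrib, ← Finset.mul_sum, ← Finset.mul_sum, Finset.sum_add_distrib,
    Finset.sum_add_distrib, ← Finset.mul_sum, ← Finset.mul_sum, Finset.sum_add_distrib,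
    ← Finset.mul_sum]
  have h1 : 2 * ∑ η ∈ S, ν η + ∑ η ∈ S, ν η * f η ≤ 3 := by linarith
  have h2 : 2 * Real.exp (-c₀) * ∑ η ∈ S, ν η * Real.exp (γ * total η) ≤ 2 := by
    calc _ ≤ 2 * Real.exp (-c₀) * Real.exp c₀ := by gcongr
      _ = 2 := by rw [mul_assoc, ← Real.exp_add]; simp
  have h3 := mul_le_mul_of_nonneg_left h1 hc₀
  have h4 := mul_le_mul_of_nonneg_left h1 hn
  refine add_le_add (mul_le_mul_of_nonneg_left ?_ (by positivity)) (by linarith)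
  linarith


/-! ### Entropy and dissipation along the forward equation -/

/-- Probability weights that solve the forward equation of the zero-range process. -/
structure IsForwardSolution (g : ℕ → ℝ) (α : ℝ) {N : ℕ} (aL aR : ℝ → ℝ)
    (p : ℝ → Config N → ℝ) : Prop where
  nonneg : ∀ s η, 0 ≤ p s η
  tsum_eq_one : ∀ s, ∑' η, ENNReal.ofReal (p s η) = 1
  continuous : ∀ η, Continuous fun s => p s η
  hasDerivWithinAt : ∀ η s, 0 ≤ s → HasDerivWithinAt (fun s => p s η)
    (forwardRate g α (p s) (aL s) (aR s) (Pi.single η 1)) (Ici s) s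

/-- Boundary fugacities with values in `[a₀, b₀]` and slope at most `K'` on `[0, T]`. -/
structure IsDriving (g : ℕ → ℝ) (a₀ b₀ K' T : ℝ) (aL aR : ℝ → ℝ) : Prop where
  continuous_left : Continuous aL
  continuous_right : Continuous aR
  mem_left : ∀ s, aL s ∈ fugacities g
  mem_right : ∀ s, aR s ∈ fugacities g
  range_left : ∀ s ∈ Icc 0 T, aL s ∈ Icc a₀ b₀
  range_right : ∀ s ∈ Icc 0 T, aR s ∈ Icc a₀ b₀
  deriv_left : ∀ s ∈ Ico 0 T, ∃ d, |d| ≤ K' ∧ HasDerivWithinAt aL d (Ici s) s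
  deriv_right : ∀ s ∈ Ico 0 T, ∃ d, |d| ≤ K' ∧ HasDerivWithinAt aR d (Ici s) s

theorem hasSum_one_of_tsum_ofReal {X : Type*} {p : X → ℝ} (hp : ∀ η, 0 ≤ p η)
    (h : ∑' η, ENNReal.ofReal (p η) = 1) : HasSum p 1 := by
  have hs : Summable p := by
    have := ENNReal.summable_toReal (f := fun η => ENNReal.ofReal (p η)) (by rw [h]; simp)
    exact this.congr fun η => ENNReal.toReal_ofReal (hp η)
  have h2 := ENNReal.ofReal_tsum_of_nonneg hp hs
  rw [h] at h2
  have h3 : ∑' η, p η = 1 := by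
    have := congrArg ENNReal.toReal h2
    rwa [ENNReal.toReal_ofReal (tsum_nonneg hp), ENNReal.toReal_one] at this
  rw [← h3]
  exact hs.hasSum

section

variable {N : ℕ} {g : ℕ → ℝ} {α : ℝ}

theorem forwardRate_eq_sum_single (p : Config N → ℝ) (a b : ℝ) (S : Finset (Config N))
    {F : Config N → ℝ} (hF : ∀ η, η ∉ S → F η = 0) :
    forwardRate g α p a b F = ∑ η ∈ S, F η * forwardRate g α p a b (Pi.single η 1) := by
  classical
  have h1 : F = fun ξ => ∑ η ∈ S, F η * (Pi.single η (1 : ℝ) : Config N → ℝ) ξ := by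
    ext ξ
    by_cases h : ξ ∈ S
    · rw [Finset.sum_eq_single ξ]
      · simp
      · intro η _ hη; simp [Ne.symm hη]
      · intro h'; exact absurd h h'
    · rw [hF ξ h, Finset.sum_eq_zero]
      intro η hη
      have : ξ ≠ η := fun e => h (e ▸ hη)
      simp [this]
  have h2 : ∀ η : Config N, Summable fun ξ => p ξ * generator g α N a b (Pi.single η 1) ξ :=
    fun η => by
      obtain ⟨M, hM⟩ := exists_total_le_of_finite_support
        ((Set.finite_singleton η).subset (Pi.support_single_subset (i := η) (a := (1 : ℝ))))
      refine summable_of_total (M := M + 1) fun ξ hξ => ?_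
      rw [generator_eq_zero hM a b hξ, mul_zero]
  unfold forwardRate
  conv_lhs => rw [h1]
  simp only [generator_sum, Finset.mul_sum]
  rw [Summable.tsum_finsetSum]
  · refine Finset.sum_congr rfl fun η _ => ?_
    rw [← tsum_mul_left]
    exact tsum_congr fun ξ => by ring
  · intro η _
    exact ((h2 η).mul_left (F η)).congr fun ξ => by ring

theorem tailProb_eq {p : Config N → ℝ} (hp : HasSum p 1) (M : ℕ) :
    tailProb p M = 1 - ∑ η ∈ (finite_total_le (N := N) M).toFinset.filter (fun η => total η < M),
      p η := by
  set S := (finite_total_le (N := N) M).toFinset.filter (fun η => total η < M) with hS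
  have h1 : HasSum (fun η => if η ∈ S then p η else 0) (∑ η ∈ S, p η) := by
    have := hasSum_sum_of_ne_finset_zero (L := SummationFilter.unconditional _) (s := S) (f := fun η => if η ∈ S then p η else 0)
      fun η hη => by simp [hη]
    rwa [Finset.sum_congr rfl fun η hη => if_pos hη] at this
  have h2 := hp.sub h1
  rw [tailProb, ← h2.tsum_eq]
  refine tsum_congr fun η => ?_
  have : η ∈ S ↔ total η < M := by
    simp only [hS, Finset.mem_filter, Finite.mem_toFinset, mem_ofPred_eq]
    exact ⟨fun h => h.2, fun h => ⟨h.le, h⟩⟩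
  by_cases h : M ≤ total η
  · simp [this, h, not_lt.2 h]
  · simp [this, h, not_le.1 h]

theorem tailProb_nonneg {p : Config N → ℝ} (hp : ∀ η, 0 ≤ p η) (M : ℕ) : 0 ≤ tailProb p M :=
  tsum_nonneg fun η => mul_nonneg (hp η) (by split_ifs <;> simp)

theorem tailProb_le_one {p : Config N → ℝ} (hp : ∀ η, 0 ≤ p η) (h1 : HasSum p 1) (M : ℕ) :
    tailProb p M ≤ 1 := by
  rw [tailProb_eq h1]
  linarith [Finset.sum_nonneg (s := (finite_total_le (N := N) M).toFinset.filter
    (fun η => total η < M)) fun η _ => hp η]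

theorem tendsto_tailProb {p : Config N → ℝ} (h1 : HasSum p 1) :
    Tendsto (tailProb p) atTop (𝓝 0) := by
  have h : Tendsto (fun M => (finite_total_le (N := N) M).toFinset.filter (fun η => total η < M))
      atTop atTop := by
    refine tendsto_atTop_finset_of_monotone (fun M M' hM η hη => ?_) fun η => ⟨total η + 1, ?_⟩
    · simp only [Finset.mem_filter, Finite.mem_toFinset, mem_ofPred_eq] at *
      omega
    · simp
  have h2 := (h1.comp h).const_sub 1
  rw [sub_self] at h2
  exact h2.congr fun M => (tailProb_eq h1 M).symm

/-- The growth rate of the relative entropy. -/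
noncomputable def growthRate (g : ℕ → ℝ) (b₀ γ K₂ : ℝ) : ℝ :=
  K₂ * (γ⁻¹ * (3 + 3 * Real.log (partitionFn g (b₀ * Real.exp γ))) + 3)

variable {a₀ b₀ K' T γ : ℝ} {aL aR : ℝ → ℝ} {p : ℝ → Config N → ℝ}

theorem refProb_pos_of_mem (hgpos : ∀ k, 0 < k → 0 < g k) {a b : ℝ} (ha : a ∈ fugacities g)
    (hb : b ∈ fugacities g) (η : Config N) : 0 < refProb g N a b η := by
  have hm : max a b ∈ fugacities g := by rcases max_choice a b with h | h <;> rwa [h]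
  exact prodProb_pos hgpos (fun x => fugacities_ordConnected (a := min a b) (lt_min ha.1 hb.1) hm
    (profile_box_mem_Icc ⟨min_le_left _ _, le_max_left _ _⟩
      ⟨min_le_right _ _, le_max_right _ _⟩ x)) η

theorem IsForwardSolution.regularized_bound (hg0 : g 0 = 0) (hgpos : ∀ k, 0 < k → 0 < g k) {K : ℝ}
    (hK0 : 0 ≤ K) (hK : ∀ k, g k ≤ K * k) (ha₀ : 0 < a₀) (hb₀ : b₀ ∈ fugacities g) (hγ : 0 < γ)
    (hs : Summable (weight g (b₀ * Real.exp γ))) {K₂ : ℝ} (hK₂0 : 0 ≤ K₂)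
    (hK₂ : ∀ (aL aR : ℝ → ℝ) (s dL dR : ℝ), aL s ∈ Icc a₀ b₀ → aR s ∈ Icc a₀ b₀ →
      |dL| ≤ K' → |dR| ≤ K' → HasDerivWithinAt aL dL (Ici s) s →
      HasDerivWithinAt aR dR (Ici s) s → ∀ η : Config N,
      ∃ d : ℝ, |d| ≤ K₂ * (total η + (2 * N + 1)) ∧
        HasDerivWithinAt (fun r => refProb g N (aL r) (aR r) η)
          (refProb g N (aL s) (aR s) η * d) (Ici s) s)
    (hd : IsDriving g a₀ b₀ K' T aL aR) (hp : IsForwardSolution g α aL aR p)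
    {A : ℝ} (hA : 1 ≤ A) {M : ℕ} (hM : 0 < M) {t : ℝ} (ht : t ∈ Icc 0 T) :
    (∑ η ∈ (finite_total_le (N := N) (2 * M)).toFinset, cutoff M (total η) *
        (refProb g N (aL t) (aR t) η * entReg A (p t η / refProb g N (aL t) (aR t) η)))
      + (N : ℝ) ^ (2 + α) * a₀ * ∫ s in (0 : ℝ)..t,
        ∑ ξ ∈ (finite_total_le (N := N) (2 * M)).toFinset, refProb g N (aL s) (aR s) ξ *
          (cutoff M (total ξ + 1) *
            bondEnergy (fun η => clip A (p s η / refProb g N (aL s) (aR s) η)) ξ)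
      ≤ Real.exp (growthRate g b₀ γ K₂ * T) *
        ((∑ η ∈ (finite_total_le (N := N) (2 * M)).toFinset, cutoff M (total η) *
          (refProb g N (aL 0) (aR 0) η * entReg A (p 0 η / refProb g N (aL 0) (aR 0) η)))
        + growthRate g b₀ γ K₂ * (2 * N + 1) * T
        + (N : ℝ) ^ (2 + α) / 2 * (Real.log A * (4 * K + 2 * b₀)) *
          ∫ s in (0 : ℝ)..T, tailProb (p s) M) := by
  set S := (finite_total_le (N := N) (2 * M)).toFinset with hS
  set ν : ℝ → Config N → ℝ := fun s => refProb g N (aL s) (aR s) with hν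
  have hνpos : ∀ s η, 0 < ν s η := fun s η =>
    refProb_pos_of_mem hgpos (hd.mem_left s) (hd.mem_right s) η
  have hνc : ∀ η, Continuous fun s => ν s η := fun η =>
    continuous_refProb hgpos hd.mem_left hd.mem_right hd.continuous_left hd.continuous_right η
  have hfc : ∀ η, Continuous fun s => p s η / ν s η := fun η =>
    (hp.continuous η).div (hνc η) fun s => (hνpos s η).ne'
  have hsum : ∀ s, HasSum (p s) 1 := fun s =>
    hasSum_one_of_tsum_ofReal (hp.nonneg s) (hp.tsum_eq_one s)
  have hentc : Continuous (entReg A) :=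
    continuous_iff_continuousAt.2 fun u => (hasDerivAt_entReg hA u).continuousAt
  set Z := partitionFn g (b₀ * Real.exp γ) with hZ
  have hb₀0 : 0 ≤ b₀ * Real.exp γ := mul_nonneg hb₀.1.le (Real.exp_pos _).le
  have hZ1 : 1 ≤ Z := one_le_partitionFn hgpos hb₀0 hs
  have hl0 : 0 ≤ Real.log Z := Real.log_nonneg hZ1
  have hγi : 0 ≤ γ⁻¹ := (inv_pos.2 hγ).le
  have hC0 : 0 ≤ growthRate g b₀ γ K₂ := by
    unfold growthRate; positivity
  have hderν : ∀ s η, ∃ d : ℝ, s ∈ Ico 0 T → |d| ≤ K₂ * (total η + (2 * N + 1)) ∧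
      HasDerivWithinAt (fun r => ν r η) (ν s η * d) (Ici s) s := fun s η => by
    by_cases h : s ∈ Ico 0 T
    · obtain ⟨dL, hdL, hL⟩ := hd.deriv_left s h
      obtain ⟨dR, hdR, hR⟩ := hd.deriv_right s h
      obtain ⟨d, h1, h2⟩ := hK₂ aL aR s dL dR (hd.range_left s ⟨h.1, h.2.le⟩)
        (hd.range_right s ⟨h.1, h.2.le⟩) hdL hdR hL hR η
      exact ⟨d, fun _ => ⟨h1, h2⟩⟩
    · exact ⟨0, fun h' => absurd h' h⟩
  choose d hdν using hderν
  set F : ℝ → Config N → ℝ := fun s η => cutoff M (total η) * Real.log (clip A (p s η / ν s η))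
    with hF
  have hχS : ∀ η, η ∉ S → cutoff M (total η) = 0 := fun η hη => by
    simp only [hS, Finite.mem_toFinset, mem_ofPred_eq, not_le] at hη
    exact cutoff_eq_zero hM hη.le
  set Y : ℝ → ℝ := fun s => ∑ η ∈ S, cutoff M (total η) * (ν s η * entReg A (p s η / ν s η)) with hY
  have hY0 : ∀ s, 0 ≤ Y s := fun s => Finset.sum_nonneg fun η _ =>
    mul_nonneg (cutoff_nonneg _ _) (mul_nonneg (hνpos s η).le (entReg_nonneg hA _))
  have hTle : ∀ s ∈ Ico 0 T, s ∈ Icc 0 T := fun s h => ⟨h.1, h.2.le⟩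
  refine gronwall_dissipation (Y := Y)
    (Y' := fun s => forwardRate g α (p s) (aL s) (aR s) (F s)
      + ∑ η ∈ S, cutoff M (total η) * ((1 - clip A (p s η / ν s η)) * (ν s η * d s η)))
    (D := fun s => ∑ ξ ∈ S, ν s ξ * (cutoff M (total ξ + 1) *
      bondEnergy (fun η => clip A (p s η / ν s η)) ξ))
    (τ := fun s => tailProb (p s) M)
    hC0 (by positivity) (mul_nonneg (by positivity) ha₀.le) ?_ ?_ ?_ ?_ ?_ ?_ ?_ ?_ ht (hY0 t)
  · have := hb₀.1
    have := Real.log_nonneg hA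
    positivity
  · refine Continuous.continuousOn (continuous_finsetSum _ fun η _ => continuous_const.mul
      ((hνc η).mul (hentc.comp (hfc η))))
  · intro s hsT
    have h1 : HasDerivWithinAt Y (∑ η ∈ S, cutoff M (total η) *
        (Real.log (clip A (p s η / ν s η)) *
            forwardRate g α (p s) (aL s) (aR s) (Pi.single η 1)
          + (1 - clip A (p s η / ν s η)) * (ν s η * d s η))) (Ici s) s := by
      refine HasDerivWithinAt.fun_sum fun η _ => HasDerivWithinAt.const_mul _ ?_
      exact hasDerivWithinAt_mul_entReg hA (hp.hasDerivWithinAt η s hsT.1)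
        (hdν s η hsT).2 (hνpos s η).ne'
    refine h1.congr_deriv ?_
    rw [forwardRate_eq_sum_single (p s) (aL s) (aR s) S (F := F s) fun η hη => by
      simp only [hF]; rw [hχS η hη, zero_mul], ← Finset.sum_add_distrib]
    exact Finset.sum_congr rfl fun η _ => by simp only [hF]; ring
  · refine continuous_finsetSum _ fun ξ _ => (hνc ξ).mul (continuous_const.mul ?_)
    unfold bondEnergy
    refine continuous_finsetSum _ fun z _ => ?_
    have hcl := fun η => ((continuous_clip A).comp (hfc η)).sqrt
    exact ((hcl _).sub (hcl _)).pow 2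
  · exact fun s => Finset.sum_nonneg fun ξ _ => mul_nonneg (hνpos s ξ).le
      (mul_nonneg (cutoff_nonneg _ _) (bondEnergy_nonneg _ _))
  · have : (fun s => tailProb (p s) M) = fun s => 1 - ∑ η ∈ (finite_total_le
        (N := N) M).toFinset.filter (fun η => total η < M), p s η := by
      ext s; exact tailProb_eq (hsum s) M
    rw [this]
    exact continuous_const.sub (continuous_finsetSum _ fun η _ => hp.continuous η)
  · exact fun s => tailProb_nonneg (hp.nonneg s) M
  · intro s hsT
    have hL := hd.range_left s (hTle s hsT)
    have hR := hd.range_right s (hTle s hsT)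
    have h1 := forwardRate_cutoff_le (α := α) hg0 hgpos hK0 hK ha₀ hb₀ hL hR hA hM (hp.nonneg s)
      (hsum s).summable (f := fun η => p s η / ν s η)
      fun η => (mul_div_cancel₀ _ (hνpos s η).ne').symm
    have hlam : ∀ x : Box N, profile N (aL s) (aR s) x ∈ fugacities g := fun x =>
      fugacities_ordConnected ha₀ hb₀ (profile_box_mem_Icc hL hR x)
    have hνsum : HasSum (ν s) 1 :=
      hasSum_one_of_tsum_ofReal (fun η => (hνpos s η).le) (tsum_prodProb hgpos hlam)
    have h2 : ∑ η ∈ S, cutoff M (total η) * ((1 - clip A (p s η / ν s η)) * (ν s η * d s η))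
        ≤ K₂ * ∑ η ∈ S, cutoff M (total η) * (ν s η * ((total η + (2 * (N : ℝ) + 1)) *
          (1 + clip A (p s η / ν s η)))) := by
      rw [Finset.mul_sum]
      refine Finset.sum_le_sum fun η _ => ?_
      have hc := clip_pos hA (p s η / ν s η)
      have hdle := (hdν s η hsT).1
      have h3 : (1 - clip A (p s η / ν s η)) * d s η
          ≤ (1 + clip A (p s η / ν s η)) * (K₂ * (total η + (2 * (N : ℝ) + 1))) := by
        calc _ ≤ |(1 - clip A (p s η / ν s η)) * d s η| := le_abs_self _
          _ = |1 - clip A (p s η / ν s η)| * |d s η| := abs_mul _ _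
          _ ≤ _ := by
            refine mul_le_mul ?_ hdle (abs_nonneg _) (by positivity)
            rw [abs_le]; constructor <;> linarith
      have h4 := mul_le_mul_of_nonneg_left h3
        (mul_nonneg (cutoff_nonneg M (total η)) (hνpos s η).le)
      nlinarith
    have hexp : ∑ η ∈ S, ν s η * Real.exp (γ * total η)
        ≤ Real.exp ((2 * (N : ℝ) + 1) * Real.log Z) := by
      have h3 := tsum_prodProb_exp_le hgpos hlam
        (fun x => (profile_box_mem_Icc hL hR x).2) hs
      have h4 := (ENNReal.sum_le_tsum S).trans h3
      have h5 : ∀ η : Config N, 0 ≤ prodProb g (fun x : Box N => profile N (aL s) (aR s) x) η *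
          Real.exp (γ * ∑ x, (η x : ℝ)) := fun η =>
        mul_nonneg (hνpos s η).le (Real.exp_pos _).le
      rw [← ENNReal.ofReal_sum_of_nonneg fun η _ => h5 η,
        ENNReal.ofReal_le_ofReal_iff (Real.exp_pos _).le, card_box] at h4
      refine le_trans (le_of_eq ?_) (h4.trans (le_of_eq ?_))
      · refine Finset.sum_congr rfl fun η _ => ?_
        unfold total
        push_cast
        rfl
      · push_cast; rfl
    have hn1 : (1 : ℝ) ≤ 2 * (N : ℝ) + 1 := by
      have : (0 : ℝ) ≤ (N : ℝ) := Nat.cast_nonneg N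
      linarith
    have h3 := sum_mul_total_le (c₀ := (2 * (N : ℝ) + 1) * Real.log Z) (n := 2 * (N : ℝ) + 1)
      hA hγ (by positivity) (by positivity) S
      (χ := fun η => cutoff M (total η)) (ν := ν s) (f := fun η => p s η / ν s η)
      (fun η => cutoff_nonneg _ _) (fun η => cutoff_le_one _ _) (fun η => (hνpos s η).le)
      (fun η => div_nonneg (hp.nonneg s η) (hνpos s η).le)
      (sum_le_hasSum S (fun η _ => (hνpos s η).le) hνsum)
      (by
        have := sum_le_hasSum S (fun η _ => hp.nonneg s η) (hsum s)
        refine le_trans (le_of_eq (Finset.sum_congr rfl fun η _ => ?_)) this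
        exact mul_div_cancel₀ _ (hνpos s η).ne') hexp
    have h5 : γ⁻¹ * (Y s + 2 + 3 * ((2 * (N : ℝ) + 1) * Real.log Z)) + 3 * (2 * (N : ℝ) + 1)
        ≤ (γ⁻¹ * (3 + 3 * Real.log Z) + 3) * (Y s + (2 * (N : ℝ) + 1)) := by
      have e1 := hY0 s
      have e2 := mul_nonneg hγi e1
      have e3 := mul_nonneg e2 hl0
      have e4 := mul_le_mul_of_nonneg_left hn1 hγi
      nlinarith
    have h6 := h2.trans ((mul_le_mul_of_nonneg_left (h3.trans h5) hK₂0))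
    have h7 : (N : ℝ) ^ (2 + α) / 2 * (Real.log A * (4 * K + (aL s + aR s))) * tailProb (p s) M
        ≤ (N : ℝ) ^ (2 + α) / 2 * (Real.log A * (4 * K + 2 * b₀)) * tailProb (p s) M := by
      refine mul_le_mul_of_nonneg_right ?_ (tailProb_nonneg (hp.nonneg s) M)
      have := Real.log_nonneg hA
      refine mul_le_mul_of_nonneg_left (mul_le_mul_of_nonneg_left ?_ this) (by positivity)
      linarith [hL.2, hR.2]
    unfold growthRate
    rw [← hZ]
    linarith

end


section

variable {N : ℕ} {g : ℕ → ℝ} {α : ℝ} {a₀ b₀ K' T γ : ℝ} {aL aR : ℝ → ℝ} {p : ℝ → Config N → ℝ}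

/-- Bounds on the relative entropy and on the integrated Dirichlet form. -/
theorem IsForwardSolution.entropy_dissipation (hg0 : g 0 = 0) (hgpos : ∀ k, 0 < k → 0 < g k) {K : ℝ}
    (hK0 : 0 ≤ K) (hK : ∀ k, g k ≤ K * k) (ha₀ : 0 < a₀) (hb₀ : b₀ ∈ fugacities g) (hγ : 0 < γ)
    (hs : Summable (weight g (b₀ * Real.exp γ))) {K₂ : ℝ} (hK₂0 : 0 ≤ K₂)
    (hK₂ : ∀ (aL aR : ℝ → ℝ) (s dL dR : ℝ), aL s ∈ Icc a₀ b₀ → aR s ∈ Icc a₀ b₀ →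
      |dL| ≤ K' → |dR| ≤ K' → HasDerivWithinAt aL dL (Ici s) s →
      HasDerivWithinAt aR dR (Ici s) s → ∀ η : Config N,
      ∃ d : ℝ, |d| ≤ K₂ * (total η + (2 * N + 1)) ∧
        HasDerivWithinAt (fun r => refProb g N (aL r) (aR r) η)
          (refProb g N (aL s) (aR s) η * d) (Ici s) s)
    (hd : IsDriving g a₀ b₀ K' T aL aR) (hp : IsForwardSolution g α aL aR p) (hN : 0 < N)
    (hT : 0 ≤ T) {H₀ : ℝ} (hH₀ : 0 ≤ H₀)
    (hent : relEntropy (p 0) (refProb g N (aL 0) (aR 0)) ≤ ENNReal.ofReal H₀) {B : ℝ}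
    (hB : B = Real.exp (growthRate g b₀ γ K₂ * T) * (H₀ + growthRate g b₀ γ K₂ * (2 * N + 1) * T)) :
    (∀ t ∈ Icc 0 T, relEntropy (p t) (refProb g N (aL t) (aR t)) ≤ ENNReal.ofReal B) ∧
    ∫⁻ s in Icc 0 T, ∑' ξ, ENNReal.ofReal (refProb g N (aL s) (aR s) ξ *
        bondEnergy (fun η => p s η / refProb g N (aL s) (aR s) η) ξ)
      ≤ ENNReal.ofReal (B / ((N : ℝ) ^ (2 + α) * a₀)) := by
  set ν : ℝ → Config N → ℝ := fun s => refProb g N (aL s) (aR s) with hν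
  have hνpos : ∀ s η, 0 < ν s η := fun s η =>
    refProb_pos_of_mem hgpos (hd.mem_left s) (hd.mem_right s) η
  have hf0 : ∀ s η, 0 ≤ p s η / ν s η := fun s η => div_nonneg (hp.nonneg s η) (hνpos s η).le
  have hνc : ∀ η, Continuous fun s => ν s η := fun η =>
    continuous_refProb hgpos hd.mem_left hd.mem_right hd.continuous_left hd.continuous_right η
  have hfc : ∀ η, Continuous fun s => p s η / ν s η := fun η =>
    (hp.continuous η).div (hνc η) fun s => (hνpos s η).ne'
  have hsum : ∀ s, HasSum (p s) 1 := fun s =>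
    hasSum_one_of_tsum_ofReal (hp.nonneg s) (hp.tsum_eq_one s)
  have hκ : 0 < (N : ℝ) ^ (2 + α) * a₀ :=
    mul_pos (Real.rpow_pos_of_pos (by exact_mod_cast hN) _) ha₀
  set κ := (N : ℝ) ^ (2 + α) * a₀ with hκdef
  set S : ℕ → Finset (Config N) := fun M => (finite_total_le (N := N) M).toFinset with hS
  have hinit : ∀ A, 1 ≤ A → ∀ M, ∑ η ∈ S (2 * M), cutoff M (total η) *
      (ν 0 η * entReg A (p 0 η / ν 0 η)) ≤ H₀ := fun A hA M => by
    have h1 : ∀ η, 0 ≤ ν 0 η * InformationTheory.klFun (p 0 η / ν 0 η) := fun η =>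
      mul_nonneg (hνpos 0 η).le (InformationTheory.klFun_nonneg (hf0 0 η))
    have h2 := (ENNReal.sum_le_tsum (S (2 * M))).trans hent
    rw [← ENNReal.ofReal_sum_of_nonneg fun η _ => h1 η, ENNReal.ofReal_le_ofReal_iff hH₀] at h2
    refine le_trans (Finset.sum_le_sum fun η _ => ?_) h2
    have h3 : ν 0 η * entReg A (p 0 η / ν 0 η)
        ≤ ν 0 η * InformationTheory.klFun (p 0 η / ν 0 η) :=
      mul_le_mul_of_nonneg_left (entReg_le_klFun hA (hf0 0 η)) (hνpos 0 η).le
    refine le_trans ?_ h3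
    exact mul_le_of_le_one_left (mul_nonneg (hνpos 0 η).le (entReg_nonneg hA _))
      (cutoff_le_one _ _)
  have htail : Tendsto (fun M => ∫ s in (0 : ℝ)..T, tailProb (p s) M) atTop (𝓝 0) := by
    have hm : ∀ M, Continuous fun s => tailProb (p s) M := fun M => by
      have : (fun s => tailProb (p s) M) = fun s => 1 - ∑ η ∈ (finite_total_le
          (N := N) M).toFinset.filter (fun η => total η < M), p s η := by
        ext s; exact tailProb_eq (hsum s) M
      rw [this]
      exact continuous_const.sub (continuous_finsetSum _ fun η _ => hp.continuous η)
    have h1 := intervalIntegral.tendsto_integral_filter_of_dominated_convergence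
      (μ := volume) (a := 0) (b := T) (l := atTop) (F := fun M s => tailProb (p s) M)
      (f := fun _ => (0 : ℝ)) (fun _ => (1 : ℝ))
      (Eventually.of_forall fun M => (hm M).aestronglyMeasurable)
      (Eventually.of_forall fun M => ae_of_all _ fun s _ => by
        rw [Real.norm_eq_abs, abs_of_nonneg (tailProb_nonneg (hp.nonneg s) M)]
        exact tailProb_le_one (hp.nonneg s) (hsum s) M)
      (continuous_const.intervalIntegrable _ _)
      (ae_of_all _ fun s _ => tendsto_tailProb (hsum s))
    simpa using h1
  have hrhs : ∀ A, Tendsto (fun M => Real.exp (growthRate g b₀ γ K₂ * T) *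
      (H₀ + growthRate g b₀ γ K₂ * (2 * N + 1) * T
        + (N : ℝ) ^ (2 + α) / 2 * (Real.log A * (4 * K + 2 * b₀)) *
          ∫ s in (0 : ℝ)..T, tailProb (p s) M)) atTop (𝓝 B) := fun A => by
    have := ((htail.const_mul ((N : ℝ) ^ (2 + α) / 2 * (Real.log A * (4 * K + 2 * b₀)))).const_add
      (H₀ + growthRate g b₀ γ K₂ * (2 * N + 1) * T)).const_mul
        (Real.exp (growthRate g b₀ γ K₂ * T))
    rwa [mul_zero, add_zero, ← hB] at this
  have hbound : ∀ A, 1 ≤ A → ∀ M, 0 < M → ∀ t ∈ Icc 0 T,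
      (∑ η ∈ S (2 * M), cutoff M (total η) * (ν t η * entReg A (p t η / ν t η)))
      + κ * ∫ s in (0 : ℝ)..t, ∑ ξ ∈ S (2 * M), ν s ξ * (cutoff M (total ξ + 1) *
            bondEnergy (fun η => clip A (p s η / ν s η)) ξ)
      ≤ Real.exp (growthRate g b₀ γ K₂ * T) *
        (H₀ + growthRate g b₀ γ K₂ * (2 * N + 1) * T
        + (N : ℝ) ^ (2 + α) / 2 * (Real.log A * (4 * K + 2 * b₀)) *
          ∫ s in (0 : ℝ)..T, tailProb (p s) M) := fun A hA M hM t ht => by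
    refine (hp.regularized_bound hg0 hgpos hK0 hK ha₀ hb₀ hγ hs hK₂0 hK₂ hd hA hM ht).trans ?_
    refine mul_le_mul_of_nonneg_left ?_ (Real.exp_pos _).le
    have := hinit A hA M
    simp only [hS, hν] at this
    linarith
  have hent0 : ∀ A, 1 ≤ A → ∀ M t, 0 ≤ ∑ η ∈ S (2 * M), cutoff M (total η) *
      (ν t η * entReg A (p t η / ν t η)) := fun A hA M t => Finset.sum_nonneg fun η _ =>
    mul_nonneg (cutoff_nonneg _ _) (mul_nonneg (hνpos t η).le (entReg_nonneg hA _))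
  have hDcont : ∀ A (c : Config N → ℝ) (S₀ : Finset (Config N)), Continuous fun s =>
      ∑ ξ ∈ S₀, ν s ξ * (c ξ * bondEnergy (fun η => clip A (p s η / ν s η)) ξ) := fun A c S₀ => by
    refine continuous_finsetSum _ fun ξ _ => (hνc ξ).mul (continuous_const.mul ?_)
    unfold bondEnergy
    refine continuous_finsetSum _ fun z _ => ?_
    have hcl := fun η => ((continuous_clip A).comp (hfc η)).sqrt
    exact ((hcl _).sub (hcl _)).pow 2
  have hDcont' : ∀ A (S₀ : Finset (Config N)), Continuous fun s =>
      ∑ ξ ∈ S₀, ν s ξ * bondEnergy (fun η => clip A (p s η / ν s η)) ξ := fun A S₀ => by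
    simpa using hDcont A (fun _ => 1) S₀
  have hD0 : ∀ A (c : Config N → ℝ) (S₀ : Finset (Config N)) s, (∀ ξ, 0 ≤ c ξ) →
      0 ≤ ∑ ξ ∈ S₀, ν s ξ * (c ξ * bondEnergy (fun η => clip A (p s η / ν s η)) ξ) :=
    fun A c S₀ s hc => Finset.sum_nonneg fun ξ _ => mul_nonneg (hνpos s ξ).le
      (mul_nonneg (hc ξ) (bondEnergy_nonneg _ _))
  have hfin1 : ∀ A, 1 ≤ A → ∀ (S₀ : Finset (Config N)), ∀ t ∈ Icc 0 T,
      ∑ η ∈ S₀, ν t η * entReg A (p t η / ν t η) ≤ B := fun A hA S₀ t ht => by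
    refine ge_of_tendsto (hrhs A) ?_
    filter_upwards [eventually_ge_atTop (S₀.sup total + 1)] with M hM
    have hM0 : 0 < M := by omega
    have hle : ∀ η ∈ S₀, total η ≤ M := fun η hη => (Finset.le_sup hη).trans (by omega)
    refine le_trans ?_ ((le_add_of_nonneg_right ?_).trans (hbound A hA M hM0 t ht))
    · have h1 : ∑ η ∈ S₀, ν t η * entReg A (p t η / ν t η)
          = ∑ η ∈ S₀, cutoff M (total η) * (ν t η * entReg A (p t η / ν t η)) :=
        Finset.sum_congr rfl fun η hη => by rw [cutoff_eq_one hM0 (hle η hη), one_mul]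
      rw [h1]
      refine Finset.sum_le_sum_of_subset_of_nonneg (fun η hη => ?_) fun η _ _ =>
        mul_nonneg (cutoff_nonneg _ _) (mul_nonneg (hνpos t η).le (entReg_nonneg hA _))
      simp only [hS, Finite.mem_toFinset, mem_ofPred_eq]
      have := hle η hη
      omega
    · refine mul_nonneg hκ.le (intervalIntegral.integral_nonneg ht.1 fun s _ => ?_)
      exact hD0 A (fun ξ => cutoff M (total ξ + 1)) _ s fun ξ => cutoff_nonneg _ _
  have hfin2 : ∀ A, 1 ≤ A → ∀ (S₀ : Finset (Config N)),
      κ * ∫ s in (0 : ℝ)..T, ∑ ξ ∈ S₀, ν s ξ * bondEnergy (fun η => clip A (p s η / ν s η)) ξ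
        ≤ B := fun A hA S₀ => by
    refine ge_of_tendsto (hrhs A) ?_
    filter_upwards [eventually_ge_atTop (S₀.sup total + 1)] with M hM
    have hM0 : 0 < M := by omega
    have hle : ∀ η ∈ S₀, total η + 1 ≤ M := fun η hη => by
      have := Finset.le_sup (f := total) hη
      omega
    refine le_trans ?_ ((le_add_of_nonneg_left (hent0 A hA M T)).trans
      (hbound A hA M hM0 T ⟨hT, le_rfl⟩))
    refine mul_le_mul_of_nonneg_left ?_ hκ.le
    refine intervalIntegral.integral_mono_on hT ((hDcont' A S₀).intervalIntegrable _ _)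
      ((hDcont A (fun ξ => cutoff M (total ξ + 1)) _).intervalIntegrable _ _) fun s _ => ?_
    have h1 : ∑ ξ ∈ S₀, ν s ξ * bondEnergy (fun η => clip A (p s η / ν s η)) ξ
        = ∑ ξ ∈ S₀, ν s ξ * (cutoff M (total ξ + 1) *
          bondEnergy (fun η => clip A (p s η / ν s η)) ξ) :=
      Finset.sum_congr rfl fun η hη => by rw [cutoff_eq_one hM0 (hle η hη), one_mul]
    rw [h1]
    refine Finset.sum_le_sum_of_subset_of_nonneg (fun η hη => ?_) fun η _ _ =>
      mul_nonneg (hνpos s η).le (mul_nonneg (cutoff_nonneg _ _) (bondEnergy_nonneg _ _))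
    simp only [hS, Finite.mem_toFinset, mem_ofPred_eq]
    have := hle η hη
    omega
  have hA1 : ∀ n : ℕ, (1 : ℝ) ≤ (n : ℝ) + 1 := fun n => by
    have : (0 : ℝ) ≤ (n : ℝ) := Nat.cast_nonneg n
    linarith
  refine ⟨fun t ht => ?_, ?_⟩
  · unfold relEntropy
    rw [ENNReal.tsum_eq_iSup_sum]
    refine iSup_le fun S₀ => ?_
    rw [← ENNReal.ofReal_sum_of_nonneg fun η _ =>
      mul_nonneg (hνpos t η).le (InformationTheory.klFun_nonneg (hf0 t η))]
    refine ENNReal.ofReal_le_ofReal ?_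
    refine le_of_tendsto (tendsto_finsetSum S₀ fun η _ =>
      (tendsto_entReg (hf0 t η)).const_mul (ν t η)) ?_
    exact Eventually.of_forall fun n => hfin1 _ (hA1 n) S₀ t ht
  · have hbEc : ∀ ξ, Measurable fun s => ENNReal.ofReal (ν s ξ *
        bondEnergy (fun η => p s η / ν s η) ξ) := fun ξ => by
      refine Measurable.ennreal_ofReal (Continuous.measurable ((hνc ξ).mul ?_))
      unfold bondEnergy
      refine continuous_finsetSum _ fun z _ => ?_
      exact ((hfc _).sqrt.sub (hfc _).sqrt).pow 2
    rw [lintegral_tsum fun ξ => (hbEc ξ).aemeasurable, ENNReal.tsum_eq_iSup_sum]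
    refine iSup_le fun S₀ => ?_
    rw [← lintegral_finsetSum _ fun ξ _ => hbEc ξ]
    have hlim : ∀ s, ∑ ξ ∈ S₀, ENNReal.ofReal (ν s ξ * bondEnergy (fun η => p s η / ν s η) ξ)
        = liminf (fun n : ℕ => ENNReal.ofReal (∑ ξ ∈ S₀, ν s ξ *
          bondEnergy (fun η => clip ((n : ℝ) + 1) (p s η / ν s η)) ξ)) atTop := fun s => by
      rw [← ENNReal.ofReal_sum_of_nonneg fun ξ _ => mul_nonneg (hνpos s ξ).le
        (bondEnergy_nonneg _ _)]
      refine (Tendsto.liminf_eq ?_).symm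
      refine ENNReal.tendsto_ofReal (tendsto_finsetSum S₀ fun ξ _ => Tendsto.const_mul _ ?_)
      unfold bondEnergy
      refine tendsto_finsetSum _ fun z _ => ?_
      exact ((tendsto_clip (hf0 s _)).sqrt.sub (tendsto_clip (hf0 s _)).sqrt).pow 2
    simp only [hlim]
    refine (lintegral_liminf_le fun n => (hDcont' _ S₀).measurable.ennreal_ofReal).trans ?_
    refine (liminf_le_liminf (Eventually.of_forall fun n => ?_)).trans_eq (liminf_const _)
    have h1 := hfin2 _ (hA1 n) S₀
    rw [← ofReal_integral_eq_lintegral_ofReal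
      ((hDcont' _ S₀).integrableOn_Icc) (ae_of_all _ fun s => by
        simpa using hD0 ((n : ℝ) + 1) (fun _ => 1) S₀ s fun _ => zero_le_one)]
    refine ENNReal.ofReal_le_ofReal ?_
    rw [integral_Icc_eq_integral_Ioc, ← intervalIntegral.integral_of_le hT, le_div_iff₀ hκ,
      mul_comm]
    exact h1

/-- Transport of a particle along the bonds to a reservoir. -/
theorem sq_sqrt_addAt_sub_le (f : Config N → ℝ) (ξ : Config N) (x : Box N) :
    (√(f (addAt ξ x)) - √(f ξ)) ^ 2 ≤ (2 * N + 2) * bondEnergy f ξ := by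
  have hx := Finset.mem_Icc.1 x.2
  have h1 := sum_Icc_int_sub (a := -(N : ℤ) - 1) (b := (x : ℤ) - 1) (by omega)
    fun z => √(f (plusAt ξ z))
  rw [sub_add_cancel, plusAt_coe, plusAt_of_notMem ξ (z := -(N : ℤ) - 1) (by simp)] at h1
  rw [← h1]
  refine (sq_sum_le_card_mul_sum_sq).trans ?_
  refine mul_le_mul ?_ ?_ (Finset.sum_nonneg fun _ _ => sq_nonneg _) (by positivity)
  · rw [Int.card_Icc]
    have : ((x : ℤ) - 1 + 1 - (-(N : ℤ) - 1)).toNat ≤ 2 * N + 2 := by omega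
    exact_mod_cast this
  · unfold bondEnergy
    refine Finset.sum_le_sum_of_subset_of_nonneg (fun z hz => ?_) fun _ _ _ => sq_nonneg _
    rw [Finset.mem_Icc] at *
    omega

end


/-! ### The initial entropy -/

open InformationTheory in
theorem relEntropy_eq_klDiv {X : Type*} [MeasurableSpace X] [Countable X]
    [MeasurableSingletonClass X] {μ ν : Measure X} [IsFiniteMeasure μ] [IsFiniteMeasure ν]
    (h : klDiv μ ν ≠ ∞) (hν : ∀ x, ν {x} ≠ 0) :
    relEntropy (fun x => μ.real {x}) (fun x => ν.real {x}) = klDiv μ ν := by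
  have hac := (klDiv_ne_top_iff.1 h).1
  rw [klDiv_eq_lintegral_klFun_of_ac hac, lintegral_countable']
  unfold relEntropy
  refine tsum_congr fun x => ?_
  have h1 : μ {x} = μ.rnDeriv ν x * ν {x} := by
    rw [← Measure.setLIntegral_rnDeriv hac, lintegral_singleton]
  have h0 : ν.real {x} ≠ 0 := by
    rw [measureReal_def, ENNReal.toReal_ne_zero]
    exact ⟨hν x, measure_ne_top _ _⟩
  have h2 : μ.real {x} / ν.real {x} = (μ.rnDeriv ν x).toReal := by
    rw [measureReal_def, h1, ENNReal.toReal_mul, ← measureReal_def, mul_div_assoc, div_self h0,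
      mul_one]
  rw [h2, ENNReal.ofReal_mul measureReal_nonneg, ofReal_measureReal, mul_comm]

section

variable {ι : Type*} [Fintype ι] {g : ℕ → ℝ}

theorem siteProb_le_mul (hgpos : ∀ k, 0 < k → 0 < g k) {a₀ b₀ lam lam' : ℝ} (ha₀ : 0 < a₀)
    (hb₀ : b₀ ∈ fugacities g) (hl : lam ∈ Icc a₀ b₀) (hl' : lam' ∈ Icc a₀ b₀) (k : ℕ) :
    siteProb g lam' k ≤ siteProb g lam k * ((b₀ / a₀) ^ k * partitionFn g b₀) := by
  have hlp : 0 < lam := ha₀.trans_le hl.1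
  have hlp' : 0 < lam' := ha₀.trans_le hl'.1
  have hZ := one_le_partitionFn hgpos hlp.le
    (fugacities_summable hgpos (fugacities_ordConnected ha₀ hb₀ hl))
  have hZ' := one_le_partitionFn hgpos hlp'.le
    (fugacities_summable hgpos (fugacities_ordConnected ha₀ hb₀ hl'))
  have hZb := partitionFn_mono hgpos hlp.le hl.2 (fugacities_summable hgpos hb₀)
  have h1 : weight g lam' k ≤ weight g lam k * (b₀ / a₀) ^ k := by
    rw [← weight_mul]
    refine weight_mono hgpos hlp'.le ?_ k
    rw [mul_div_assoc', le_div_iff₀ ha₀]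
    nlinarith [hl.1, hl'.2, hl'.1, hl.2]
  have hw := weight_nonneg hgpos hlp.le k
  have hq : 0 ≤ (b₀ / a₀) ^ k := pow_nonneg (div_nonneg hb₀.1.le ha₀.le) _
  unfold siteProb
  calc weight g lam' k / partitionFn g lam' ≤ weight g lam' k :=
        div_le_self (weight_nonneg hgpos hlp'.le k) hZ'
    _ ≤ weight g lam k * (b₀ / a₀) ^ k := h1
    _ = weight g lam k / partitionFn g lam * ((b₀ / a₀) ^ k * partitionFn g lam) := by
        field_simp
    _ ≤ _ := by gcongr

theorem prodProb_le_mul (hgpos : ∀ k, 0 < k → 0 < g k) {a₀ b₀ : ℝ} {lam lam' : ι → ℝ} (ha₀ : 0 < a₀)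
    (hb₀ : b₀ ∈ fugacities g) (hl : ∀ x, lam x ∈ Icc a₀ b₀) (hl' : ∀ x, lam' x ∈ Icc a₀ b₀)
    (η : ι → ℕ) : prodProb g lam' η
      ≤ prodProb g lam η * ((b₀ / a₀) ^ (∑ x, η x) * partitionFn g b₀ ^ Fintype.card ι) := by
  unfold prodProb
  rw [← Finset.prod_pow_eq_pow_sum, ← Finset.card_univ, ← Finset.prod_const,
    ← Finset.prod_mul_distrib, ← Finset.prod_mul_distrib]
  refine Finset.prod_le_prod (fun x _ => ?_) fun x _ => ?_
  · exact (siteProb_pos hgpos (fugacities_ordConnected ha₀ hb₀ (hl' x)) _).le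
  · exact siteProb_le_mul hgpos ha₀ hb₀ (hl x) (hl' x) _

variable [DecidableEq ι]

/-- Mean particle numbers are controlled by the relative entropy. -/
theorem tsum_mul_sum_le (hgpos : ∀ k, 0 < k → 0 < g k) {b₀ γ : ℝ} (hγ : 0 < γ) {lam : ι → ℝ}
    (hlam : ∀ x, lam x ∈ fugacities g) (hlb : ∀ x, lam x ≤ b₀) (hb₀ : 0 < b₀)
    (hs : Summable (weight g (b₀ * Real.exp γ))) {p : (ι → ℕ) → ℝ} (hp : ∀ η, 0 ≤ p η)
    (hp1 : ∑' η, ENNReal.ofReal (p η) = 1) :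
    ∑' η, ENNReal.ofReal (p η * ∑ x, (η x : ℝ)) ≤ ENNReal.ofReal γ⁻¹ *
      (relEntropy p (prodProb g lam)
        + ENNReal.ofReal (Fintype.card ι * Real.log (partitionFn g (b₀ * Real.exp γ)))) := by
  have hZ := one_le_partitionFn hgpos (mul_nonneg hb₀.le (Real.exp_pos γ).le) hs
  have h := tsum_mul_le_relEntropy_add (V := fun η : ι → ℕ => γ * ∑ x, (η x : ℝ))
    (prodProb_pos hgpos hlam) hp (tsum_prodProb hgpos hlam) hp1
    (fun η => by positivity) (by have := Real.log_nonneg hZ; positivity)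
    (tsum_prodProb_exp_le hgpos hlam hlb hs)
  refine le_trans (le_of_eq ?_) (mul_le_mul_right h (ENNReal.ofReal γ⁻¹))
  rw [← ENNReal.tsum_mul_left]
  refine tsum_congr fun η => ?_
  rw [← ENNReal.ofReal_mul (inv_pos.2 hγ).le]
  congr 1
  field_simp

open InformationTheory in
/-- Change of the fugacity profile of the reference measure. -/
theorem relEntropy_prodProb_le (hgpos : ∀ k, 0 < k → 0 < g k) {a₀ b₀ γ : ℝ} (hγ : 0 < γ)
    {lam lam' : ι → ℝ} (ha₀ : 0 < a₀) (hab : a₀ ≤ b₀) (hb₀ : b₀ ∈ fugacities g)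
    (hl : ∀ x, lam x ∈ Icc a₀ b₀)
    (hl' : ∀ x, lam' x ∈ Icc a₀ b₀) (hs : Summable (weight g (b₀ * Real.exp γ)))
    {p : (ι → ℕ) → ℝ} (hp : ∀ η, 0 ≤ p η) (hp1 : ∑' η, ENNReal.ofReal (p η) = 1) :
    relEntropy p (prodProb g lam) ≤ relEntropy p (prodProb g lam')
      + (ENNReal.ofReal (Real.log (b₀ / a₀)) * (ENNReal.ofReal γ⁻¹ *
        (relEntropy p (prodProb g lam')
          + ENNReal.ofReal (Fintype.card ι * Real.log (partitionFn g (b₀ * Real.exp γ)))))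
      + ENNReal.ofReal (Fintype.card ι * Real.log (partitionFn g b₀))) := by
  have hf : ∀ x, lam x ∈ fugacities g := fun x => fugacities_ordConnected ha₀ hb₀ (hl x)
  have hf' : ∀ x, lam' x ∈ fugacities g := fun x => fugacities_ordConnected ha₀ hb₀ (hl' x)
  have hν := prodProb_pos hgpos hf
  have hν' := prodProb_pos hgpos hf'
  have hZb := one_le_partitionFn hgpos hb₀.1.le (fugacities_summable hgpos hb₀)
  have hlZ := Real.log_nonneg hZb
  have hr1 : 1 ≤ b₀ / a₀ := (one_le_div ha₀).2 hab
  have hlr := Real.log_nonneg hr1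
  have hlog : ∀ η, Real.log (prodProb g lam' η / prodProb g lam η)
      ≤ Real.log (b₀ / a₀) * ∑ x, (η x : ℝ) + Fintype.card ι * Real.log (partitionFn g b₀) :=
    fun η => by
    have h1 := prodProb_le_mul hgpos ha₀ hb₀ hl hl' η
    have h2 : prodProb g lam' η / prodProb g lam η
        ≤ (b₀ / a₀) ^ (∑ x, η x) * partitionFn g b₀ ^ Fintype.card ι := by
      rw [div_le_iff₀ (hν η)]; linarith
    have h3 := Real.log_le_log (div_pos (hν' η) (hν η)) h2
    rw [Real.log_mul (by positivity) (by positivity), Real.log_pow, Real.log_pow] at h3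
    push_cast at h3
    linarith
  have hpt : ∀ η, prodProb g lam η * klFun (p η / prodProb g lam η) + prodProb g lam' η
      ≤ prodProb g lam' η * klFun (p η / prodProb g lam' η) + (Real.log (b₀ / a₀) *
        (p η * ∑ x, (η x : ℝ)) + Fintype.card ι * Real.log (partitionFn g b₀) * p η)
        + prodProb g lam η := fun η => by
    have h1 := hν η
    have h2 := hν' η
    rcases (hp η).eq_or_lt with h0 | h0
    · rw [← h0]; simp [klFun_zero]; linarith
    · have h3 := mul_le_mul_of_nonneg_left (hlog η) h0.le
      rw [Real.log_div h2.ne' h1.ne'] at h3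
      rw [klFun_apply, klFun_apply, Real.log_div h0.ne' h1.ne', Real.log_div h0.ne' h2.ne']
      have e1 : prodProb g lam η * (p η / prodProb g lam η *
          (Real.log (p η) - Real.log (prodProb g lam η)) + 1 - p η / prodProb g lam η)
          = p η * (Real.log (p η) - Real.log (prodProb g lam η)) + prodProb g lam η - p η := by
        field_simp
      have e2 : prodProb g lam' η * (p η / prodProb g lam' η *
          (Real.log (p η) - Real.log (prodProb g lam' η)) + 1 - p η / prodProb g lam' η)
          = p η * (Real.log (p η) - Real.log (prodProb g lam' η)) + prodProb g lam' η - p η := by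
        field_simp
      rw [e1, e2]
      nlinarith
  have hsum : relEntropy p (prodProb g lam) + 1 ≤ relEntropy p (prodProb g lam')
      + (ENNReal.ofReal (Real.log (b₀ / a₀)) * (∑' η, ENNReal.ofReal (p η * ∑ x, (η x : ℝ)))
      + ENNReal.ofReal (Fintype.card ι * Real.log (partitionFn g b₀))) + 1 := by
    have e := ENNReal.tsum_le_tsum fun η => ENNReal.ofReal_le_ofReal (hpt η)
    have k1 : ∀ η, 0 ≤ prodProb g lam η * klFun (p η / prodProb g lam η) := fun η =>
      mul_nonneg (hν η).le (klFun_nonneg (div_nonneg (hp η) (hν η).le))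
    have k2 : ∀ η, 0 ≤ prodProb g lam' η * klFun (p η / prodProb g lam' η) := fun η =>
      mul_nonneg (hν' η).le (klFun_nonneg (div_nonneg (hp η) (hν' η).le))
    have k3 : ∀ η, 0 ≤ Real.log (b₀ / a₀) * (p η * ∑ x, (η x : ℝ)) := fun η =>
      mul_nonneg hlr (mul_nonneg (hp η) (by positivity))
    have k4 : 0 ≤ Fintype.card ι * Real.log (partitionFn g b₀) := by positivity
    have k5 : ∀ η, 0 ≤ Fintype.card ι * Real.log (partitionFn g b₀) * p η := fun η =>
      mul_nonneg k4 (hp η)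
    have e1 : ∀ η, ENNReal.ofReal (prodProb g lam η * klFun (p η / prodProb g lam η)
          + prodProb g lam' η) = ENNReal.ofReal (prodProb g lam η * klFun (p η / prodProb g lam η))
          + ENNReal.ofReal (prodProb g lam' η) := fun η =>
      ENNReal.ofReal_add (k1 η) (hν' η).le
    have e2 : ∀ η, ENNReal.ofReal (prodProb g lam' η * klFun (p η / prodProb g lam' η)
          + (Real.log (b₀ / a₀) * (p η * ∑ x, (η x : ℝ))
            + Fintype.card ι * Real.log (partitionFn g b₀) * p η) + prodProb g lam η)
        = ENNReal.ofReal (prodProb g lam' η * klFun (p η / prodProb g lam' η))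
          + (ENNReal.ofReal (Real.log (b₀ / a₀)) * ENNReal.ofReal (p η * ∑ x, (η x : ℝ))
            + ENNReal.ofReal (Fintype.card ι * Real.log (partitionFn g b₀)) *
              ENNReal.ofReal (p η)) + ENNReal.ofReal (prodProb g lam η) := fun η => by
      rw [ENNReal.ofReal_add (add_nonneg (k2 η) (add_nonneg (k3 η) (k5 η))) (hν η).le,
        ENNReal.ofReal_add (k2 η) (add_nonneg (k3 η) (k5 η)), ENNReal.ofReal_add (k3 η) (k5 η),
        ENNReal.ofReal_mul hlr, ENNReal.ofReal_mul k4]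
    simp only [e1, e2] at e
    rw [ENNReal.tsum_add, ENNReal.tsum_add, ENNReal.tsum_add, ENNReal.tsum_add,
      ENNReal.tsum_mul_left, ENNReal.tsum_mul_left, tsum_prodProb hgpos hf,
      tsum_prodProb hgpos hf', hp1, mul_one] at e
    exact e
  refine ((ENNReal.add_le_add_iff_right ENNReal.one_ne_top).1 hsum).trans ?_
  gcongr
  exact tsum_mul_sum_le hgpos hγ hf' (fun x => (hl' x).2) hb₀.1 hs hp hp1

end


/-! ### The resampling distances are controlled by the Dirichlet form -/

variable {N : ℕ} {g : ℕ → ℝ} {K a₀ b₀ u v : ℝ}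

theorem refProb_pos_of_mem_Icc (hgpos : ∀ k, 0 < k → 0 < g k) (ha₀ : 0 < a₀)
    (hb₀ : b₀ ∈ fugacities g) (hu : u ∈ Icc a₀ b₀) (hv : v ∈ Icc a₀ b₀) (η : Config N) :
    0 < refProb g N u v η :=
  prodProb_pos hgpos (fun x => fugacities_ordConnected ha₀ hb₀ (profile_box_mem_Icc hu hv x)) η

theorem tsum_mul_abs_addAt_sub_le (hg0 : g 0 = 0) (hgpos : ∀ k, 0 < k → 0 < g k)
    (hK : ∀ k, |g (k + 1) - g k| ≤ K) (ha₀ : 0 < a₀) (hb₀ : b₀ ∈ fugacities g)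
    (hu : u ∈ Icc a₀ b₀) (hv : v ∈ Icc a₀ b₀) {p : Config N → ℝ} (hp : ∀ η, 0 ≤ p η)
    (hp1 : ∑' η, ENNReal.ofReal (p η) = 1) {θ : ℝ} (hθ : 0 < θ) (x : Box N) :
    ∑' η, ENNReal.ofReal (refProb g N u v η) *
        ENNReal.ofReal |p (addAt η x) / refProb g N u v (addAt η x) - p η / refProb g N u v η|
      ≤ ENNReal.ofReal ((2 * N + 2) * θ⁻¹) * ∑' η, ENNReal.ofReal (refProb g N u v η *
          bondEnergy (fun ζ => p ζ / refProb g N u v ζ) η)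
        + ENNReal.ofReal (θ * (K / a₀)) * (∑' η, ENNReal.ofReal (p η * η x))
        + ENNReal.ofReal θ := by
  have hν := fun η : Config N => refProb_pos_of_mem_Icc hgpos ha₀ hb₀ hu hv η
  set ν := refProb g N u v with hνdef
  set f : Config N → ℝ := fun ζ => p ζ / ν ζ with hf
  have hK0 : 0 ≤ K := (abs_nonneg _).trans (hK 0)
  have hf0 : ∀ η, 0 ≤ f η := fun η => div_nonneg (hp η) (hν η).le
  have hshift : ∑' η : Config N, ENNReal.ofReal (p (addAt η x) * (addAt η x x : ℕ))
      = ∑' η, ENNReal.ofReal (p η * η x) :=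
    tsum_update_succ x (F := fun η => ENNReal.ofReal (p η * η x)) fun η h => by simp [h]
  have hpt : ∀ η, ENNReal.ofReal (ν η) * ENNReal.ofReal |f (addAt η x) - f η| ≤
      ENNReal.ofReal ((2 * N + 2) * θ⁻¹) * ENNReal.ofReal (ν η * bondEnergy f η)
        + ENNReal.ofReal (θ * (K / a₀)) * ENNReal.ofReal (p (addAt η x) * (addAt η x x : ℕ))
        + ENNReal.ofReal θ * ENNReal.ofReal (p η) := fun η => by
    have hb := bondEnergy_nonneg f η
    have hθi : 0 < θ⁻¹ := inv_pos.2 hθ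
    rw [← ENNReal.ofReal_mul (hν η).le, ← ENNReal.ofReal_mul (by positivity),
      ← ENNReal.ofReal_mul (by positivity), ← ENNReal.ofReal_mul hθ.le,
      ← ENNReal.ofReal_add, ← ENNReal.ofReal_add]
    · refine ENNReal.ofReal_le_ofReal ?_
      have h1 := abs_sub_le_sq_sqrt_sub (hf0 (addAt η x)) (hf0 η) hθ
      have h2 := sq_sqrt_addAt_sub_le f η x
      have h3 : ν η * f (addAt η x) ≤ K / a₀ * (p (addAt η x) * (addAt η x x : ℕ)) := by
        have hlam := (profile_box_mem_Icc hu hv x).1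
        have h4 := refProb_addAt_mul hgpos u v η x
        rw [← hνdef] at h4
        have h5 : p (addAt η x) = ν (addAt η x) * f (addAt η x) := by
          rw [hf]; field_simp [(hν (addAt η x)).ne']
        have h6 := le_mul_of_lipschitz hg0 hK (η x + 1)
        rw [div_mul_eq_mul_div, le_div_iff₀ ha₀, addAt_apply_self]
        have h7 : 0 ≤ ν η * f (addAt η x) := mul_nonneg (hν η).le (hf0 _)
        calc ν η * f (addAt η x) * a₀ ≤ ν η * f (addAt η x) * profile N u v x := by gcongr
          _ = (profile N u v x * ν η) * f (addAt η x) := by ring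
          _ = ν (addAt η x) * g (η x + 1) * f (addAt η x) := by rw [h4]
          _ = p (addAt η x) * g (η x + 1) := by rw [h5]; ring
          _ ≤ p (addAt η x) * (K * (η x + 1 : ℕ)) := by
            have := hp (addAt η x); gcongr
          _ = _ := by ring
      have h8 : p η = ν η * f η := by rw [hf]; field_simp [(hν η).ne']
      calc ν η * |f (addAt η x) - f η|
          ≤ ν η * (θ⁻¹ * ((2 * N + 2) * bondEnergy f η) + θ * (f (addAt η x) + f η)) := by
            have := (hν η).le
            gcongr
            exact h1.trans (by gcongr)
        _ = (2 * N + 2) * θ⁻¹ * (ν η * bondEnergy f η) + θ * (ν η * f (addAt η x))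
            + θ * (ν η * f η) := by ring
        _ ≤ (2 * N + 2) * θ⁻¹ * (ν η * bondEnergy f η)
            + θ * (K / a₀ * (p (addAt η x) * (addAt η x x : ℕ))) + θ * p η := by
            rw [h8]; gcongr
        _ = _ := by ring
    · have := (hν η).le
      have := hp (addAt η x)
      positivity
    · have := hp η
      positivity
    · have := (hν η).le
      positivity
    · have := hp (addAt η x)
      positivity
  refine (ENNReal.tsum_le_tsum hpt).trans (le_of_eq ?_)
  rw [ENNReal.tsum_add, ENNReal.tsum_add, ENNReal.tsum_mul_left, ENNReal.tsum_mul_left,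
    ENNReal.tsum_mul_left, hshift, hp1, mul_one]

theorem indicator_lt_le_mul (m k : ℕ) :
    (if m < k then 1 else 0 : ℝ≥0∞) ≤ ENNReal.ofReal ((m + 1 : ℝ)⁻¹) * ENNReal.ofReal k := by
  split_ifs with h
  · rw [← ENNReal.ofReal_mul (by positivity), ← ENNReal.ofReal_one]
    refine ENNReal.ofReal_le_ofReal ?_
    rw [inv_mul_eq_div, one_le_div (by positivity)]
    exact_mod_cast h
  · exact zero_le

/-- A bound for the mean number of particles at a site, at any fugacity up to `b`. -/
noncomputable def densityBound (g : ℕ → ℝ) (b : ℝ) : ℝ :=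
  partitionFn g b * ∑' k : ℕ, siteProb g b k * k

theorem tsum_siteProb_mul_le_densityBound (hgpos : ∀ k, 0 < k → 0 < g k) {lam : ℝ} (hlam : 0 < lam)
    (hlb : lam ≤ b₀) (hb₀ : b₀ ∈ fugacities g) :
    ∑' k : ℕ, ENNReal.ofReal (siteProb g lam k) * ENNReal.ofReal k
      ≤ ENNReal.ofReal (densityBound g b₀) := by
  have hpos := fun k => (siteProb_pos hgpos hb₀ k).le
  have hZ : 0 ≤ partitionFn g b₀ := zero_le_one.trans
    (one_le_partitionFn hgpos hb₀.1.le (fugacities_summable hgpos hb₀))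
  rw [densityBound, ← tsum_mul_left, ENNReal.ofReal_tsum_of_nonneg
    (fun k => mul_nonneg hZ (mul_nonneg (hpos k) k.cast_nonneg))
    ((summable_siteProb_mul_self hgpos hb₀).mul_left _)]
  refine ENNReal.tsum_le_tsum fun k => ?_
  rw [← ENNReal.ofReal_mul' k.cast_nonneg, ← mul_assoc]
  have := siteProb_le hgpos hlam hlb hb₀ k
  gcongr

theorem sum_resampling_singleton_le (hg0 : g 0 = 0) (hgpos : ∀ k, 0 < k → 0 < g k)
    (hK : ∀ k, |g (k + 1) - g k| ≤ K) (ha₀ : 0 < a₀) (hb₀ : b₀ ∈ fugacities g)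
    (hu : u ∈ Icc a₀ b₀) (hv : v ∈ Icc a₀ b₀) {p : Config N → ℝ} (hp : ∀ η, 0 ≤ p η)
    (hp1 : ∑' η, ENNReal.ofReal (p η) = 1) {θ : ℝ} (hθ : 0 < θ) (m : ℕ) :
    ∑ x : Box N, resampling (fun η => ENNReal.ofReal (refProb g N u v η))
        (fun η => p η / refProb g N u v η) {x}
      ≤ (∑ j ∈ Finset.range m, ENNReal.ofReal (partitionFn g b₀ / weight g a₀ j)) *
          (ENNReal.ofReal ((2 * N + 1) * ((2 * N + 2) * θ⁻¹)) *
              (∑' η, ENNReal.ofReal (refProb g N u v η *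
                bondEnergy (fun ζ => p ζ / refProb g N u v ζ) η))
            + ENNReal.ofReal (θ * (K / a₀)) * (∑' η, ENNReal.ofReal (p η * ∑ x, (η x : ℝ)))
            + ENNReal.ofReal ((2 * N + 1) * θ))
        + 2 * (ENNReal.ofReal ((m + 1 : ℝ)⁻¹) *
          ((∑' η, ENNReal.ofReal (p η * ∑ x, (η x : ℝ)))
            + ENNReal.ofReal ((2 * N + 1) * densityBound g b₀))) := by
  have hlam : ∀ x : Box N, profile N u v x ∈ fugacities g := fun x =>
    fugacities_ordConnected ha₀ hb₀ (profile_box_mem_Icc hu hv x)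
  have hν := fun η : Config N => refProb_pos_of_mem_Icc hgpos ha₀ hb₀ hu hv η
  have hW : IsProductWeight fun η : Config N => ENNReal.ofReal (refProb g N u v η) :=
    isProductWeight_prodProb hgpos hlam
  have hpν : ∀ η, ENNReal.ofReal (refProb g N u v η) * ENNReal.ofReal (p η / refProb g N u v η)
      = ENNReal.ofReal (p η) := fun η => by
    rw [← ENNReal.ofReal_mul (hν η).le, mul_div_cancel₀ _ (hν η).ne']
  have hf1 : ∑' η, ENNReal.ofReal (refProb g N u v η) * ENNReal.ofReal (p η / refProb g N u v η)
      = 1 := by simp only [hpν, hp1]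
  have hsum : ∑' η, ENNReal.ofReal (p η * ∑ x, (η x : ℝ))
      = ∑ x : Box N, ∑' η, ENNReal.ofReal (p η * η x) := by
    rw [← Summable.tsum_finsetSum fun _ _ => ENNReal.summable]
    refine tsum_congr fun η => ?_
    rw [Finset.mul_sum, ENNReal.ofReal_sum_of_nonneg fun x _ =>
      mul_nonneg (hp η) (Nat.cast_nonneg _)]
  have hdens : 0 ≤ densityBound g b₀ := mul_nonneg (zero_le_one.trans
    (one_le_partitionFn hgpos hb₀.1.le (fugacities_summable hgpos hb₀)))
    (tsum_nonneg fun k => mul_nonneg (siteProb_pos hgpos hb₀ k).le k.cast_nonneg)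
  have hconst : ∀ c : ℝ, 0 ≤ c → ∑ _x : Box N, ENNReal.ofReal c
      = ENNReal.ofReal ((2 * N + 1) * c) := fun c hc => by
    rw [Finset.sum_const, Finset.card_univ, card_box, nsmul_eq_mul,
      ENNReal.ofReal_mul (by positivity)]
    congr 1
    rw [← ENNReal.ofReal_natCast]
    push_cast
    rfl
  set c := ∑ j ∈ Finset.range m, ENNReal.ofReal (partitionFn g b₀ / weight g a₀ j) with hc
  set D := ∑' η, ENNReal.ofReal (refProb g N u v η *
    bondEnergy (fun ζ => p ζ / refProb g N u v ζ) η) with hD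
  have hx : ∀ x : Box N, resampling (fun η => ENNReal.ofReal (refProb g N u v η))
        (fun η => p η / refProb g N u v η) {x} ≤
      c * (ENNReal.ofReal ((2 * N + 2) * θ⁻¹) * D
        + ENNReal.ofReal (θ * (K / a₀)) * (∑' η, ENNReal.ofReal (p η * η x))
        + ENNReal.ofReal θ)
      + 2 * (ENNReal.ofReal ((m + 1 : ℝ)⁻¹) * ((∑' η, ENNReal.ofReal (p η * η x))
        + ENNReal.ofReal (densityBound g b₀))) := fun x => by
    have hM : ∀ j, ∑' η : Config N, ENNReal.ofReal (refProb g N u v η)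
        * (if η x = j then 1 else 0) = ENNReal.ofReal (siteProb g (profile N u v x) j) := fun j => by
      refine (tsum_prodProb_eval hgpos hlam x fun k => if k = j then 1 else 0).trans ?_
      rw [tsum_eq_single j fun k hk => by simp [hk]]
      simp
    have h1 := hW.resampling_singleton_le (f := fun η => p η / refProb g N u v η)
      (fun η => div_nonneg (hp η) (hν η).le) hf1 x hM
      (fun j => (ENNReal.ofReal_pos.2 (siteProb_pos hgpos (hlam x) j)).ne')
      (fun _ => ENNReal.ofReal_ne_top) m
    refine h1.trans ?_
    have hmem := profile_box_mem_Icc hu hv x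
    have h2 : ∑ j ∈ Finset.range m, (ENNReal.ofReal (siteProb g (profile N u v x) j))⁻¹ ≤ c := by
      refine Finset.sum_le_sum fun j _ => ?_
      rw [← ENNReal.ofReal_inv_of_pos (siteProb_pos hgpos (hlam x) j)]
      exact ENNReal.ofReal_le_ofReal (inv_siteProb_le hgpos ha₀ hmem.1 hmem.2 hb₀ j)
    have h3 := tsum_mul_abs_addAt_sub_le hg0 hgpos hK ha₀ hb₀ hu hv hp hp1 hθ x
    have h4 : ∑' η : Config N, ENNReal.ofReal (refProb g N u v η) *
        (ENNReal.ofReal (p η / refProb g N u v η) * (if m < η x then 1 else 0))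
        ≤ ENNReal.ofReal ((m + 1 : ℝ)⁻¹) * ∑' η, ENNReal.ofReal (p η * η x) := by
      rw [← ENNReal.tsum_mul_left]
      refine ENNReal.tsum_le_tsum fun η => ?_
      rw [← mul_assoc, hpν, ENNReal.ofReal_mul (hp η), mul_left_comm]
      gcongr
      exact indicator_lt_le_mul m (η x)
    have h5 : ∑' η : Config N, ENNReal.ofReal (refProb g N u v η) * (if m < η x then 1 else 0)
        ≤ ENNReal.ofReal ((m + 1 : ℝ)⁻¹) * ENNReal.ofReal (densityBound g b₀) := by
      refine (tsum_prodProb_eval hgpos hlam x fun k => if m < k then 1 else 0).trans_le ?_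
      refine le_trans ?_ (mul_le_mul_right
        (tsum_siteProb_mul_le_densityBound hgpos (hlam x).1 hmem.2 hb₀) _)
      rw [← ENNReal.tsum_mul_left]
      refine ENNReal.tsum_le_tsum fun k => ?_
      rw [mul_left_comm]
      gcongr
      exact indicator_lt_le_mul m k
    rw [mul_add (ENNReal.ofReal ((m + 1 : ℝ)⁻¹))]
    gcongr
    exact h3
  refine (Finset.sum_le_sum fun x _ => hx x).trans (le_of_eq ?_)
  rw [Finset.sum_add_distrib, ← Finset.mul_sum, ← Finset.mul_sum, ← Finset.mul_sum,
    Finset.sum_add_distrib, Finset.sum_add_distrib, Finset.sum_add_distrib, ← Finset.sum_mul,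
    hconst _ (by positivity), hconst _ hθ.le, hconst _ hdens, hsum, ← Finset.mul_sum]


/-! ### Variance of sums of local functions -/

section

variable {X : Type*} {p : X → ℝ}

theorem summable_mul_of_abs_le (hp : ∀ η, 0 ≤ p η) (hp1 : ∑' η, ENNReal.ofReal (p η) = 1)
    {Φ : X → ℝ} {B : ℝ} (hB : ∀ η, |Φ η| ≤ B) : Summable fun η => p η * Φ η := by
  refine Summable.of_norm_bounded ((hasSum_one_of_tsum_ofReal hp hp1).summable.mul_right B)
    fun η => ?_
  rw [Real.norm_eq_abs, abs_mul, abs_of_nonneg (hp η)]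
  exact mul_le_mul_of_nonneg_left (hB η) (hp η)

theorem ofReal_tsum_mul_add (hp : ∀ η, 0 ≤ p η) (hp1 : ∑' η, ENNReal.ofReal (p η) = 1)
    {Φ : X → ℝ} {B : ℝ} (hB : ∀ η, |Φ η| ≤ B) :
    ∑' η, ENNReal.ofReal (p η) * ENNReal.ofReal (Φ η + B)
      = ENNReal.ofReal ((∑' η, p η * Φ η) + B) ∧ 0 ≤ (∑' η, p η * Φ η) + B := by
  have h1 := hasSum_one_of_tsum_ofReal hp hp1
  have h0 : ∀ η, 0 ≤ p η * Φ η + p η * B := fun η => by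
    rw [← mul_add]
    exact mul_nonneg (hp η) (by linarith [(abs_le.1 (hB η)).1])
  have h2 : (∑' η, p η * Φ η) + B = ∑' η, (p η * Φ η + p η * B) := by
    rw [(summable_mul_of_abs_le hp hp1 hB).tsum_add (h1.summable.mul_right B), tsum_mul_right,
      h1.tsum_eq, one_mul]
  rw [h2]
  refine ⟨?_, tsum_nonneg h0⟩
  rw [ENNReal.ofReal_tsum_of_nonneg h0
    ((summable_mul_of_abs_le hp hp1 hB).add (h1.summable.mul_right B))]
  refine tsum_congr fun η => ?_
  rw [← ENNReal.ofReal_mul (hp η), mul_add]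

theorem abs_tsum_mul_le (hp : ∀ η, 0 ≤ p η) (hp1 : ∑' η, ENNReal.ofReal (p η) = 1)
    {Φ : X → ℝ} {B : ℝ} (hB : ∀ η, |Φ η| ≤ B) : |∑' η, p η * Φ η| ≤ B := by
  rw [abs_le]
  have h := (ofReal_tsum_mul_add hp hp1 hB).2
  have h' := (ofReal_tsum_mul_add (Φ := fun η => -Φ η) hp hp1 fun η => by rw [abs_neg]; exact hB η).2
  simp only [mul_neg, tsum_neg] at h'
  constructor <;> linarith

end

section

variable {ι : Type*} [DecidableEq ι] {ν p : (ι → ℕ) → ℝ}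

theorem IsProductWeight.tsum_mul_real (hν : ∀ η, 0 ≤ ν η)
    (hW : IsProductWeight fun η => ENNReal.ofReal (ν η)) {S T : Finset ι} (hST : Disjoint S T)
    {Φ Ψ : (ι → ℕ) → ℝ} {B : ℝ} (hΦ : DependsOn Φ S) (hΨ : DependsOn Ψ T)
    (hΦB : ∀ η, |Φ η| ≤ B) (hΨB : ∀ η, |Ψ η| ≤ B) :
    ∑' η, ν η * (Φ η * Ψ η) = (∑' η, ν η * Φ η) * ∑' η, ν η * Ψ η := by
  have hB0 : 0 ≤ B := (abs_nonneg _).trans (hΦB 0)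
  have hΦ0 : ∀ η, 0 ≤ Φ η + B := fun η => by linarith [(abs_le.1 (hΦB η)).1]
  have hΨ0 : ∀ η, 0 ≤ Ψ η + B := fun η => by linarith [(abs_le.1 (hΨB η)).1]
  obtain ⟨h1, h1'⟩ := ofReal_tsum_mul_add hν hW.tsum_eq_one hΦB
  obtain ⟨h2, h2'⟩ := ofReal_tsum_mul_add hν hW.tsum_eq_one hΨB
  have h := hW.tsum_mul hST (A := fun η => ENNReal.ofReal (Φ η + B))
    (B := fun η => ENNReal.ofReal (Ψ η + B)) (fun η ζ h => by simp only [hΦ h])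
    (fun η ζ h => by simp only [hΨ h])
  simp only [h1, h2, ← ENNReal.ofReal_mul (hΦ0 _)] at h
  have hs := summable_mul_of_abs_le hν hW.tsum_eq_one hΦB
  have hs' := summable_mul_of_abs_le hν hW.tsum_eq_one hΨB
  have hss : Summable fun η => ν η * (Φ η * Ψ η) :=
    summable_mul_of_abs_le hν hW.tsum_eq_one (B := B * B) fun η => by
      rw [abs_mul]; exact mul_le_mul (hΦB η) (hΨB η) (abs_nonneg _) hB0
  have h1 := hasSum_one_of_tsum_ofReal hν hW.tsum_eq_one
  have e : HasSum (fun η => ν η * ((Φ η + B) * (Ψ η + B)))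
      ((∑' η, ν η * (Φ η * Ψ η)) + B * (∑' η, ν η * Φ η) + B * (∑' η, ν η * Ψ η)
        + B * B * 1) :=
    (((hss.hasSum.add (hs.hasSum.mul_left B)).add (hs'.hasSum.mul_left B)).add
      (h1.mul_left (B * B))).congr_fun fun η => by ring
  simp only [← ENNReal.ofReal_mul (hν _)] at h
  rw [← ENNReal.ofReal_tsum_of_nonneg
    (fun η => mul_nonneg (hν η) (mul_nonneg (hΦ0 η) (hΨ0 η))) e.summable, e.tsum_eq,
    ← ENNReal.ofReal_mul h1'] at h
  have h3 : 0 ≤ (∑' η, ν η * (Φ η * Ψ η)) + B * (∑' η, ν η * Φ η) + B * (∑' η, ν η * Ψ η)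
        + B * B * 1 := by
    rw [← e.tsum_eq]
    exact tsum_nonneg fun η => mul_nonneg (hν η) (mul_nonneg (hΦ0 η) (hΨ0 η))
  rw [ENNReal.ofReal_eq_ofReal_iff h3 (mul_nonneg h1' h2')] at h
  linarith

theorem IsProductWeight.tsum_le_add_resampling_real (hν : ∀ η, 0 < ν η)
    (hW : IsProductWeight fun η => ENNReal.ofReal (ν η)) (hp : ∀ η, 0 ≤ p η)
    (hp1 : ∑' η, ENNReal.ofReal (p η) = 1) {S : Finset ι} {Φ : (ι → ℕ) → ℝ} {B : ℝ}
    (hΦ : DependsOn Φ S) (hB : ∀ η, |Φ η| ≤ B) :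
    ∑' η, p η * Φ η ≤ ∑' η, ν η * Φ η + 2 * B *
      ∑ x ∈ S, (resampling (fun η => ENNReal.ofReal (ν η)) (fun η => p η / ν η) {x}).toReal := by
  have hB0 : 0 ≤ B := (abs_nonneg _).trans (hB 0)
  have hf0 : ∀ η, 0 ≤ p η / ν η := fun η => div_nonneg (hp η) (hν η).le
  have hpν : ∀ η, ENNReal.ofReal (ν η) * ENNReal.ofReal (p η / ν η) = ENNReal.ofReal (p η) :=
    fun η => by rw [← ENNReal.ofReal_mul (hν η).le, mul_div_cancel₀ _ (hν η).ne']
  have hf1 : ∑' η, ENNReal.ofReal (ν η) * ENNReal.ofReal (p η / ν η) = 1 := by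
    simp only [hpν, hp1]
  obtain ⟨h1, h1'⟩ := ofReal_tsum_mul_add hp hp1 hB
  obtain ⟨h2, h2'⟩ := ofReal_tsum_mul_add (fun η => (hν η).le) hW.tsum_eq_one hB
  have hfin : ∀ x, resampling (fun η => ENNReal.ofReal (ν η)) (fun η => p η / ν η) {x} ≠ ∞ :=
    fun x => ((hW.resampling_le_two hf0 hf1 {x}).trans_lt (by simp)).ne
  have h := hW.tsum_le_add_resampling hf0 hf1 (S := S) (Φ := fun η => ENNReal.ofReal (Φ η + B))
    (B := ENNReal.ofReal (2 * B)) (fun η ζ h => by simp only [hΦ h])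
    (fun η => ENNReal.ofReal_le_ofReal (by linarith [(abs_le.1 (hB η)).2]))
  simp only [← mul_assoc, hpν] at h
  rw [h1, h2] at h
  have h3 := h.trans (add_le_add_right (mul_le_mul_right (hW.resampling_le_sum _ S) _) _)
  rw [← ENNReal.ofReal_toReal (ENNReal.sum_ne_top.2 fun x (_ : x ∈ S) => hfin x),
    ← ENNReal.ofReal_mul (by positivity), ← ENNReal.ofReal_add h2' (by positivity),
    ENNReal.ofReal_le_ofReal_iff (by positivity), ENNReal.toReal_sum fun x _ => hfin x] at h3
  linarith

theorem IsProductWeight.tsum_mul_sq_sum_le [Fintype ι] (hν : ∀ η, 0 < ν η)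
    (hW : IsProductWeight fun η => ENNReal.ofReal (ν η)) (hp : ∀ η, 0 ≤ p η)
    (hp1 : ∑' η, ENNReal.ofReal (p η) = 1) {κ : Type*} (I : Finset κ) {S : κ → Finset ι}
    {F : κ → (ι → ℕ) → ℝ} {B : ℝ} (hF : ∀ x ∈ I, DependsOn (F x) (S x))
    (hB : ∀ x ∈ I, ∀ η, |F x η| ≤ B) (hB0 : 0 ≤ B) (h0 : ∀ x ∈ I, ∑' η, ν η * F x η = 0) {q r : ℕ}
    (hq : ∀ x ∈ I, (I.filter fun y => ¬ Disjoint (S x) (S y)).card ≤ q)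
    (hr : ∀ z, (I.filter fun x => z ∈ S x).card ≤ r) :
    ∑' η, ENNReal.ofReal (p η * (∑ x ∈ I, F x η) ^ 2) ≤
      ENNReal.ofReal (B ^ 2 * I.card) * (q + 4 * r * ∑ z, resampling (fun η => ENNReal.ofReal (ν η))
        (fun η => p η / ν η) {z}) := by
  have hf0 : ∀ η, 0 ≤ p η / ν η := fun η => div_nonneg (hp η) (hν η).le
  have hf1 : ∑' η, ENNReal.ofReal (ν η) * ENNReal.ofReal (p η / ν η) = 1 := by
    rw [← hp1]
    exact tsum_congr fun η => by
      rw [← ENNReal.ofReal_mul (hν η).le, mul_div_cancel₀ _ (hν η).ne']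
  have hfin : ∀ x, resampling (fun η => ENNReal.ofReal (ν η)) (fun η => p η / ν η) {x} ≠ ∞ :=
    fun x => ((hW.resampling_le_two hf0 hf1 {x}).trans_lt (by simp)).ne
  set d : ι → ℝ := fun z =>
    (resampling (fun η => ENNReal.ofReal (ν η)) (fun η => p η / ν η) {z}).toReal with hd
  have hd0 : ∀ z, 0 ≤ d z := fun z => ENNReal.toReal_nonneg
  have hFF : ∀ x ∈ I, ∀ y ∈ I, ∀ η, |F x η * F y η| ≤ B ^ 2 := fun x hx y hy η => by
    rw [abs_mul, sq]
    exact mul_le_mul (hB x hx η) (hB y hy η) (abs_nonneg _) hB0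
  have hss : ∀ x ∈ I, ∀ y ∈ I, Summable fun η => p η * (F x η * F y η) := fun x hx y hy =>
    summable_mul_of_abs_le hp hp1 (hFF x hx y hy)
  have hterm : ∀ x ∈ I, ∀ y ∈ I, ∑' η, p η * (F x η * F y η) ≤
      (if ¬ Disjoint (S x) (S y) then B ^ 2 else 0)
        + 2 * B ^ 2 * (∑ z ∈ S x, d z + ∑ z ∈ S y, d z) := fun x hx y hy => by
    have hnn : 0 ≤ 2 * B ^ 2 * (∑ z ∈ S x, d z + ∑ z ∈ S y, d z) :=
      mul_nonneg (by positivity) (add_nonneg (Finset.sum_nonneg fun z _ => hd0 z)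
        (Finset.sum_nonneg fun z _ => hd0 z))
    split_ifs with hdis
    · have h1 := hW.tsum_le_add_resampling_real hν hp hp1 (S := S x ∪ S y)
        (Φ := fun η => F x η * F y η) (fun η ζ h => by
          change F x η * F y η = F x ζ * F y ζ
          rw [hF x hx fun i hi => h i (Finset.mem_coe.2 (Finset.mem_union_left _ hi)),
            hF y hy fun i hi => h i (Finset.mem_coe.2 (Finset.mem_union_right _ hi))])
        (hFF x hx y hy)
      rw [hW.tsum_mul_real (fun η => (hν η).le) hdis (hF x hx) (hF y hy) (hB x hx) (hB y hy),
        h0 x hx, zero_mul] at h1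
      rwa [Finset.sum_union hdis] at h1
    · have := (le_abs_self _).trans (abs_tsum_mul_le hp hp1 (hFF x hx y hy))
      linarith
  have hsum : ∀ η, p η * (∑ x ∈ I, F x η) ^ 2 = ∑ x ∈ I, ∑ y ∈ I, p η * (F x η * F y η) :=
    fun η => by rw [sq, Finset.sum_mul_sum, Finset.mul_sum]; simp only [Finset.mul_sum]
  have hδ : ∑ x ∈ I, ∑ z ∈ S x, d z ≤ r * ∑ z, d z := by
    have : ∀ x ∈ I, ∑ z ∈ S x, d z = ∑ z, if z ∈ S x then d z else 0 := fun x _ => by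
      rw [← Finset.sum_filter]; congr 1; ext; simp
    rw [Finset.sum_congr rfl this, Finset.sum_comm, Finset.mul_sum]
    refine Finset.sum_le_sum fun z _ => ?_
    rw [← Finset.sum_filter, Finset.sum_const, nsmul_eq_mul]
    have := hd0 z
    have := hr z
    gcongr
  have hreal : ∑' η, p η * (∑ x ∈ I, F x η) ^ 2 ≤
      B ^ 2 * I.card * (q + 4 * r * ∑ z, d z) := by
    simp only [hsum]
    rw [Summable.tsum_finsetSum fun x hx => summable_sum fun y hy => hss x hx y hy]
    calc ∑ x ∈ I, ∑' η, ∑ y ∈ I, p η * (F x η * F y η)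
        = ∑ x ∈ I, ∑ y ∈ I, ∑' η, p η * (F x η * F y η) :=
          Finset.sum_congr rfl fun x hx => Summable.tsum_finsetSum fun y hy => hss x hx y hy
      _ ≤ ∑ x ∈ I, ∑ y ∈ I, ((if ¬ Disjoint (S x) (S y) then B ^ 2 else 0)
          + 2 * B ^ 2 * (∑ z ∈ S x, d z + ∑ z ∈ S y, d z)) :=
          Finset.sum_le_sum fun x hx => Finset.sum_le_sum fun y hy => hterm x hx y hy
      _ = ∑ x ∈ I, ((I.filter fun y => ¬ Disjoint (S x) (S y)).card * B ^ 2)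
          + 4 * B ^ 2 * I.card * ∑ x ∈ I, ∑ z ∈ S x, d z := by
          simp only [Finset.sum_add_distrib, ← Finset.mul_sum, Finset.sum_const, nsmul_eq_mul,
            ← Finset.sum_filter]
          ring
      _ ≤ ∑ _x ∈ I, q * B ^ 2 + 4 * B ^ 2 * I.card * (r * ∑ z, d z) := by
          gcongr with x hx
          exact hq x hx
      _ = _ := by rw [Finset.sum_const, nsmul_eq_mul]; ring
  have hps : Summable fun η => p η * (∑ x ∈ I, F x η) ^ 2 := by
    simp only [hsum]
    exact summable_sum fun x hx => summable_sum fun y hy => hss x hx y hy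
  rw [← ENNReal.ofReal_tsum_of_nonneg (fun η => mul_nonneg (hp η) (sq_nonneg _)) hps]
  refine (ENNReal.ofReal_le_ofReal hreal).trans (le_of_eq ?_)
  have hdz : ENNReal.ofReal (∑ z, d z) = ∑ z, resampling (fun η => ENNReal.ofReal (ν η))
      (fun η => p η / ν η) {z} := by
    rw [ENNReal.ofReal_sum_of_nonneg fun z _ => hd0 z]
    exact Finset.sum_congr rfl fun z _ => ENNReal.ofReal_toReal (hfin z)
  have hdn : 0 ≤ ∑ z, d z := Finset.sum_nonneg fun z _ => hd0 z
  rw [ENNReal.ofReal_mul (by positivity), ENNReal.ofReal_add (by positivity) (by positivity),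
    ENNReal.ofReal_mul (by positivity), ENNReal.ofReal_mul (by positivity), hdz,
    ENNReal.ofReal_mul zero_le_four, ENNReal.ofReal_natCast, ENNReal.ofReal_natCast,
    ENNReal.ofReal_natCast, ENNReal.ofReal_ofNat]

/-- First moments are controlled by second moments. -/
theorem tsum_mul_abs_le_of_sq {X : Type*} {p Y : X → ℝ} (hp : ∀ η, 0 ≤ p η)
    (hp1 : ∑' η, ENNReal.ofReal (p η) = 1) {ε : ℝ} (hε : 0 < ε) :
    ∑' η, ENNReal.ofReal (p η * |Y η|) ≤ ENNReal.ofReal ε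
      + ENNReal.ofReal ε⁻¹ * ∑' η, ENNReal.ofReal (p η * Y η ^ 2) := by
  have h : ∀ η, ENNReal.ofReal (p η * |Y η|) ≤ ENNReal.ofReal ε * ENNReal.ofReal (p η)
      + ENNReal.ofReal ε⁻¹ * ENNReal.ofReal (p η * Y η ^ 2) := fun η => by
    have h0 := hp η
    rw [← ENNReal.ofReal_mul hε.le, ← ENNReal.ofReal_mul (by positivity),
      ← ENNReal.ofReal_add (by positivity) (by positivity)]
    refine ENNReal.ofReal_le_ofReal ?_
    have h1 : |Y η| ≤ ε + ε⁻¹ * Y η ^ 2 := by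
      rw [inv_mul_eq_div, ← sub_le_iff_le_add', le_div_iff₀ hε, ← sq_abs (Y η)]
      nlinarith [sq_nonneg (|Y η| - ε), abs_nonneg (Y η)]
    calc p η * |Y η| ≤ p η * (ε + ε⁻¹ * Y η ^ 2) := by gcongr
      _ = _ := by ring
  refine (ENNReal.tsum_le_tsum h).trans (le_of_eq ?_)
  rw [ENNReal.tsum_add, ENNReal.tsum_mul_left, ENNReal.tsum_mul_left, hp1, mul_one]

end


/-! ### Local functions -/

/-- The sites of `{-N, …, N}` on which `θ_x φ` depends. -/
noncomputable def window (N ℓ : ℕ) (x : ℤ) : Finset (Box N) :=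
  Finset.univ.filter fun z => (z : ℤ) ∈ Finset.Icc (x - ℓ) (x + ℓ)

variable {N ℓ : ℕ}

theorem mem_window {x : ℤ} {z : Box N} : z ∈ window N ℓ x ↔ x - ℓ ≤ z ∧ (z : ℤ) ≤ x + ℓ := by
  simp [window]

theorem dependsOn_shift (φ : Config ℓ → ℝ) (x : ℤ) :
    DependsOn (shift φ x : Config N → ℝ) (window N ℓ x) := by
  intro η ζ h
  unfold shift
  congr 1
  ext z
  unfold occ
  split_ifs with hz
  · refine h _ (Finset.mem_coe.2 (mem_window.2 ?_))
    have := Finset.mem_Icc.1 z.2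
    simp only
    omega
  · rfl

theorem card_filter_not_disjoint_window_le (I : Finset ℤ) (x : ℤ) :
    (I.filter fun y => ¬ Disjoint (window N ℓ x) (window N ℓ y)).card ≤ 4 * ℓ + 1 := by
  refine (Finset.card_le_card (t := Finset.Icc (x - 2 * ℓ) (x + 2 * ℓ)) fun y hy => ?_).trans ?_
  · obtain ⟨z, hz, hz'⟩ := Finset.not_disjoint_iff.1 (Finset.mem_filter.1 hy).2
    rw [mem_window] at hz hz'
    rw [Finset.mem_Icc]
    omega
  · rw [Int.card_Icc]; omega

theorem card_filter_mem_window_le (I : Finset ℤ) (z : Box N) :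
    (I.filter fun x => z ∈ window N ℓ x).card ≤ 2 * ℓ + 1 := by
  refine (Finset.card_le_card (t := Finset.Icc ((z : ℤ) - ℓ) (z + ℓ)) fun y hy => ?_).trans ?_
  · have := mem_window.1 (Finset.mem_filter.1 hy).2
    rw [Finset.mem_Icc]
    omega
  · rw [Int.card_Icc]; omega

theorem disjoint_window_of_emod_eq {x y : ℤ} (hxy : x ≠ y)
    (h : x % (2 * ℓ + 1) = y % (2 * ℓ + 1)) : Disjoint (window N ℓ x) (window N ℓ y) := by
  rw [Finset.disjoint_left]
  intro z hz hz'
  rw [mem_window] at hz hz'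
  have hd : (2 * ℓ + 1 : ℤ) ∣ x - y := Int.ModEq.dvd (Eq.symm h)
  obtain ⟨k, hk⟩ := hd
  have : k = 0 := by
    by_contra hk0
    rcases lt_or_gt_of_ne hk0 with h1 | h1
    · nlinarith
    · nlinarith
  subst this
  omega

/-- The centres of the windows that lie within `{-N, …, N}`. -/
noncomputable abbrev centres (N ℓ : ℕ) : Finset ℤ := Finset.Icc (-(N : ℤ) + ℓ) ((N : ℤ) - ℓ)

theorem card_centres_le (N ℓ : ℕ) : (centres N ℓ).card ≤ 2 * N + 1 := by
  rw [Int.card_Icc]; omega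

/-- The window `{x - ℓ, …, x + ℓ}` as a part of `{-N, …, N}`. -/
def windowSite (x : ℤ) (hx : x ∈ centres N ℓ) (z : Box ℓ) : Box N :=
  ⟨x + z, by
    have h1 := Finset.mem_Icc.1 hx
    have h2 := Finset.mem_Icc.1 z.2
    rw [Finset.mem_Icc]
    omega⟩

theorem shift_eq {x : ℤ} (hx : x ∈ centres N ℓ) (φ : Config ℓ → ℝ) (η : Config N) :
    shift φ x η = φ (η ∘ windowSite x hx) := by
  unfold shift
  congr 1
  ext z
  unfold occ
  exact dif_pos (windowSite x hx z).2

theorem windowSite_injective {x : ℤ} (hx : x ∈ centres N ℓ) :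
    Function.Injective (windowSite x hx) := by
  intro z w h
  have := congrArg (fun b : Box N => (b : ℤ)) h
  simp only [windowSite] at this
  exact Subtype.ext (by omega)

section

variable {ι κ : Type*} [Fintype ι] [DecidableEq ι] [Fintype κ] {g : ℕ → ℝ}

/-- The marginal distribution of a product measure. -/
theorem tsum_prodProb_comp (hgpos : ∀ k, 0 < k → 0 < g k) {lam : ι → ℝ}
    (hlam : ∀ x, lam x ∈ fugacities g) {e : κ → ι} (he : Function.Injective e)
    (H : (κ → ℕ) → ℝ≥0∞) :
    ∑' η, ENNReal.ofReal (prodProb g lam η) * H (η ∘ e)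
      = ∑' ξ, ENNReal.ofReal (prodProb g (lam ∘ e) ξ) * H ξ := by
  classical
  have hW := isProductWeight_prodProb hgpos hlam
  have hξ : ∀ ξ : κ → ℕ, ENNReal.ofReal (prodProb g (lam ∘ e) ξ)
      = ∑' η, ENNReal.ofReal (prodProb g lam η) * if η ∘ e = ξ then 1 else 0 := fun ξ => by
    have h1 := hW.tsum_prod Finset.univ (S := fun z => {e z})
      (A := fun z η => if η (e z) = ξ z then 1 else 0)
      (fun z _ η ζ h => by simp only [h (e z) (by simp)])
      (fun z _ w _ hzw => by simpa using fun h => hzw (he h))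
    have h2 : ∀ z, ∑' η, ENNReal.ofReal (prodProb g lam η) * (if η (e z) = ξ z then 1 else 0)
        = ENNReal.ofReal (siteProb g (lam (e z)) (ξ z)) := fun z => by
      rw [tsum_prodProb_eval hgpos hlam (e z) fun k => if k = ξ z then 1 else 0,
        tsum_eq_single (ξ z) fun k hk => by simp [hk]]
      simp
    simp only [h2] at h1
    rw [prodProb, ENNReal.ofReal_prod_of_nonneg (f := fun z => siteProb g ((lam ∘ e) z) (ξ z))
      fun z _ => (siteProb_pos hgpos (hlam (e z)) (ξ z)).le]
    refine h1.symm.trans (tsum_congr fun η => ?_)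
    congr 1
    rw [Finset.prod_ite_zero]
    simp [funext_iff]
  simp only [hξ, ← ENNReal.tsum_mul_right]
  rw [ENNReal.tsum_comm]
  refine tsum_congr fun η => ?_
  rw [tsum_eq_single (η ∘ e) fun ξ hξ => by simp [hξ.symm]]
  simp

theorem prodProb_le_pow_mul (hgpos : ∀ k, 0 < k → 0 < g k) {lam : κ → ℝ} {b₀ : ℝ}
    (hlam : ∀ z, 0 < lam z) (hlb : ∀ z, lam z ≤ b₀) (hb₀ : b₀ ∈ fugacities g) (ξ : κ → ℕ) :
    prodProb g lam ξ
      ≤ partitionFn g b₀ ^ Fintype.card κ * prodProb g (fun _ => b₀) ξ := by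
  unfold prodProb
  rw [← Finset.card_univ, ← Finset.prod_const, ← Finset.prod_mul_distrib]
  refine Finset.prod_le_prod (fun z _ => ?_) fun z _ => siteProb_le hgpos (hlam z) (hlb z) hb₀ _
  exact (siteProb_pos hgpos (fugacities_ordConnected (hlam z) hb₀ ⟨le_rfl, hlb z⟩) _).le

theorem tsum_prodProb_exp_le_one_add (hgpos : ∀ k, 0 < k → 0 < g k) {lam : κ → ℝ} {b₀ : ℝ}
    (hlam : ∀ z, 0 < lam z) (hlb : ∀ z, lam z ≤ b₀) (hb₀ : b₀ ∈ fugacities g) {V : (κ → ℕ) → ℝ}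
    (hV : ∀ ξ, 0 ≤ V ξ) {ε : ℝ} (hε : 0 ≤ ε)
    (h : ENNReal.ofReal (partitionFn g b₀ ^ Fintype.card κ) * ∑' ξ, ENNReal.ofReal
      (prodProb g (fun _ => b₀) ξ) * ENNReal.ofReal (Real.exp (V ξ) - 1) ≤ ENNReal.ofReal ε) :
    ∑' ξ, ENNReal.ofReal (prodProb g lam ξ) * ENNReal.ofReal (Real.exp (V ξ))
      ≤ ENNReal.ofReal (1 + ε) := by
  have hf : ∀ z, lam z ∈ fugacities g := fun z =>
    fugacities_ordConnected (hlam z) hb₀ ⟨le_rfl, hlb z⟩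
  have hZ : 0 ≤ partitionFn g b₀ := zero_le_one.trans
    (one_le_partitionFn hgpos hb₀.1.le (fugacities_summable hgpos hb₀))
  have h1 : ∀ ξ, ENNReal.ofReal (prodProb g lam ξ) * ENNReal.ofReal (Real.exp (V ξ))
      ≤ ENNReal.ofReal (prodProb g lam ξ) + ENNReal.ofReal (partitionFn g b₀ ^ Fintype.card κ) *
        (ENNReal.ofReal (prodProb g (fun _ => b₀) ξ) * ENNReal.ofReal (Real.exp (V ξ) - 1)) :=
    fun ξ => by
      have he : 0 ≤ Real.exp (V ξ) - 1 := by linarith [Real.add_one_le_exp (V ξ), hV ξ]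
      have e : ENNReal.ofReal (Real.exp (V ξ)) = 1 + ENNReal.ofReal (Real.exp (V ξ) - 1) := by
        rw [← ENNReal.ofReal_one, ← ENNReal.ofReal_add zero_le_one he, add_sub_cancel]
      rw [e, mul_add, mul_one, ← mul_assoc, ← ENNReal.ofReal_mul (pow_nonneg hZ _)]
      gcongr
      exact prodProb_le_pow_mul hgpos hlam hlb hb₀ ξ
  refine (ENNReal.tsum_le_tsum h1).trans ?_
  rw [ENNReal.tsum_add, ENNReal.tsum_mul_left, tsum_prodProb hgpos hf,
    ENNReal.ofReal_add zero_le_one hε, ENNReal.ofReal_one]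
  gcongr

end

variable {g : ℕ → ℝ}

/-- Exponential moments of a nonnegative local function control its spatial sums. -/
theorem tsum_mul_sum_shift_le (hgpos : ∀ k, 0 < k → 0 < g k) {lam : Box N → ℝ} {b₀ : ℝ}
    (hlam : ∀ z, 0 < lam z) (hlb : ∀ z, lam z ≤ b₀) (hb₀ : b₀ ∈ fugacities g) {p : Config N → ℝ}
    (hp : ∀ η, 0 ≤ p η) (hp1 : ∑' η, ENNReal.ofReal (p η) = 1) {ψ : Config ℓ → ℝ}
    (hψ : ∀ ξ, 0 ≤ ψ ξ) {γ ε : ℝ} (hγ : 0 < γ) (hε : 0 ≤ ε)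
    (h : ENNReal.ofReal (partitionFn g b₀ ^ (2 * ℓ + 1)) * ∑' ξ : Config ℓ, ENNReal.ofReal
      (prodProb g (fun _ => b₀) ξ) * ENNReal.ofReal (Real.exp (γ * ψ ξ) - 1) ≤ ENNReal.ofReal ε) :
    ∑' η, ENNReal.ofReal (p η * ∑ x ∈ centres N ℓ, shift ψ x η) ≤ ENNReal.ofReal γ⁻¹ *
      ((2 * ℓ + 1) * relEntropy p (prodProb g lam) + ENNReal.ofReal (ε * (2 * N + 1))) := by
  have hf : ∀ z, lam z ∈ fugacities g := fun z =>
    fugacities_ordConnected (hlam z) hb₀ ⟨le_rfl, hlb z⟩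
  have hW := isProductWeight_prodProb hgpos hf
  have hV0 : ∀ x, ∀ η : Config N, 0 ≤ shift ψ x η := fun x η => hψ _
  set J : ℕ → Finset ℤ := fun j => (centres N ℓ).filter fun x => x % (2 * ℓ + 1) = j with hJ
  have hone : ∀ x ∈ centres N ℓ, ∑' η, ENNReal.ofReal (prodProb g lam η) *
      ENNReal.ofReal (Real.exp (γ * shift ψ x η)) ≤ ENNReal.ofReal (1 + ε) := fun x hx => by
    simp only [shift_eq hx]
    rw [tsum_prodProb_comp hgpos hf (windowSite_injective hx)
      fun ξ => ENNReal.ofReal (Real.exp (γ * ψ ξ))]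
    refine tsum_prodProb_exp_le_one_add hgpos (fun z => hlam _) (fun z => hlb _) hb₀
      (fun ξ => mul_nonneg hγ.le (hψ ξ)) hε ?_
    rwa [card_box]
  have hclass : ∀ j, ∑' η, ENNReal.ofReal (p η * (γ * ∑ x ∈ J j, shift ψ x η))
      ≤ relEntropy p (prodProb g lam) + ENNReal.ofReal (ε * (J j).card) := fun j => by
    refine tsum_mul_le_relEntropy_add (prodProb_pos hgpos hf) hp (tsum_prodProb hgpos hf) hp1
      (fun η => mul_nonneg hγ.le (Finset.sum_nonneg fun x _ => hV0 x η)) (by positivity) ?_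
    have e : ∀ η : Config N, ENNReal.ofReal (prodProb g lam η *
        Real.exp (γ * ∑ x ∈ J j, shift ψ x η)) = ENNReal.ofReal (prodProb g lam η) *
          ∏ x ∈ J j, ENNReal.ofReal (Real.exp (γ * shift ψ x η)) := fun η => by
      rw [ENNReal.ofReal_mul (prodProb_pos hgpos hf η).le, Finset.mul_sum, Real.exp_sum,
        ENNReal.ofReal_prod_of_nonneg fun x _ => (Real.exp_pos _).le]
    simp only [e]
    rw [hW.tsum_prod (J j) (S := window N ℓ)
      (A := fun x η => ENNReal.ofReal (Real.exp (γ * shift ψ x η)))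
      (fun x _ η ζ h => by simp only [dependsOn_shift ψ x h])
      (fun x hx y hy hxy => disjoint_window_of_emod_eq hxy
        ((Finset.mem_filter.1 hx).2.trans (Finset.mem_filter.1 hy).2.symm))]
    refine (Finset.prod_le_prod' fun x hx => hone x (Finset.mem_filter.1 hx).1).trans ?_
    rw [Finset.prod_const, ← ENNReal.ofReal_pow (by positivity), mul_comm ε, Real.exp_nat_mul]
    refine ENNReal.ofReal_le_ofReal (pow_le_pow_left₀ (by positivity) ?_ _)
    linarith [Real.add_one_le_exp ε]
  have hmaps : ∀ x ∈ centres N ℓ, (x % (2 * ℓ + 1 : ℤ)).toNat ∈ Finset.range (2 * ℓ + 1) :=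
    fun x _ => by
      have h1 := Int.emod_nonneg x (b := 2 * ℓ + 1) (by omega)
      have h2 := Int.emod_lt_of_pos x (b := 2 * ℓ + 1) (by omega)
      rw [Finset.mem_range]; omega
  have hJ' : ∀ j, J j = (centres N ℓ).filter fun x => (x % (2 * ℓ + 1 : ℤ)).toNat = j := fun j =>
    Finset.filter_congr fun x _ => by
      have h1 := Int.emod_nonneg x (b := 2 * ℓ + 1) (by omega)
      omega
  have hsplit : ∀ η : Config N, ∑ x ∈ centres N ℓ, shift ψ x η
      = ∑ j ∈ Finset.range (2 * ℓ + 1), ∑ x ∈ J j, shift ψ x η := fun η => by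
    rw [← Finset.sum_fiberwise_of_maps_to hmaps]
    exact Finset.sum_congr rfl fun j _ => by rw [hJ']
  have hcard : ∑ j ∈ Finset.range (2 * ℓ + 1), (J j).card = (centres N ℓ).card := by
    rw [Finset.card_eq_sum_card_fiberwise hmaps]
    exact Finset.sum_congr rfl fun j _ => by rw [hJ']
  have hpt : ∀ η, ENNReal.ofReal (p η * ∑ x ∈ centres N ℓ, shift ψ x η) = ENNReal.ofReal γ⁻¹ *
      ∑ j ∈ Finset.range (2 * ℓ + 1), ENNReal.ofReal (p η * (γ * ∑ x ∈ J j, shift ψ x η)) :=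
    fun η => by
      rw [← ENNReal.ofReal_sum_of_nonneg fun j _ => mul_nonneg (hp η) (mul_nonneg hγ.le
        (Finset.sum_nonneg fun x _ => hV0 x η)), ← ENNReal.ofReal_mul (inv_pos.2 hγ).le,
        ← Finset.mul_sum, ← Finset.mul_sum, ← hsplit]
      congr 1
      field_simp
  simp only [hpt]
  rw [ENNReal.tsum_mul_left]
  gcongr
  rw [Summable.tsum_finsetSum fun _ _ => ENNReal.summable]
  refine (Finset.sum_le_sum fun j _ => hclass j).trans ?_
  rw [Finset.sum_add_distrib, Finset.sum_const, Finset.card_range, nsmul_eq_mul]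
  push_cast
  gcongr
  rw [← ENNReal.ofReal_sum_of_nonneg fun j _ => by positivity, ← Finset.mul_sum]
  refine ENNReal.ofReal_le_ofReal ?_
  gcongr
  have := card_centres_le N ℓ
  rw [← hcard] at this
  exact_mod_cast this


/-! ### Means of local functions -/

/-- The values of a function, cut off at the levels `-A` and `A`. -/
noncomputable def truncate (A u : ℝ) : ℝ := max (-A) (min u A)

theorem abs_truncate_le {A : ℝ} (hA : 0 ≤ A) (u : ℝ) : |truncate A u| ≤ A :=
  abs_le.2 ⟨le_max_left _ _, max_le (by linarith) (min_le_right _ _)⟩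

theorem truncate_eq_self {A u : ℝ} (h : |u| ≤ A) : truncate A u = u := by
  have := abs_le.1 h
  rw [truncate, min_eq_left this.2, max_eq_right this.1]

theorem abs_sub_truncate_le {A : ℝ} (hA : 0 ≤ A) (u : ℝ) : |u - truncate A u| ≤ |u| := by
  unfold truncate
  rcases le_total u A with h | h
  · rw [min_eq_left h]
    rcases le_total (-A) u with h' | h'
    · rw [max_eq_right h']; simp
    · rw [max_eq_left h', abs_of_nonpos (by linarith), abs_of_nonpos (by linarith)]; linarith
  · rw [min_eq_right h, max_eq_right (by linarith), abs_of_nonneg (by linarith),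
      abs_of_nonneg (by linarith)]
    linarith

section

variable {κ : Type*} [Fintype κ] {g : ℕ → ℝ}

/-- The mean of `φ` under the product measure with fugacities `lam`. -/
noncomputable def localMean (g : ℕ → ℝ) (φ : (κ → ℕ) → ℝ) (lam : κ → ℝ) : ℝ :=
  ∑' ξ, prodProb g lam ξ * φ ξ

variable {b₀ : ℝ} {φ : (κ → ℕ) → ℝ}

theorem abs_prodProb_mul_le (hgpos : ∀ k, 0 < k → 0 < g k) (hb₀ : b₀ ∈ fugacities g) {lam : κ → ℝ}
    (hlam : ∀ z, 0 < lam z) (hlb : ∀ z, lam z ≤ b₀) (ξ : κ → ℕ) :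
    |prodProb g lam ξ * φ ξ|
      ≤ partitionFn g b₀ ^ Fintype.card κ * (prodProb g (fun _ => b₀) ξ * |φ ξ|) := by
  have hpos := prodProb_pos hgpos
    (fun z => fugacities_ordConnected (hlam z) hb₀ ⟨le_rfl, hlb z⟩) ξ
  rw [abs_mul, abs_of_pos hpos, ← mul_assoc]
  exact mul_le_mul_of_nonneg_right (prodProb_le_pow_mul hgpos hlam hlb hb₀ ξ) (abs_nonneg _)

theorem summable_prodProb_mul (hgpos : ∀ k, 0 < k → 0 < g k) (hb₀ : b₀ ∈ fugacities g)
    (hφ : Summable fun ξ => prodProb g (fun _ => b₀) ξ * |φ ξ|) {lam : κ → ℝ}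
    (hlam : ∀ z, 0 < lam z) (hlb : ∀ z, lam z ≤ b₀) : Summable fun ξ => prodProb g lam ξ * φ ξ :=
  Summable.of_norm_bounded (hφ.mul_left _) fun ξ => abs_prodProb_mul_le hgpos hb₀ hlam hlb ξ

theorem abs_localMean_le (hgpos : ∀ k, 0 < k → 0 < g k) (hb₀ : b₀ ∈ fugacities g)
    (hφ : Summable fun ξ => prodProb g (fun _ => b₀) ξ * |φ ξ|) {lam : κ → ℝ}
    (hlam : ∀ z, 0 < lam z) (hlb : ∀ z, lam z ≤ b₀) :
    |localMean g φ lam| ≤ partitionFn g b₀ ^ Fintype.card κ *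
      ∑' ξ, prodProb g (fun _ => b₀) ξ * |φ ξ| := by
  rw [← tsum_mul_left, ← Real.norm_eq_abs]
  exact tsum_of_norm_bounded (hφ.mul_left _).hasSum
    (abs_prodProb_mul_le (φ := φ) hgpos hb₀ hlam hlb)

theorem tendsto_localMean (hgpos : ∀ k, 0 < k → 0 < g k) (hb₀ : b₀ ∈ fugacities g)
    (hφ : Summable fun ξ => prodProb g (fun _ => b₀) ξ * |φ ξ|) {X : Type*} {l : Filter X}
    {lam : X → κ → ℝ} {lam₀ : κ → ℝ} (hlam : ∀ᶠ n in l, ∀ z, 0 < lam n z ∧ lam n z ≤ b₀)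
    (hlam₀ : ∀ z, lam₀ z ∈ fugacities g) (h : ∀ z, Tendsto (fun n => lam n z) l (𝓝 (lam₀ z))) :
    Tendsto (fun n => localMean g φ (lam n)) l (𝓝 (localMean g φ lam₀)) := by
  refine tendsto_tsum_of_dominated_convergence (hφ.mul_left (partitionFn g b₀ ^ Fintype.card κ))
    (fun ξ => Tendsto.mul_const _ ?_) ?_
  · exact tendsto_finsetProd _ fun z _ => (continuousAt_siteProb hgpos (hlam₀ z) (ξ z)).tendsto.comp
      (h z)
  · filter_upwards [hlam] with n hn ξ
    exact abs_prodProb_mul_le hgpos hb₀ (fun z => (hn z).1) (fun z => (hn z).2) ξ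

end

section

variable {g : ℕ → ℝ} {ℓ : ℕ} {φ : Config ℓ → ℝ} {b₀ : ℝ}

theorem HasExpMoments.integrable (hφ : HasExpMoments g φ) {lam : ℝ} (hlam : lam ∈ fugacities g) :
    Integrable φ (homMeasure g ℓ lam) := by
  refine (hφ 1 one_pos lam hlam).mono' (measurable_of_countable φ).aestronglyMeasurable
    (ae_of_all _ fun ξ => ?_)
  rw [Real.norm_eq_abs]
  linarith [Real.add_one_le_exp (1 * |φ ξ|)]

theorem HasExpMoments.summable (hgpos : ∀ k, 0 < k → 0 < g k) (hφ : HasExpMoments g φ) {lam : ℝ}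
    (hlam : lam ∈ fugacities g) : Summable fun ξ => prodProb g (fun _ => lam) ξ * |φ ξ| := by
  have h := (hφ.integrable hlam).abs.lintegral_lt_top
  rw [homMeasure, lintegral_pi_siteMeasure hgpos fun _ => hlam] at h
  refine (ENNReal.summable_toReal h.ne).congr fun ξ => ?_
  rw [← ENNReal.ofReal_mul (prodProb_pos hgpos (fun _ => hlam) ξ).le, ENNReal.toReal_ofReal
    (mul_nonneg (prodProb_pos hgpos (fun _ => hlam) ξ).le (abs_nonneg _))]

theorem HasExpMoments.localAverage_eq (hgpos : ∀ k, 0 < k → 0 < g k) (hφ : HasExpMoments g φ)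
    {lam : ℝ} (hlam : lam ∈ fugacities g) :
    localAverage g φ lam = localMean g φ fun _ => lam := by
  rw [localAverage, integral_countable (hφ.integrable hlam)]
  refine tsum_congr fun ξ => ?_
  rw [measureReal_def, homMeasure, pi_siteMeasure_singleton hgpos fun _ => hlam,
    ENNReal.toReal_ofReal (prodProb_pos hgpos (fun _ => hlam) ξ).le, smul_eq_mul]

theorem HasExpMoments.tendsto_truncate (hgpos : ∀ k, 0 < k → 0 < g k) (hφ : HasExpMoments g φ)
    (hb₀ : b₀ ∈ fugacities g) {γ : ℝ} (hγ : 0 < γ) :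
    Tendsto (fun n : ℕ => ∑' ξ : Config ℓ, ENNReal.ofReal (prodProb g (fun _ => b₀) ξ) *
      ENNReal.ofReal (Real.exp (γ * |φ ξ - truncate n (φ ξ)|) - 1)) atTop (𝓝 0) := by
  simp only [← lintegral_pi_siteMeasure hgpos fun _ => hb₀]
  have h := tendsto_lintegral_of_dominated_convergence
    (μ := Measure.pi fun _ : Box ℓ => siteMeasure g b₀)
    (F := fun (n : ℕ) ξ => ENNReal.ofReal (Real.exp (γ * |φ ξ - truncate n (φ ξ)|) - 1))
    (f := fun _ => 0) (fun ξ => ENNReal.ofReal (Real.exp (γ * |φ ξ|)))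
    (fun n => measurable_of_countable _) (fun n => ae_of_all _ fun ξ => ?_)
    (hφ γ hγ b₀ hb₀).lintegral_lt_top.ne (ae_of_all _ fun ξ => ?_)
  · simpa using h
  · refine ENNReal.ofReal_le_ofReal ?_
    have : Real.exp (γ * |φ ξ - truncate n (φ ξ)|) ≤ Real.exp (γ * |φ ξ|) :=
      Real.exp_le_exp.2 (mul_le_mul_of_nonneg_left (abs_sub_truncate_le n.cast_nonneg _) hγ.le)
    linarith
  · refine tendsto_const_nhds.congr' ?_
    obtain ⟨n₀, hn₀⟩ := exists_nat_ge |φ ξ|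
    filter_upwards [eventually_ge_atTop n₀] with n hn
    rw [truncate_eq_self (hn₀.trans (by exact_mod_cast hn))]
    simp

end

/-! ### Riemann sums -/

theorem tendsto_floor_add_div (y : ℝ) (w c : ℝ) :
    Tendsto (fun N : ℕ => ((⌊(N : ℝ) * y⌋ : ℝ) + w) / (N + c)) atTop (𝓝 y) := by
  have hN : Tendsto (fun N : ℕ => (N : ℝ)) atTop atTop := tendsto_natCast_atTop_atTop
  have hfl : Tendsto (fun N : ℕ => (⌊(N : ℝ) * y⌋ : ℝ) / N) atTop (𝓝 y) := by
    have h1 : Tendsto (fun N : ℕ => y - 1 / (N : ℝ)) atTop (𝓝 y) := by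
      simpa using tendsto_const_nhds.sub (tendsto_one_div_atTop_nhds_zero_nat (𝕜 := ℝ))
    refine tendsto_of_tendsto_of_tendsto_of_le_of_le' h1 tendsto_const_nhds ?_ ?_
    · filter_upwards [eventually_gt_atTop 0] with N hN0
      have : (0 : ℝ) < N := by exact_mod_cast hN0
      rw [le_div_iff₀ this, sub_mul, one_div, inv_mul_cancel₀ this.ne']
      linarith [Int.sub_one_lt_floor ((N : ℝ) * y)]
    · filter_upwards [eventually_gt_atTop 0] with N hN0
      have : (0 : ℝ) < N := by exact_mod_cast hN0
      rw [div_le_iff₀ this]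
      linarith [Int.floor_le ((N : ℝ) * y)]
  have hw : Tendsto (fun N : ℕ => w / (N : ℝ)) atTop (𝓝 0) := hN.const_div_atTop w
  have hc : Tendsto (fun N : ℕ => 1 + c / (N : ℝ)) atTop (𝓝 1) := by
    simpa using (hN.const_div_atTop c).const_add 1
  have h := (hfl.add hw).div hc one_ne_zero
  rw [add_zero, div_one] at h
  refine h.congr' ?_
  filter_upwards [eventually_gt_atTop 0] with N hN0
  have h0 : (N : ℝ) ≠ 0 := by exact_mod_cast hN0.ne'
  simp only [Pi.div_apply]
  rw [← add_div, one_add_div h0, div_div_div_cancel_right₀ h0]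

theorem eventually_floor_mem_centres (ℓ : ℕ) {y : ℝ} (hy : y ∈ Ioo (-1 : ℝ) 1) :
    ∀ᶠ N : ℕ in atTop, ⌊(N : ℝ) * y⌋ ∈ centres N ℓ := by
  have hN : Tendsto (fun N : ℕ => (N : ℝ)) atTop atTop := tendsto_natCast_atTop_atTop
  filter_upwards [(hN.atTop_mul_const (by linarith [hy.1] : 0 < 1 + y)).eventually_ge_atTop (ℓ : ℝ),
    (hN.atTop_mul_const (by linarith [hy.2] : 0 < 1 - y)).eventually_ge_atTop (ℓ : ℝ)] with N h1 h2
  rw [Finset.mem_Icc]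
  constructor
  · rw [Int.le_floor]; push_cast; linarith
  · have : (⌊(N : ℝ) * y⌋ : ℝ) ≤ N - ℓ := (Int.floor_le _).trans (by linarith)
    exact_mod_cast this

theorem tendsto_sum_centres (ℓ : ℕ) {c : ℕ → ℤ → ℝ} {F : ℝ → ℝ} {M : ℝ}
    (hM : ∀ N, ∀ x ∈ centres N ℓ, |c N x| ≤ M)
    (hF : ∀ᵐ y ∂volume.restrict (Ioo (-1 : ℝ) 1),
      Tendsto (fun N : ℕ => c N ⌊(N : ℝ) * y⌋) atTop (𝓝 (F y))) :
    Tendsto (fun N : ℕ => 1 / (N : ℝ) * ∑ x ∈ centres N ℓ, c N x) atTop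
      (𝓝 (∫ y in (-1 : ℝ)..1, F y)) := by
  have hM0 : 0 ≤ M := (abs_nonneg _).trans (hM ℓ 0 (by simp))
  set f : ℕ → ℝ → ℝ := fun N y => ∑ x ∈ centres N ℓ,
    (Ico ((x : ℝ) / N) ((x + 1) / N)).indicator (fun _ => c N x) y with hf
  have hfl : ∀ N : ℕ, 0 < N → ∀ y, f N y
      = if ⌊(N : ℝ) * y⌋ ∈ centres N ℓ then c N ⌊(N : ℝ) * y⌋ else 0 := fun N hN y => by
    have h0 : (0 : ℝ) < N := by exact_mod_cast hN
    have e : ∀ x : ℤ, (Ico ((x : ℝ) / N) ((x + 1) / N)).indicator (fun _ => c N x) y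
        = if ⌊(N : ℝ) * y⌋ = x then c N x else 0 := fun x => by
      rw [indicator_apply]
      congr 1
      rw [mem_Ico, div_le_iff₀ h0, lt_div_iff₀ h0, Int.floor_eq_iff, mul_comm]
    simp only [hf, e]
    rw [Finset.sum_ite_eq]
  have hint : ∀ N : ℕ, ∫ y, f N y = 1 / (N : ℝ) * ∑ x ∈ centres N ℓ, c N x := fun N => by
    rw [hf, integral_finsetSum _ fun x _ => (integrable_indicator_iff measurableSet_Ico).2
      (integrableOn_const (by simp)), Finset.mul_sum]
    refine Finset.sum_congr rfl fun x _ => ?_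
    rw [integral_indicator_const _ measurableSet_Ico, measureReal_def, Real.volume_Ico, ← sub_div,
      add_sub_cancel_left, ENNReal.toReal_ofReal (by positivity), smul_eq_mul]
  simp only [← hint]
  rw [intervalIntegral.integral_of_le (by norm_num), integral_Ioc_eq_integral_Ioo,
    ← integral_indicator measurableSet_Ioo, ← tendsto_add_atTop_iff_nat 1]
  refine tendsto_integral_of_dominated_convergence ((Icc (-1 : ℝ) 2).indicator fun _ => M)
    (fun N => ?_) ((integrable_indicator_iff measurableSet_Icc).2 (integrableOn_const (by simp)))
    (fun N => ae_of_all _ fun y => ?_) ?_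
  · exact (Finset.measurable_sum _ fun x _ =>
      measurable_const.indicator measurableSet_Ico).aestronglyMeasurable
  · have h0 : (0 : ℝ) < (N + 1 : ℕ) := by positivity
    have h1 : (1 : ℝ) ≤ (N + 1 : ℕ) := by exact_mod_cast Nat.le_add_left 1 N
    rw [hfl (N + 1) N.succ_pos y, indicator_apply]
    split_ifs with h2 h3 h3
    · exact hM _ _ h2
    · exfalso
      rw [Finset.mem_Icc] at h2
      apply h3
      have h4 : (-((N + 1 : ℕ) : ℝ) + ℓ) ≤ ⌊((N + 1 : ℕ) : ℝ) * y⌋ := by exact_mod_cast h2.1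
      have h5 : (⌊((N + 1 : ℕ) : ℝ) * y⌋ : ℝ) ≤ ((N + 1 : ℕ) : ℝ) - ℓ := by exact_mod_cast h2.2
      have h6 := Int.floor_le (((N + 1 : ℕ) : ℝ) * y)
      have h7 := Int.lt_floor_add_one (((N + 1 : ℕ) : ℝ) * y)
      have h8 : (0 : ℝ) ≤ ℓ := ℓ.cast_nonneg
      constructor <;> by_contra hc <;> rw [not_le] at hc
      · nlinarith
      · nlinarith
    · simpa using hM0
    · simp
  · have hF' := (ae_restrict_iff' measurableSet_Ioo).1 hF
    have hne : ∀ᵐ y : ℝ, y ≠ -1 ∧ y ≠ 1 :=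
      (Measure.ae_ne volume (-1 : ℝ)).and (Measure.ae_ne volume (1 : ℝ))
    filter_upwards [hF', hne] with y hy hy'
    rw [tendsto_add_atTop_iff_nat (f := fun N => f N y) 1, indicator_apply]
    split_ifs with h
    · refine (hy h).congr' ?_
      filter_upwards [eventually_floor_mem_centres ℓ h, eventually_gt_atTop 0] with N h1 h2
      rw [hfl N h2, if_pos h1]
    · refine tendsto_const_nhds.congr' ?_
      rcases lt_or_gt_of_ne hy'.1 with h1 | h1
      · filter_upwards [eventually_gt_atTop 0] with N hN
        have h0 : (0 : ℝ) < N := by exact_mod_cast hN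
        rw [hfl N hN, if_neg]
        rw [Finset.mem_Icc]
        rintro ⟨h2, -⟩
        have h4 : (-(N : ℝ) + ℓ) ≤ ⌊(N : ℝ) * y⌋ := by exact_mod_cast h2
        have h6 := Int.floor_le ((N : ℝ) * y)
        have h8 : (0 : ℝ) ≤ ℓ := ℓ.cast_nonneg
        nlinarith
      · have h3 : 1 < y := lt_of_le_of_ne (not_lt.1 fun h4 => h ⟨h1, h4⟩) hy'.2.symm
        have hN : Tendsto (fun N : ℕ => (N : ℝ)) atTop atTop := tendsto_natCast_atTop_atTop
        filter_upwards [eventually_gt_atTop 0,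
          (hN.atTop_mul_const (by linarith : 0 < y - 1)).eventually_ge_atTop 1] with N hN h4
        rw [hfl N hN, if_neg]
        rw [Finset.mem_Icc]
        rintro ⟨-, h2⟩
        have h5 : (⌊(N : ℝ) * y⌋ : ℝ) ≤ (N : ℝ) - ℓ := by exact_mod_cast h2
        have h7 := Int.lt_floor_add_one ((N : ℝ) * y)
        have h8 : (0 : ℝ) ≤ ℓ := ℓ.cast_nonneg
        linarith

/-! ### The equilibrium mean of a spatial average -/

variable {g : ℕ → ℝ} {ℓ : ℕ} {a₀ b₀ u v : ℝ}

/-- The mean of the spatial average of `φ` under the stationary product measure. -/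
noncomputable def meanSpatialAverage (g : ℕ → ℝ) (N : ℕ) (G : ℝ → ℝ) (φ : Config ℓ → ℝ)
    (u v : ℝ) : ℝ :=
  1 / (N : ℝ) * ∑ x ∈ centres N ℓ, G ((x : ℝ) / N) *
    localMean g φ fun z : Box ℓ => profile N u v (x + z)

theorem profile_window_mem_Icc {N : ℕ} (hu : u ∈ Icc a₀ b₀) (hv : v ∈ Icc a₀ b₀) {x : ℤ}
    (hx : x ∈ centres N ℓ) (z : Box ℓ) : profile N u v (x + z) ∈ Icc a₀ b₀ :=
  profile_box_mem_Icc hu hv (windowSite x hx z)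

theorem div_mem_Icc_of_mem_centres {N : ℕ} {x : ℤ} (hx : x ∈ centres N ℓ) :
    (x : ℝ) / N ∈ Icc (-1 : ℝ) 1 := by
  rw [Finset.mem_Icc] at hx
  rcases N.eq_zero_or_pos with rfl | hN
  · simp
  have h0 : (0 : ℝ) < N := by exact_mod_cast hN
  have h1 : (-(N : ℝ) + ℓ) ≤ x := by exact_mod_cast hx.1
  have h2 : (x : ℝ) ≤ N - ℓ := by exact_mod_cast hx.2
  have h3 : (0 : ℝ) ≤ ℓ := ℓ.cast_nonneg
  rw [mem_Icc, le_div_iff₀ h0, div_le_iff₀ h0]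
  constructor <;> linarith

theorem tendsto_meanSpatialAverage (hgpos : ∀ k, 0 < k → 0 < g k) (ha₀ : 0 < a₀)
    (hb₀ : b₀ ∈ fugacities g) (hu : u ∈ Icc a₀ b₀) (hv : v ∈ Icc a₀ b₀) {φ : Config ℓ → ℝ}
    (hφ : HasExpMoments g φ) {G : ℝ → ℝ} (hG : IsTestFunction G) :
    Tendsto (fun N => meanSpatialAverage g N G φ u v) atTop
      (𝓝 (∫ y in (-1 : ℝ)..1, G y * localAverage g φ (interp u v y))) := by
  obtain ⟨M, hM⟩ := hG.bounded
  have hM0 : 0 ≤ M := (abs_nonneg _).trans (hM 0 (by simp))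
  have hs := hφ.summable hgpos hb₀
  refine tendsto_sum_centres ℓ (M := M * (partitionFn g b₀ ^ Fintype.card (Box ℓ) *
    ∑' ξ, prodProb g (fun _ => b₀) ξ * |φ ξ|)) (fun N x hx => ?_) ?_
  · rw [abs_mul]
    refine mul_le_mul (hM _ (div_mem_Icc_of_mem_centres hx)) ?_ (abs_nonneg _) hM0
    exact abs_localMean_le hgpos hb₀ hs
      (fun z => ha₀.trans_le (profile_window_mem_Icc hu hv hx z).1)
      (fun z => (profile_window_mem_Icc hu hv hx z).2)
  · have hc := ae_restrict_of_ae_restrict_of_subset Ioo_subset_Icc_self hG.continuous_ae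
    filter_upwards [hc, ae_restrict_mem measurableSet_Ioo] with y hy hyI
    have hmem := eventually_floor_mem_centres ℓ hyI
    have hyf : interp u v y ∈ fugacities g :=
      fugacities_ordConnected ha₀ hb₀ (interp_mem_Icc hu hv (Ioo_subset_Icc_self hyI))
    refine Tendsto.mul ?_ ?_
    · refine hy.tendsto.comp (tendsto_nhdsWithin_iff.2 ⟨?_, ?_⟩)
      · simpa using tendsto_floor_add_div y 0 0
      · filter_upwards [hmem] with N hN using div_mem_Icc_of_mem_centres hN
    · rw [hφ.localAverage_eq hgpos hyf]
      refine tendsto_localMean hgpos hb₀ hs ?_ (fun _ => hyf) fun z => ?_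
      · filter_upwards [hmem] with N hN z
        have := profile_window_mem_Icc hu hv hN z
        exact ⟨ha₀.trans_le this.1, this.2⟩
      · have h := tendsto_floor_add_div y ((z : ℤ) : ℝ) 1
        have hcont : Continuous (interp u v) := by unfold interp; fun_prop
        refine ((hcont.tendsto y).comp h).congr fun N => ?_
        simp only [Function.comp, profile]
        push_cast
        rfl


/-! ### Distance between spatial averages and their equilibrium means -/

section

variable {κ ι : Type*} [Fintype κ] [Fintype ι] [DecidableEq ι] {g : ℕ → ℝ} {b₀ : ℝ}

theorem tsum_prodProb_mul_comp (hgpos : ∀ k, 0 < k → 0 < g k) {lam : ι → ℝ}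
    (hlam : ∀ x, lam x ∈ fugacities g) {e : κ → ι} (he : Function.Injective e) {Φ : (κ → ℕ) → ℝ}
    {B : ℝ} (hB : ∀ ξ, |Φ ξ| ≤ B) :
    ∑' η, prodProb g lam η * Φ (η ∘ e) = localMean g Φ (lam ∘ e) := by
  obtain ⟨h1, h1'⟩ := ofReal_tsum_mul_add (fun η => (prodProb_pos hgpos hlam η).le)
    (tsum_prodProb hgpos hlam) (Φ := fun η => Φ (η ∘ e)) fun η => hB _
  have hlam' : ∀ z, (lam ∘ e) z ∈ fugacities g := fun z => hlam (e z)
  obtain ⟨h2, h2'⟩ := ofReal_tsum_mul_add (fun ξ => (prodProb_pos hgpos hlam' ξ).le)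
    (tsum_prodProb hgpos hlam') hB
  rw [tsum_prodProb_comp hgpos hlam he fun ξ => ENNReal.ofReal (Φ ξ + B), h2,
    ENNReal.ofReal_eq_ofReal_iff h2' h1'] at h1
  unfold localMean
  linarith

theorem abs_localMean_sub_le (hgpos : ∀ k, 0 < k → 0 < g k) (hb₀ : b₀ ∈ fugacities g)
    {φ φ' : (κ → ℕ) → ℝ} (hφ : Summable fun ξ => prodProb g (fun _ => b₀) ξ * |φ ξ|)
    (hφ' : Summable fun ξ => prodProb g (fun _ => b₀) ξ * |φ' ξ|) {lam : κ → ℝ}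
    (hlam : ∀ z, 0 < lam z) (hlb : ∀ z, lam z ≤ b₀) {γ ε : ℝ} (hγ : 0 < γ) (hε : 0 ≤ ε)
    (h : ENNReal.ofReal (partitionFn g b₀ ^ Fintype.card κ) * ∑' ξ, ENNReal.ofReal
      (prodProb g (fun _ => b₀) ξ) * ENNReal.ofReal (Real.exp (γ * |φ ξ - φ' ξ|) - 1)
        ≤ ENNReal.ofReal ε) :
    |localMean g φ' lam - localMean g φ lam| ≤ ε / γ := by
  have hs := summable_prodProb_mul hgpos hb₀ hφ hlam hlb
  have hs' := summable_prodProb_mul hgpos hb₀ hφ' hlam hlb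
  have hpos := fun ξ => prodProb_pos hgpos
    (fun z => fugacities_ordConnected (hlam z) hb₀ ⟨le_rfl, hlb z⟩) ξ
  have hZ : 0 ≤ partitionFn g b₀ := zero_le_one.trans
    (one_le_partitionFn hgpos hb₀.1.le (fugacities_summable hgpos hb₀))
  have hsd : Summable fun ξ => |prodProb g lam ξ * φ' ξ - prodProb g lam ξ * φ ξ| :=
    (hs'.sub hs).abs
  have h1 : |localMean g φ' lam - localMean g φ lam|
      ≤ ∑' ξ, |prodProb g lam ξ * φ' ξ - prodProb g lam ξ * φ ξ| := by
    have h0 := norm_tsum_le_tsum_norm (hs'.sub hs).norm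
    rw [hs'.tsum_sub hs] at h0
    exact h0
  rw [le_div_iff₀ hγ, mul_comm]
  refine (mul_le_mul_of_nonneg_left h1 hγ.le).trans ?_
  rw [← tsum_mul_left, ← ENNReal.ofReal_le_ofReal_iff hε, ENNReal.ofReal_tsum_of_nonneg
    (fun ξ => mul_nonneg hγ.le (abs_nonneg _)) (hsd.mul_left γ)]
  refine le_trans ?_ h
  rw [← ENNReal.tsum_mul_left]
  refine ENNReal.tsum_le_tsum fun ξ => ?_
  rw [← mul_assoc, ← ENNReal.ofReal_mul (pow_nonneg hZ _), ← ENNReal.ofReal_mul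
    (mul_nonneg (pow_nonneg hZ _) (prodProb_pos hgpos (fun _ => hb₀) ξ).le)]
  refine ENNReal.ofReal_le_ofReal ?_
  rw [← mul_sub, abs_mul, abs_of_pos (hpos ξ), mul_left_comm, abs_sub_comm]
  have h2 : γ * |φ ξ - φ' ξ| ≤ Real.exp (γ * |φ ξ - φ' ξ|) - 1 := by
    linarith [Real.add_one_le_exp (γ * |φ ξ - φ' ξ|)]
  have h3 : 0 ≤ γ * |φ ξ - φ' ξ| := mul_nonneg hγ.le (abs_nonneg _)
  exact mul_le_mul (prodProb_le_pow_mul hgpos hlam hlb hb₀ ξ) h2 h3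
    (mul_nonneg (pow_nonneg hZ _) (prodProb_pos hgpos (fun _ => hb₀) ξ).le)

end

variable {g : ℕ → ℝ} {N ℓ : ℕ} {a₀ b₀ u v M : ℝ} {G : ℝ → ℝ} {p : Config N → ℝ}

theorem tsum_mul_sq_spatialAverage_sub_le (hgpos : ∀ k, 0 < k → 0 < g k) (ha₀ : 0 < a₀)
    (hb₀ : b₀ ∈ fugacities g) (hu : u ∈ Icc a₀ b₀) (hv : v ∈ Icc a₀ b₀) (hM0 : 0 ≤ M)
    (hM : ∀ y ∈ Icc (-1 : ℝ) 1, |G y| ≤ M) (hp : ∀ η, 0 ≤ p η)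
    (hp1 : ∑' η, ENNReal.ofReal (p η) = 1) {φ : Config ℓ → ℝ} {A : ℝ} (hA : ∀ ξ, |φ ξ| ≤ A) :
    ∑' η, ENNReal.ofReal (p η * (spatialAverage G φ η - meanSpatialAverage g N G φ u v) ^ 2) ≤
      ENNReal.ofReal (1 / (N : ℝ) ^ 2) * (ENNReal.ofReal ((M * (2 * A)) ^ 2 * (2 * N + 1)) *
        ((4 * ℓ + 1 : ℕ) + 4 * (2 * ℓ + 1 : ℕ) * ∑ z : Box N,
          resampling (fun η => ENNReal.ofReal (refProb g N u v η))
            (fun η => p η / refProb g N u v η) {z})) := by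
  have hlam : ∀ x : Box N, profile N u v x ∈ fugacities g := fun x =>
    fugacities_ordConnected ha₀ hb₀ (profile_box_mem_Icc hu hv x)
  have hν := fun η : Config N => refProb_pos_of_mem_Icc hgpos ha₀ hb₀ hu hv η
  have hW : IsProductWeight fun η : Config N => ENNReal.ofReal (refProb g N u v η) :=
    isProductWeight_prodProb hgpos hlam
  have hA0 : 0 ≤ A := (abs_nonneg _).trans (hA 0)
  set m : ℤ → ℝ := fun x => localMean g φ fun z : Box ℓ => profile N u v (x + z) with hm
  have hmean : ∀ x ∈ centres N ℓ, ∑' η, refProb g N u v η * shift φ x η = m x := fun x hx => by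
    simp only [shift_eq hx]
    exact tsum_prodProb_mul_comp hgpos hlam (windowSite_injective hx) hA
  have hm' : ∀ x ∈ centres N ℓ, |m x| ≤ A := fun x hx => by
    rw [← hmean x hx]
    exact abs_tsum_mul_le (fun η => (hν η).le) hW.tsum_eq_one fun η => hA _
  set F : ℤ → Config N → ℝ := fun x η => G ((x : ℝ) / N) * (shift φ x η - m x) with hF
  have hFB : ∀ x ∈ centres N ℓ, ∀ η, |F x η| ≤ M * (2 * A) := fun x hx η => by
    rw [hF, abs_mul]
    refine mul_le_mul (hM _ (div_mem_Icc_of_mem_centres hx)) ?_ (abs_nonneg _) hM0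
    have h1 : |shift φ x η| ≤ A := hA _
    have h2 := hm' x hx
    have h3 := abs_sub (shift φ x η) (m x)
    linarith
  have hF0 : ∀ x ∈ centres N ℓ, ∑' η, refProb g N u v η * F x η = 0 := fun x hx => by
    have hs := (summable_mul_of_abs_le (fun η => (hν η).le) hW.tsum_eq_one
      (Φ := fun η : Config N => shift φ x η) (B := A) fun η => hA _).hasSum
    rw [hmean x hx] at hs
    have h1 := (hasSum_one_of_tsum_ofReal (fun η => (hν η).le) hW.tsum_eq_one).mul_right (m x)
    have h2 := ((hs.sub h1).mul_left (G ((x : ℝ) / N))).tsum_eq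
    rw [one_mul, sub_self, mul_zero] at h2
    rw [← h2]
    exact tsum_congr fun η => by rw [hF]; ring
  have hkey := hW.tsum_mul_sq_sum_le hν hp hp1 (centres N ℓ) (S := window N ℓ) (F := F)
    (fun x _ η ζ h => by simp only [hF, dependsOn_shift φ x h]) hFB (by positivity) hF0
    (fun x _ => card_filter_not_disjoint_window_le _ x) (fun z => card_filter_mem_window_le _ z)
  have hY : ∀ η, ENNReal.ofReal (p η * (spatialAverage G φ η - meanSpatialAverage g N G φ u v) ^ 2)
      = ENNReal.ofReal (1 / (N : ℝ) ^ 2) * ENNReal.ofReal (p η * (∑ x ∈ centres N ℓ, F x η) ^ 2) :=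
    fun η => by
      rw [← ENNReal.ofReal_mul (by positivity)]
      congr 1
      have : spatialAverage G φ η - meanSpatialAverage g N G φ u v
          = 1 / (N : ℝ) * ∑ x ∈ centres N ℓ, F x η := by
        unfold spatialAverage meanSpatialAverage
        rw [← mul_sub, ← Finset.sum_sub_distrib]
        simp only [hF, mul_sub, hm]
      rw [this]
      ring
  simp only [hY]
  rw [ENNReal.tsum_mul_left]
  gcongr
  refine hkey.trans ?_
  gcongr
  exact_mod_cast card_centres_le N ℓ

theorem tsum_mul_abs_spatialAverage_sub_le (hgpos : ∀ k, 0 < k → 0 < g k) (ha₀ : 0 < a₀)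
    (hb₀ : b₀ ∈ fugacities g) (hu : u ∈ Icc a₀ b₀) (hv : v ∈ Icc a₀ b₀) (hM0 : 0 ≤ M)
    (hM : ∀ y ∈ Icc (-1 : ℝ) 1, |G y| ≤ M) (hp : ∀ η, 0 ≤ p η)
    (hp1 : ∑' η, ENNReal.ofReal (p η) = 1) {φ : Config ℓ → ℝ} (hφ : HasExpMoments g φ)
    {A γ ε δ : ℝ} (hA : 0 ≤ A) (hγ : 0 < γ) (hε : 0 ≤ ε) (hδ : 0 < δ)
    (h : ENNReal.ofReal (partitionFn g b₀ ^ (2 * ℓ + 1)) * ∑' ξ : Config ℓ, ENNReal.ofReal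
      (prodProb g (fun _ => b₀) ξ) * ENNReal.ofReal (Real.exp (γ * |φ ξ - truncate A (φ ξ)|) - 1)
        ≤ ENNReal.ofReal ε) (c : ℝ) :
    ∑' η, ENNReal.ofReal (p η * |spatialAverage G φ η - c|) ≤
      ENNReal.ofReal (M / N) * (ENNReal.ofReal γ⁻¹ * ((2 * ℓ + 1) * relEntropy p (refProb g N u v)
        + ENNReal.ofReal (ε * (2 * N + 1))))
      + (ENNReal.ofReal δ + ENNReal.ofReal δ⁻¹ * (ENNReal.ofReal (1 / (N : ℝ) ^ 2) *
        (ENNReal.ofReal ((M * (2 * A)) ^ 2 * (2 * N + 1)) *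
          ((4 * ℓ + 1 : ℕ) + 4 * (2 * ℓ + 1 : ℕ) * ∑ z : Box N,
            resampling (fun η => ENNReal.ofReal (refProb g N u v η))
              (fun η => p η / refProb g N u v η) {z}))))
      + ENNReal.ofReal (M / N * ((2 * N + 1) * (ε / γ)))
      + ENNReal.ofReal |meanSpatialAverage g N G φ u v - c| := by
  have hmem := fun x : Box N => profile_box_mem_Icc hu hv x
  set φ' : Config ℓ → ℝ := fun ξ => truncate A (φ ξ) with hφ'
  set ψ : Config ℓ → ℝ := fun ξ => |φ ξ - φ' ξ| with hψ
  have hφ'A : ∀ ξ, |φ' ξ| ≤ A := fun ξ => abs_truncate_le hA _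
  have hGx : ∀ x ∈ centres N ℓ, |G ((x : ℝ) / N)| ≤ M := fun x hx =>
    hM _ (div_mem_Icc_of_mem_centres hx)
  have hN0 : (0 : ℝ) ≤ 1 / N := by positivity
  have h1 := tsum_mul_sum_shift_le (ℓ := ℓ) (N := N) hgpos (lam := fun x => profile N u v x)
    (fun x => ha₀.trans_le (hmem x).1) (fun x => (hmem x).2) hb₀ hp hp1 (ψ := ψ)
    (fun ξ => abs_nonneg _) hγ hε h
  have h2 := (tsum_mul_abs_le_of_sq (Y := fun η =>
    spatialAverage G φ' η - meanSpatialAverage g N G φ' u v) hp hp1 hδ).trans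
    (add_le_add_right (mul_le_mul_right (tsum_mul_sq_spatialAverage_sub_le (G := G) hgpos ha₀ hb₀
      hu hv hM0 hM hp hp1 hφ'A) _) _)
  have hs := hφ.summable hgpos hb₀
  have hs' : Summable fun ξ => prodProb g (fun _ => b₀) ξ * |φ' ξ| :=
    summable_mul_of_abs_le (fun ξ => (prodProb_pos hgpos (fun _ => hb₀) ξ).le)
      (tsum_prodProb hgpos fun _ => hb₀) fun ξ => by rw [abs_abs]; exact hφ'A ξ
  have h3 : |meanSpatialAverage g N G φ' u v - meanSpatialAverage g N G φ u v|
      ≤ M / N * ((2 * N + 1) * (ε / γ)) := by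
    unfold meanSpatialAverage
    rw [← mul_sub, ← Finset.sum_sub_distrib, abs_mul, abs_of_nonneg hN0]
    simp only [← mul_sub]
    have h4 : ∀ x ∈ centres N ℓ, |G ((x : ℝ) / N) *
        (localMean g φ' (fun z : Box ℓ => profile N u v (x + z))
          - localMean g φ (fun z : Box ℓ => profile N u v (x + z)))| ≤ M * (ε / γ) := fun x hx => by
      rw [abs_mul]
      refine mul_le_mul (hGx x hx) ?_ (abs_nonneg _) hM0
      refine abs_localMean_sub_le hgpos hb₀ hs hs'
        (fun z => ha₀.trans_le (profile_window_mem_Icc hu hv hx z).1)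
        (fun z => (profile_window_mem_Icc hu hv hx z).2) hγ hε ?_
      rwa [card_box]
    have h5 := (Finset.abs_sum_le_sum_abs _ _).trans (Finset.sum_le_sum h4)
    rw [Finset.sum_const, nsmul_eq_mul] at h5
    have h6 : ((centres N ℓ).card : ℝ) ≤ 2 * N + 1 := by exact_mod_cast card_centres_le N ℓ
    have h7 : 0 ≤ M * (ε / γ) := by positivity
    calc 1 / (N : ℝ) * _ ≤ 1 / N * ((2 * N + 1) * (M * (ε / γ))) := by
          refine mul_le_mul_of_nonneg_left (h5.trans ?_) hN0
          gcongr
      _ = _ := by ring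
  have hpt : ∀ η, ENNReal.ofReal (p η * |spatialAverage G φ η - c|) ≤
      ENNReal.ofReal (M / N) * ENNReal.ofReal (p η * ∑ x ∈ centres N ℓ, shift ψ x η)
      + ENNReal.ofReal (p η * |spatialAverage G φ' η - meanSpatialAverage g N G φ' u v|)
      + ENNReal.ofReal (p η) * ENNReal.ofReal (M / N * ((2 * N + 1) * (ε / γ)))
      + ENNReal.ofReal (p η) * ENNReal.ofReal |meanSpatialAverage g N G φ u v - c| := fun η => by
    have hp0 := hp η
    have hψ0 : 0 ≤ ∑ x ∈ centres N ℓ, shift ψ x η := Finset.sum_nonneg fun x _ => abs_nonneg _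
    rw [← ENNReal.ofReal_mul (by positivity), ← ENNReal.ofReal_mul hp0,
      ← ENNReal.ofReal_mul hp0, ← ENNReal.ofReal_add (by positivity) (by positivity),
      ← ENNReal.ofReal_add (by positivity) (by positivity),
      ← ENNReal.ofReal_add (by positivity) (by positivity)]
    refine ENNReal.ofReal_le_ofReal ?_
    have h4 : |spatialAverage G φ η - spatialAverage G φ' η|
        ≤ M / N * ∑ x ∈ centres N ℓ, shift ψ x η := by
      unfold spatialAverage
      rw [← mul_sub, ← Finset.sum_sub_distrib, abs_mul, abs_of_nonneg hN0]
      have h5 : |∑ x ∈ centres N ℓ, (G ((x : ℝ) / N) * shift φ x η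
          - G ((x : ℝ) / N) * shift φ' x η)| ≤ M * ∑ x ∈ centres N ℓ, shift ψ x η := by
        rw [Finset.mul_sum]
        refine (Finset.abs_sum_le_sum_abs _ _).trans (Finset.sum_le_sum fun x hx => ?_)
        rw [← mul_sub, abs_mul]
        exact mul_le_mul_of_nonneg_right (hGx x hx) (abs_nonneg _)
      calc 1 / (N : ℝ) * _ ≤ 1 / N * (M * ∑ x ∈ centres N ℓ, shift ψ x η) :=
            mul_le_mul_of_nonneg_left h5 hN0
        _ = _ := by ring
    have h6 : |spatialAverage G φ η - c| ≤ |spatialAverage G φ η - spatialAverage G φ' η|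
        + |spatialAverage G φ' η - meanSpatialAverage g N G φ' u v|
        + |meanSpatialAverage g N G φ' u v - meanSpatialAverage g N G φ u v|
        + |meanSpatialAverage g N G φ u v - c| := by
      have e : spatialAverage G φ η - c = (spatialAverage G φ η - spatialAverage G φ' η)
        + (spatialAverage G φ' η - meanSpatialAverage g N G φ' u v)
        + (meanSpatialAverage g N G φ' u v - meanSpatialAverage g N G φ u v)
        + (meanSpatialAverage g N G φ u v - c) := by ring
      rw [e]
      refine (abs_add_le _ _).trans (add_le_add ((abs_add_le _ _).trans
        (add_le_add (abs_add_le _ _) le_rfl)) le_rfl)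
    calc p η * |spatialAverage G φ η - c| ≤ p η * (M / N * ∑ x ∈ centres N ℓ, shift ψ x η
        + |spatialAverage G φ' η - meanSpatialAverage g N G φ' u v|
        + M / N * ((2 * N + 1) * (ε / γ)) + |meanSpatialAverage g N G φ u v - c|) := by
          refine mul_le_mul_of_nonneg_left (h6.trans ?_) hp0
          gcongr
      _ = _ := by ring
  refine (ENNReal.tsum_le_tsum hpt).trans ?_
  rw [ENNReal.tsum_add, ENNReal.tsum_add, ENNReal.tsum_add, ENNReal.tsum_mul_left,
    ENNReal.tsum_mul_right, ENNReal.tsum_mul_right, hp1, one_mul, one_mul]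
  gcongr
  exact h1


/-! ### Averages over time -/

theorem tendsto_zero_of_eventually_le_ofReal {X : Type*} {l : Filter X} {F : X → ℝ≥0∞}
    (h : ∀ ε : ℝ, 0 < ε → ∀ᶠ n in l, F n ≤ ENNReal.ofReal ε) : Tendsto F l (𝓝 0) := by
  rw [ENNReal.tendsto_nhds_zero]
  intro ε hε
  by_cases hε' : ε = ∞
  · subst hε'; simp
  · filter_upwards [h ε.toReal (ENNReal.toReal_pos hε.ne' hε')] with n hn
    rwa [ENNReal.ofReal_toReal hε'] at hn

theorem setLIntegral_Icc_const {T : ℝ} (c : ℝ≥0∞) :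
    ∫⁻ _ in Icc (0 : ℝ) T, c = c * ENNReal.ofReal T := by
  rw [setLIntegral_const, Real.volume_Icc, sub_zero]

theorem tendsto_ofReal_one_div : Tendsto (fun N : ℕ => ENNReal.ofReal (1 / (N : ℝ))) atTop (𝓝 0) := by
  rw [← ENNReal.ofReal_zero]
  exact ENNReal.tendsto_ofReal (tendsto_one_div_atTop_nhds_zero_nat (𝕜 := ℝ))

variable {g : ℕ → ℝ} {ℓ : ℕ} {a₀ b₀ T : ℝ} {aL aR : ℝ → ℝ}

/-- The relative entropy and the time integral of the Dirichlet form of the densities `p` with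
respect to the stationary product measures are of the orders `N` and `N ^ (-1 - α)`. -/
structure HasEntropyBounds (g : ℕ → ℝ) (α C T : ℝ) (aL aR : ℝ → ℝ)
    (p : ∀ N, ℝ → Config N → ℝ) : Prop where
  nonneg : ∀ N s η, 0 ≤ p N s η
  tsum_eq_one : ∀ N, 0 < N → ∀ s, ∑' η, ENNReal.ofReal (p N s η) = 1
  relEntropy_le : ∀ N, 0 < N → ∀ s ∈ Icc 0 T,
    relEntropy (p N s) (refProb g N (aL s) (aR s)) ≤ ENNReal.ofReal (C * N)
  lintegral_bondEnergy_le : ∀ N, 0 < N →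
    ∫⁻ s in Icc 0 T, ∑' ξ, ENNReal.ofReal (refProb g N (aL s) (aR s) ξ *
        bondEnergy (fun η => p N s η / refProb g N (aL s) (aR s) η) ξ)
      ≤ ENNReal.ofReal (C * N / (N : ℝ) ^ (2 + α))

/-- The total resampling distance between `p` and the stationary product measure. -/
noncomputable def totalResampling (g : ℕ → ℝ) (N : ℕ) (u v : ℝ) (p : Config N → ℝ) : ℝ≥0∞ :=
  ∑ z : Box N, resampling (fun η => ENNReal.ofReal (refProb g N u v η))
    (fun η => p η / refProb g N u v η) {z}

variable {α C : ℝ} {p : ∀ N, ℝ → Config N → ℝ}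

theorem HasEntropyBounds.lintegral_totalResampling_le (hp : HasEntropyBounds g α C T aL aR p)
    (hg0 : g 0 = 0) (hgpos : ∀ k, 0 < k → 0 < g k) {K : ℝ} (hK : ∀ k, |g (k + 1) - g k| ≤ K)
    (ha₀ : 0 < a₀) (hb₀ : b₀ ∈ fugacities g) {γ : ℝ} (hγ : 0 < γ)
    (hs : Summable (weight g (b₀ * Real.exp γ))) (hL : ∀ s ∈ Icc 0 T, aL s ∈ Icc a₀ b₀)
    (hR : ∀ s ∈ Icc 0 T, aR s ∈ Icc a₀ b₀) (hC : 0 ≤ C) (hT : 0 ≤ T) {C₁ : ℝ}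
    (hC₁ : C₁ = γ⁻¹ * (C + 3 * Real.log (partitionFn g (b₀ * Real.exp γ)))) {θ : ℝ} (hθ : 0 < θ)
    (m : ℕ) {N : ℕ} (hN : 0 < N) {c : ℝ}
    (hc : c = ∑ j ∈ Finset.range m, partitionFn g b₀ / weight g a₀ j) :
    ENNReal.ofReal (1 / N) * ∫⁻ s in Icc 0 T, totalResampling g N (aL s) (aR s) (p N s) ≤
      ENNReal.ofReal (c * (12 * θ⁻¹ * C) * (N : ℝ) ^ (-α)
        + T * (c * (θ * (K / a₀ * C₁ + 3)) + 2 * ((m + 1 : ℝ)⁻¹ * (C₁ + 3 * densityBound g b₀)))) := by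
  have hN1 : (1 : ℝ) ≤ N := by exact_mod_cast hN
  have hN0 : (0 : ℝ) < N := by linarith
  have hK0 : 0 ≤ K := (abs_nonneg _).trans (hK 0)
  have hZ := one_le_partitionFn hgpos (mul_nonneg hb₀.1.le (Real.exp_pos γ).le) hs
  have hZb := one_le_partitionFn hgpos hb₀.1.le (fugacities_summable hgpos hb₀)
  have hlog := Real.log_nonneg hZ
  have hC₁0 : 0 ≤ C₁ := by rw [hC₁]; positivity
  have hcj : ∀ j, 0 ≤ partitionFn g b₀ / weight g a₀ j := fun j =>
    div_nonneg (zero_le_one.trans hZb) (weight_nonneg hgpos ha₀.le j)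
  have hc0 : 0 ≤ c := hc ▸ Finset.sum_nonneg fun j _ => hcj j
  have hR0 : 0 ≤ densityBound g b₀ := mul_nonneg (zero_le_one.trans hZb)
    (tsum_nonneg fun k => mul_nonneg (siteProb_pos hgpos hb₀ k).le k.cast_nonneg)
  have hcE : ∑ j ∈ Finset.range m, ENNReal.ofReal (partitionFn g b₀ / weight g a₀ j)
      = ENNReal.ofReal c := by
    rw [hc, ENNReal.ofReal_sum_of_nonneg fun j _ => hcj j]
  set D : ℝ → ℝ≥0∞ := fun s => ∑' ξ, ENNReal.ofReal (refProb g N (aL s) (aR s) ξ *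
        bondEnergy (fun η => p N s η / refProb g N (aL s) (aR s) η) ξ) with hD
  have hpt : ∀ s ∈ Icc 0 T, totalResampling g N (aL s) (aR s) (p N s) ≤
      ENNReal.ofReal (c * (12 * N ^ 2 * θ⁻¹)) * D s
        + ENNReal.ofReal (N * (c * (θ * (K / a₀ * C₁ + 3))
          + 2 * ((m + 1 : ℝ)⁻¹ * (C₁ + 3 * densityBound g b₀)))) := fun s hs' => by
    have h1 := sum_resampling_singleton_le hg0 hgpos hK ha₀ hb₀ (hL s hs') (hR s hs')
      (hp.nonneg N s) (hp.tsum_eq_one N hN s) hθ m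
    have hmem := fun x : Box N => profile_box_mem_Icc (hL s hs') (hR s hs') x
    have h2 : ∑' η, ENNReal.ofReal (p N s η * ∑ x, (η x : ℝ)) ≤ ENNReal.ofReal (C₁ * N) := by
      refine (tsum_mul_sum_le hgpos hγ (lam := fun x : Box N => profile N (aL s) (aR s) x)
        (fun x => fugacities_ordConnected ha₀ hb₀ (hmem x)) (fun x => (hmem x).2) hb₀.1 hs
        (hp.nonneg N s) (hp.tsum_eq_one N hN s)).trans ?_
      refine (mul_le_mul_right (add_le_add_left (hp.relEntropy_le N hN s hs') _) _).trans ?_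
      rw [card_box, ← ENNReal.ofReal_add (by positivity) (by positivity),
        ← ENNReal.ofReal_mul (by positivity)]
      refine ENNReal.ofReal_le_ofReal ?_
      rw [hC₁, mul_assoc γ⁻¹]
      gcongr
      push_cast
      nlinarith
    refine h1.trans ?_
    rw [hcE]
    calc _ ≤ ENNReal.ofReal c * (ENNReal.ofReal (12 * N ^ 2 * θ⁻¹) * D s
            + ENNReal.ofReal (θ * (K / a₀)) * ENNReal.ofReal (C₁ * N) + ENNReal.ofReal (3 * N * θ))
          + ENNReal.ofReal 2 * (ENNReal.ofReal ((m + 1 : ℝ)⁻¹) * (ENNReal.ofReal (C₁ * N)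
            + ENNReal.ofReal (3 * N * densityBound g b₀))) := by
          rw [ENNReal.ofReal_ofNat]
          have e1 : (2 * (N : ℝ) + 1) ≤ 3 * N := by linarith
          have e2 : (2 * (N : ℝ) + 1) * ((2 * N + 2) * θ⁻¹) ≤ 12 * N ^ 2 * θ⁻¹ := by
            rw [← mul_assoc]
            have : (2 * (N : ℝ) + 1) * (2 * N + 2) ≤ 12 * N ^ 2 := by nlinarith
            gcongr
          refine add_le_add (mul_le_mul' le_rfl (add_le_add (add_le_add (mul_le_mul'
            (ENNReal.ofReal_le_ofReal e2) le_rfl) (mul_le_mul' le_rfl h2)) ?_)) ?_ <;> gcongr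
      _ = _ := by
          rw [← ENNReal.ofReal_mul (by positivity), add_assoc,
            ← ENNReal.ofReal_add (by positivity) (by positivity),
            ← ENNReal.ofReal_add (by positivity) (by positivity),
            ← ENNReal.ofReal_mul (by positivity), ← ENNReal.ofReal_mul (by positivity), mul_add,
            ← ENNReal.ofReal_mul hc0, ← mul_assoc, ← ENNReal.ofReal_mul hc0, add_assoc,
            ← ENNReal.ofReal_add (by positivity) (by positivity)]
          congr 2
          ring
  calc ENNReal.ofReal (1 / N) * ∫⁻ s in Icc 0 T, totalResampling g N (aL s) (aR s) (p N s)
      ≤ ENNReal.ofReal (1 / N) * (ENNReal.ofReal (c * (12 * N ^ 2 * θ⁻¹)) *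
          ENNReal.ofReal (C * N / (N : ℝ) ^ (2 + α))
        + ENNReal.ofReal (N * (c * (θ * (K / a₀ * C₁ + 3))
          + 2 * ((m + 1 : ℝ)⁻¹ * (C₁ + 3 * densityBound g b₀)))) * ENNReal.ofReal T) := by
        gcongr
        refine (setLIntegral_mono' measurableSet_Icc hpt).trans ?_
        rw [lintegral_add_right _ measurable_const, setLIntegral_Icc_const,
          lintegral_const_mul' _ _ ENNReal.ofReal_ne_top]
        gcongr
        exact hp.lintegral_bondEnergy_le N hN
    _ = _ := by
        have hpow : (0 : ℝ) < (N : ℝ) ^ (2 + α) := Real.rpow_pos_of_pos hN0 _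
        rw [← ENNReal.ofReal_mul (by positivity), ← ENNReal.ofReal_mul (by positivity),
          ← ENNReal.ofReal_add (by positivity) (by positivity), ← ENNReal.ofReal_mul (by positivity)]
        congr 1
        have e : (N : ℝ) ^ (-α) = N ^ 2 / (N : ℝ) ^ (2 + α) := by
          rw [Real.rpow_add hN0, Real.rpow_neg hN0.le, Real.rpow_two]
          field_simp
        rw [e]
        field_simp

theorem HasEntropyBounds.tendsto_totalResampling (hp : HasEntropyBounds g α C T aL aR p)
    (hα : 0 < α)
    (hg0 : g 0 = 0) (hgpos : ∀ k, 0 < k → 0 < g k) {K : ℝ} (hK : ∀ k, |g (k + 1) - g k| ≤ K)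
    (ha₀ : 0 < a₀) (hb₀ : b₀ ∈ fugacities g) {γ : ℝ} (hγ : 0 < γ)
    (hs : Summable (weight g (b₀ * Real.exp γ))) (hL : ∀ s ∈ Icc 0 T, aL s ∈ Icc a₀ b₀)
    (hR : ∀ s ∈ Icc 0 T, aR s ∈ Icc a₀ b₀) (hC : 0 ≤ C) (hT : 0 ≤ T) :
    Tendsto (fun N : ℕ => ENNReal.ofReal (1 / N) *
      ∫⁻ s in Icc 0 T, totalResampling g N (aL s) (aR s) (p N s)) atTop (𝓝 0) := by
  refine tendsto_zero_of_eventually_le_ofReal fun ε hε => ?_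
  set C₁ := γ⁻¹ * (C + 3 * Real.log (partitionFn g (b₀ * Real.exp γ))) with hC₁
  obtain ⟨m, hm⟩ : ∃ m : ℕ, T * (2 * ((m + 1 : ℝ)⁻¹ * (C₁ + 3 * densityBound g b₀))) < ε / 3 := by
    have h1 : Tendsto (fun m : ℕ => T * (2 * (1 / ((m : ℝ) + 1) * (C₁ + 3 * densityBound g b₀))))
        atTop (𝓝 (T * (2 * (0 * (C₁ + 3 * densityBound g b₀))))) :=
      ((tendsto_one_div_add_atTop_nhds_zero_nat.mul_const _).const_mul _).const_mul _
    simp only [zero_mul, mul_zero, one_div] at h1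
    exact (h1.eventually_lt_const (by positivity : 0 < ε / 3)).exists
  set c := ∑ j ∈ Finset.range m, partitionFn g b₀ / weight g a₀ j with hc
  obtain ⟨θ, hθ, hθε⟩ : ∃ θ : ℝ, 0 < θ ∧ T * (c * (θ * (K / a₀ * C₁ + 3))) < ε / 3 := by
    have h1 : Tendsto (fun θ : ℝ => T * (c * (θ * (K / a₀ * C₁ + 3)))) (𝓝[>] 0)
        (𝓝 (T * (c * (0 * (K / a₀ * C₁ + 3))))) :=
      Tendsto.mono_left (Continuous.tendsto (by fun_prop) 0) nhdsWithin_le_nhds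
    simp only [zero_mul, mul_zero] at h1
    obtain ⟨θ, h2, h3⟩ :=
      ((h1.eventually_lt_const (by positivity : 0 < ε / 3)).and self_mem_nhdsWithin).exists
    exact ⟨θ, h3, h2⟩
  have h1 : Tendsto (fun N : ℕ => c * (12 * θ⁻¹ * C) * (N : ℝ) ^ (-α)) atTop (𝓝 0) := by
    simpa using ((tendsto_rpow_neg_atTop hα).comp tendsto_natCast_atTop_atTop).const_mul
      (c * (12 * θ⁻¹ * C))
  filter_upwards [h1.eventually_lt_const (by positivity : 0 < ε / 3), eventually_gt_atTop 0]
    with N h2 hN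
  refine (hp.lintegral_totalResampling_le hg0 hgpos hK ha₀ hb₀ hγ hs hL hR hC hT hC₁ hθ m hN
    hc).trans (ENNReal.ofReal_le_ofReal ?_)
  rw [mul_add]
  linarith

/-! ### Riemann sums, uniformly in time -/

theorem aemeasurable_meanSpatialAverage (hgpos : ∀ k, 0 < k → 0 < g k) (ha₀ : 0 < a₀)
    (hb₀ : b₀ ∈ fugacities g) (hL : ∀ s ∈ Icc 0 T, aL s ∈ Icc a₀ b₀)
    (hR : ∀ s ∈ Icc 0 T, aR s ∈ Icc a₀ b₀) (hLc : ContinuousOn aL (Icc 0 T))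
    (hRc : ContinuousOn aR (Icc 0 T)) {φ : Config ℓ → ℝ} (hφ : HasExpMoments g φ) (G : ℝ → ℝ)
    (N : ℕ) : AEMeasurable (fun s => meanSpatialAverage g N G φ (aL s) (aR s))
      (volume.restrict (Icc 0 T)) := by
  refine ContinuousOn.aemeasurable (ContinuousOn.mul continuousOn_const
    (continuousOn_finsetSum _ fun x hx => ContinuousOn.mul continuousOn_const fun s hs' => ?_))
    measurableSet_Icc
  refine tendsto_localMean hgpos hb₀ (hφ.summable hgpos hb₀) ?_ (fun z => fugacities_ordConnected
    ha₀ hb₀ (profile_window_mem_Icc (hL s hs') (hR s hs') hx z)) fun z => ?_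
  · filter_upwards [self_mem_nhdsWithin] with r hr z
    have := profile_window_mem_Icc (hL r hr) (hR r hr) hx z
    exact ⟨ha₀.trans_le this.1, this.2⟩
  · have h1 := hLc s hs'
    have h2 := hRc s hs'
    have : ContinuousWithinAt (fun r => profile N (aL r) (aR r) (x + z)) (Icc 0 T) s := by
      unfold profile interp; fun_prop
    exact this

theorem aemeasurable_integral_localAverage (hgpos : ∀ k, 0 < k → 0 < g k) (ha₀ : 0 < a₀)
    (hb₀ : b₀ ∈ fugacities g) (hL : ∀ s ∈ Icc 0 T, aL s ∈ Icc a₀ b₀)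
    (hR : ∀ s ∈ Icc 0 T, aR s ∈ Icc a₀ b₀) (hLc : ContinuousOn aL (Icc 0 T))
    (hRc : ContinuousOn aR (Icc 0 T)) {φ : Config ℓ → ℝ}
    (hφ : HasExpMoments g φ) {G : ℝ → ℝ} (hG : IsTestFunction G) {c : ℝ → ℝ}
    (hc : ∀ s ∈ Icc 0 T,
      c s = ∫ y in (-1 : ℝ)..1, G y * localAverage g φ (interp (aL s) (aR s) y)) :
    AEMeasurable c (volume.restrict (Icc 0 T)) := by
  refine aemeasurable_of_tendsto_metrizable_ae atTop (aemeasurable_meanSpatialAverage hgpos ha₀ hb₀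
    hL hR hLc hRc hφ G) ((ae_restrict_mem measurableSet_Icc).mono fun s hs' => ?_)
  rw [hc s hs']
  exact tendsto_meanSpatialAverage hgpos ha₀ hb₀ (hL s hs') (hR s hs') hφ hG

theorem tendsto_lintegral_meanSpatialAverage (hgpos : ∀ k, 0 < k → 0 < g k) (ha₀ : 0 < a₀)
    (hb₀ : b₀ ∈ fugacities g) (hL : ∀ s ∈ Icc 0 T, aL s ∈ Icc a₀ b₀)
    (hR : ∀ s ∈ Icc 0 T, aR s ∈ Icc a₀ b₀) (hLc : ContinuousOn aL (Icc 0 T))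
    (hRc : ContinuousOn aR (Icc 0 T)) {φ : Config ℓ → ℝ}
    (hφ : HasExpMoments g φ) {G : ℝ → ℝ} (hG : IsTestFunction G) {c : ℝ → ℝ}
    (hc : ∀ s ∈ Icc 0 T,
      c s = ∫ y in (-1 : ℝ)..1, G y * localAverage g φ (interp (aL s) (aR s) y)) :
    (∀ N, AEMeasurable (fun s => ENNReal.ofReal |meanSpatialAverage g N G φ (aL s) (aR s) - c s|)
      (volume.restrict (Icc 0 T))) ∧
    Tendsto (fun N : ℕ => ∫⁻ s in Icc 0 T,
      ENNReal.ofReal |meanSpatialAverage g N G φ (aL s) (aR s) - c s|) atTop (𝓝 0) := by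
  obtain ⟨M, hM⟩ := hG.bounded
  have hM0 : 0 ≤ M := (abs_nonneg _).trans (hM 0 (by simp))
  have hs := hφ.summable hgpos hb₀
  have hlim : ∀ s ∈ Icc 0 T, Tendsto (fun N => meanSpatialAverage g N G φ (aL s) (aR s)) atTop
      (𝓝 (c s)) := fun s hs' => by
    rw [hc s hs']
    exact tendsto_meanSpatialAverage hgpos ha₀ hb₀ (hL s hs') (hR s hs') hφ hG
  have hm : ∀ N, AEMeasurable (fun s => ENNReal.ofReal
      |meanSpatialAverage g N G φ (aL s) (aR s) - c s|) (volume.restrict (Icc 0 T)) := fun N =>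
    (measurable_abs.comp_aemeasurable ((aemeasurable_meanSpatialAverage hgpos ha₀ hb₀
      hL hR hLc hRc hφ G N).sub (aemeasurable_integral_localAverage hgpos ha₀ hb₀
      hL hR hLc hRc hφ hG hc))).ennreal_ofReal
  refine ⟨hm, ?_⟩
  set B := 3 * (M * (partitionFn g b₀ ^ Fintype.card (Box ℓ) *
    ∑' ξ, prodProb g (fun _ => b₀) ξ * |φ ξ|)) with hB
  have hbd : ∀ s ∈ Icc 0 T, ∀ N, |meanSpatialAverage g N G φ (aL s) (aR s)| ≤ B := fun s hs' N => by
    have hx : ∀ x ∈ centres N ℓ, |G ((x : ℝ) / N) * localMean g φ fun z : Box ℓ =>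
        profile N (aL s) (aR s) (x + z)| ≤ B / 3 := fun x hx => by
      rw [abs_mul, hB, mul_div_cancel_left₀ _ three_ne_zero]
      refine mul_le_mul (hM _ (div_mem_Icc_of_mem_centres hx)) ?_ (abs_nonneg _) hM0
      exact abs_localMean_le hgpos hb₀ hs
        (fun z => ha₀.trans_le (profile_window_mem_Icc (hL s hs') (hR s hs') hx z).1)
        (fun z => (profile_window_mem_Icc (hL s hs') (hR s hs') hx z).2)
    have hB0 : 0 ≤ B := by
      have hZ : 0 ≤ partitionFn g b₀ := zero_le_one.trans
        (one_le_partitionFn hgpos hb₀.1.le (fugacities_summable hgpos hb₀))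
      have : 0 ≤ ∑' ξ, prodProb g (fun _ => b₀) ξ * |φ ξ| := tsum_nonneg fun ξ =>
        mul_nonneg (prodProb_pos hgpos (fun _ => hb₀) ξ).le (abs_nonneg _)
      positivity
    have h5 := (Finset.abs_sum_le_sum_abs _ _).trans (Finset.sum_le_sum hx)
    rw [Finset.sum_const, nsmul_eq_mul] at h5
    have h6 : ((centres N ℓ).card : ℝ) ≤ 2 * N + 1 := by exact_mod_cast card_centres_le N ℓ
    have h7 : 1 / (N : ℝ) * (2 * N + 1) ≤ 3 := by
      rcases N.eq_zero_or_pos with rfl | hN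
      · simp
      · have : (1 : ℝ) ≤ N := by exact_mod_cast hN
        rw [div_mul_eq_mul_div, div_le_iff₀ (by linarith)]
        linarith
    unfold meanSpatialAverage
    rw [abs_mul, abs_of_nonneg (by positivity : (0 : ℝ) ≤ 1 / N)]
    calc 1 / (N : ℝ) * _ ≤ 1 / N * ((2 * N + 1) * (B / 3)) := by
          refine mul_le_mul_of_nonneg_left (h5.trans ?_) (by positivity)
          gcongr
      _ = (1 / N * (2 * N + 1)) * (B / 3) := by ring
      _ ≤ 3 * (B / 3) := by gcongr
      _ = B := by ring
  have h := tendsto_lintegral_of_dominated_convergence' (μ := volume.restrict (Icc 0 T))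
    (f := fun _ => 0) (fun _ => ENNReal.ofReal (2 * B)) hm (fun N => ?_) ?_ ?_
  · simpa using h
  · filter_upwards [ae_restrict_mem measurableSet_Icc] with s hs'
    refine ENNReal.ofReal_le_ofReal ?_
    have h1 := hbd s hs' N
    have h2 : |c s| ≤ B := le_of_tendsto (hlim s hs').abs (Eventually.of_forall (hbd s hs'))
    have h3 := abs_sub (meanSpatialAverage g N G φ (aL s) (aR s)) (c s)
    linarith
  · rw [setLIntegral_Icc_const]
    exact ENNReal.mul_ne_top ENNReal.ofReal_ne_top ENNReal.ofReal_ne_top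
  · filter_upwards [ae_restrict_mem measurableSet_Icc] with s hs'
    have h1 := ((hlim s hs').sub_const (c s)).abs
    rw [sub_self, abs_zero] at h1
    simpa using ENNReal.tendsto_ofReal h1

/-! ### Local equilibrium from the entropy bounds -/

theorem HasEntropyBounds.tendsto_spatialAverage (hp : HasEntropyBounds g α C T aL aR p)
    (hα : 0 < α)
    (hg0 : g 0 = 0) (hgpos : ∀ k, 0 < k → 0 < g k) {K : ℝ} (hK : ∀ k, |g (k + 1) - g k| ≤ K)
    (ha₀ : 0 < a₀) (hb₀ : b₀ ∈ fugacities g) {γ₀ : ℝ} (hγ₀ : 0 < γ₀)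
    (hs : Summable (weight g (b₀ * Real.exp γ₀))) (hL : ∀ s ∈ Icc 0 T, aL s ∈ Icc a₀ b₀)
    (hR : ∀ s ∈ Icc 0 T, aR s ∈ Icc a₀ b₀) (hLc : ContinuousOn aL (Icc 0 T))
    (hRc : ContinuousOn aR (Icc 0 T)) (hC : 0 ≤ C) (hT : 0 ≤ T) {φ : Config ℓ → ℝ}
    (hφ : HasExpMoments g φ) {G : ℝ → ℝ} (hG : IsTestFunction G) {c : ℝ → ℝ}
    (hc : ∀ s ∈ Icc 0 T,
      c s = ∫ y in (-1 : ℝ)..1, G y * localAverage g φ (interp (aL s) (aR s) y)) :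
    Tendsto (fun N : ℕ => ∫⁻ s in Icc 0 T, ∑' η,
      ENNReal.ofReal (p N s η * |spatialAverage G φ η - c s|)) atTop (𝓝 0) := by
  obtain ⟨M, hM⟩ := hG.bounded
  have hM0 : 0 ≤ M := (abs_nonneg _).trans (hM 0 (by simp))
  obtain ⟨hRm, hRt⟩ := tendsto_lintegral_meanSpatialAverage hgpos ha₀ hb₀ hL hR hLc hRc hφ hG hc
  have hres := hp.tendsto_totalResampling hα hg0 hgpos hK ha₀ hb₀ hγ₀ hs hL hR hC hT
  refine tendsto_zero_of_eventually_le_ofReal fun ε hε => ?_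
  set X := T * (M * ((2 * ℓ + 1) * C + 6)) with hX
  have hX0 : 0 ≤ X := by positivity
  set γ := 4 * (X + 1) / ε with hγdef
  have hγ : 0 < γ := by positivity
  set δ := ε / (4 * (T + 1)) with hδdef
  have hδ : 0 < δ := by positivity
  obtain ⟨A, hA⟩ : ∃ A : ℕ, ENNReal.ofReal (partitionFn g b₀ ^ (2 * ℓ + 1)) * ∑' ξ : Config ℓ,
      ENNReal.ofReal (prodProb g (fun _ => b₀) ξ) *
        ENNReal.ofReal (Real.exp (γ * |φ ξ - truncate A (φ ξ)|) - 1) ≤ ENNReal.ofReal 1 := by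
    have h1 := ENNReal.Tendsto.const_mul (a := ENNReal.ofReal (partitionFn g b₀ ^ (2 * ℓ + 1)))
      (hφ.tendsto_truncate hgpos hb₀ hγ) (Or.inr ENNReal.ofReal_ne_top)
    rw [mul_zero] at h1
    exact (h1.eventually_le_const (by simp)).exists
  set κ := δ⁻¹ * (3 * (M * (2 * A)) ^ 2) with hκ
  have hκ0 : 0 ≤ κ := by positivity
  set Q : ℕ → ℝ≥0∞ := fun N => ENNReal.ofReal κ *
    ((4 * ℓ + 1 : ℕ) * ENNReal.ofReal T * ENNReal.ofReal (1 / (N : ℝ))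
      + 4 * (2 * ℓ + 1 : ℕ) * (ENNReal.ofReal (1 / (N : ℝ)) *
        ∫⁻ s in Icc 0 T, totalResampling g N (aL s) (aR s) (p N s))) with hQ
  have hQt : Tendsto Q atTop (𝓝 0) := by
    have h1 := ENNReal.Tendsto.const_mul (a := ((4 * ℓ + 1 : ℕ) : ℝ≥0∞) * ENNReal.ofReal T)
      tendsto_ofReal_one_div
      (Or.inr (ENNReal.mul_ne_top (ENNReal.natCast_ne_top _) ENNReal.ofReal_ne_top))
    have h2 := ENNReal.Tendsto.const_mul (a := 4 * ((2 * ℓ + 1 : ℕ) : ℝ≥0∞)) hres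
      (Or.inr (ENNReal.mul_ne_top (by simp) (ENNReal.natCast_ne_top _)))
    have h3 := ENNReal.Tendsto.const_mul (a := ENNReal.ofReal κ) (h1.add h2)
      (Or.inr ENNReal.ofReal_ne_top)
    rwa [mul_zero, mul_zero, add_zero, mul_zero] at h3
  have hε4 : (0 : ℝ≥0∞) < ENNReal.ofReal (ε / 4) := ENNReal.ofReal_pos.2 (by positivity)
  filter_upwards [hQt.eventually_le_const hε4, hRt.eventually_le_const hε4, eventually_gt_atTop 0]
    with N h1 h2 hN
  have hN1 : (1 : ℝ) ≤ N := by exact_mod_cast hN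
  have hN0 : (0 : ℝ) < N := by linarith
  have h3N : (2 * (N : ℝ) + 1) ≤ 3 * N := by linarith
  have hpt : ∀ s ∈ Icc 0 T, ∑' η, ENNReal.ofReal (p N s η * |spatialAverage G φ η - c s|) ≤
      ENNReal.ofReal (M * ((2 * ℓ + 1) * C + 6) / γ + δ)
        + ENNReal.ofReal κ * ENNReal.ofReal (1 / N) * ((4 * ℓ + 1 : ℕ) + 4 * (2 * ℓ + 1 : ℕ) *
          totalResampling g N (aL s) (aR s) (p N s))
        + ENNReal.ofReal |meanSpatialAverage g N G φ (aL s) (aR s) - c s| := fun s hs' => by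
    refine (tsum_mul_abs_spatialAverage_sub_le hgpos ha₀ hb₀ (hL s hs') (hR s hs') hM0 hM
      (hp.nonneg N s) (hp.tsum_eq_one N hN s) hφ A.cast_nonneg hγ zero_le_one hδ hA (c s)).trans ?_
    have e1 : ENNReal.ofReal (M / N) * (ENNReal.ofReal γ⁻¹ * ((2 * ℓ + 1) *
        relEntropy (p N s) (refProb g N (aL s) (aR s)) + ENNReal.ofReal (1 * (2 * N + 1))))
        ≤ ENNReal.ofReal (M * ((2 * ℓ + 1) * C + 3) / γ) := by
      have e : (2 * ℓ + 1 : ℝ≥0∞) = ENNReal.ofReal (2 * ℓ + 1) := by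
        rw [ENNReal.ofReal_add (by positivity) zero_le_one, ENNReal.ofReal_mul zero_le_two,
          ENNReal.ofReal_ofNat, ENNReal.ofReal_natCast, ENNReal.ofReal_one]
      calc _ ≤ ENNReal.ofReal (M / N) * (ENNReal.ofReal γ⁻¹ * (ENNReal.ofReal (2 * ℓ + 1) *
            ENNReal.ofReal (C * N) + ENNReal.ofReal (3 * N))) := by
            rw [e]
            have e' : 1 * (2 * (N : ℝ) + 1) ≤ 3 * N := by linarith
            exact mul_le_mul' le_rfl (mul_le_mul' le_rfl (add_le_add (mul_le_mul' le_rfl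
              (hp.relEntropy_le N hN s hs')) (ENNReal.ofReal_le_ofReal e')))
        _ = _ := by
            rw [← ENNReal.ofReal_mul (by positivity),
              ← ENNReal.ofReal_add (by positivity) (by positivity),
              ← ENNReal.ofReal_mul (by positivity), ← ENNReal.ofReal_mul (by positivity)]
            congr 1
            field_simp
    have e2 : ENNReal.ofReal (M / N * ((2 * N + 1) * (1 / γ))) ≤ ENNReal.ofReal (3 * M / γ) := by
      refine ENNReal.ofReal_le_ofReal ?_
      calc M / N * ((2 * N + 1) * (1 / γ)) ≤ M / N * (3 * N * (1 / γ)) := by gcongr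
        _ = _ := by field_simp
    have e3 : ∀ Y : ℝ≥0∞, ENNReal.ofReal δ⁻¹ * (ENNReal.ofReal (1 / (N : ℝ) ^ 2) *
        (ENNReal.ofReal ((M * (2 * A)) ^ 2 * (2 * N + 1)) * Y))
        ≤ ENNReal.ofReal κ * ENNReal.ofReal (1 / N) * Y := fun Y => by
      rw [← mul_assoc, ← mul_assoc, ← ENNReal.ofReal_mul (by positivity),
        ← ENNReal.ofReal_mul (by positivity), ← ENNReal.ofReal_mul (by positivity)]
      refine mul_le_mul' (ENNReal.ofReal_le_ofReal ?_) le_rfl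
      calc δ⁻¹ * (1 / (N : ℝ) ^ 2) * ((M * (2 * A)) ^ 2 * (2 * N + 1))
          ≤ δ⁻¹ * (1 / (N : ℝ) ^ 2) * ((M * (2 * A)) ^ 2 * (3 * N)) := by gcongr
        _ = κ * (1 / N) := by rw [hκ]; field_simp
    have e4 : ENNReal.ofReal (M * ((2 * ℓ + 1) * C + 6) / γ + δ)
        = ENNReal.ofReal (M * ((2 * ℓ + 1) * C + 3) / γ) + ENNReal.ofReal δ
          + ENNReal.ofReal (3 * M / γ) := by
      rw [← ENNReal.ofReal_add (by positivity) (by positivity),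
        ← ENNReal.ofReal_add (by positivity) (by positivity)]
      congr 1
      ring
    refine add_le_add ?_ le_rfl
    refine (add_le_add (add_le_add e1 (add_le_add le_rfl (e3 _))) e2).trans (le_of_eq ?_)
    rw [e4, totalResampling]
    ring
  refine (setLIntegral_mono' measurableSet_Icc hpt).trans ?_
  rw [lintegral_add_right' _ (hRm N), lintegral_add_left measurable_const, setLIntegral_Icc_const,
    lintegral_const_mul' _ _ (ENNReal.mul_ne_top ENNReal.ofReal_ne_top ENNReal.ofReal_ne_top),
    lintegral_add_left measurable_const, setLIntegral_Icc_const, lintegral_const_mul' _ _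
      (ENNReal.mul_ne_top (by simp) (ENNReal.natCast_ne_top _))]
  have e5 : ENNReal.ofReal κ * ENNReal.ofReal (1 / N) * ((4 * ℓ + 1 : ℕ) * ENNReal.ofReal T
      + 4 * (2 * ℓ + 1 : ℕ) * ∫⁻ s in Icc 0 T, totalResampling g N (aL s) (aR s) (p N s)) = Q N := by
    rw [hQ]
    ring
  have e6 : ENNReal.ofReal (M * ((2 * ℓ + 1) * C + 6) / γ + δ) * ENNReal.ofReal T
      ≤ ENNReal.ofReal (ε / 2) := by
    rw [← ENNReal.ofReal_mul (by positivity)]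
    refine ENNReal.ofReal_le_ofReal ?_
    have e7 : M * ((2 * ℓ + 1) * C + 6) / γ * T = X / γ := by rw [hX]; ring
    have e8 : X / γ ≤ ε / 4 := by
      rw [hγdef, div_div_eq_mul_div, div_le_iff₀ (by positivity)]
      nlinarith
    have e9 : δ * T ≤ ε / 4 := by
      rw [hδdef, div_mul_eq_mul_div, div_le_iff₀ (by positivity)]
      nlinarith
    rw [add_mul, e7]
    linarith
  rw [e5]
  refine (add_le_add (add_le_add e6 h1) h2).trans (le_of_eq ?_)
  rw [← ENNReal.ofReal_add (by positivity) (by positivity),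
    ← ENNReal.ofReal_add (by positivity) (by positivity)]
  congr 1
  ring


/-! ### The zero-range process -/

variable {g : ℕ → ℝ} {α : ℝ} {lamL lamR : ℝ → ℝ}

theorem IsZeroRangeProcess.isForwardSolution {N : ℕ} {Ω : Type*} [MeasurableSpace Ω] {P : Measure Ω}
    [IsProbabilityMeasure P] {η : ℝ≥0 → Ω → Config N}
    (hη : IsZeroRangeProcess g α lamL lamR N P η) {aL aR : ℝ → ℝ} (haL : Continuous aL)
    (haR : Continuous aR) (hL : ∀ r, 0 ≤ r → aL r = lamL r) (hR : ∀ r, 0 ≤ r → aR r = lamR r) :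
    IsForwardSolution g α aL aR (law P η) where
  nonneg := law_nonneg P η
  tsum_eq_one s := tsum_law P η s (hη.measurable _)
  continuous ζ := hη.continuous_law haL haR hL hR ζ
  hasDerivWithinAt ζ _ hs := hη.hasDerivWithinAt_law haL haR hL hR ζ hs

theorem exists_mem_Icc_of_continuousOn {u v : ℝ → ℝ} {T : ℝ} (hT : 0 ≤ T)
    (hu : ∀ s ∈ Icc 0 T, u s ∈ fugacities g) (hv : ∀ s ∈ Icc 0 T, v s ∈ fugacities g)
    (huc : ContinuousOn u (Icc 0 T)) (hvc : ContinuousOn v (Icc 0 T)) :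
    ∃ a₀ b₀, 0 < a₀ ∧ b₀ ∈ fugacities g ∧ (∀ s ∈ Icc 0 T, u s ∈ Icc a₀ b₀) ∧
      ∀ s ∈ Icc 0 T, v s ∈ Icc a₀ b₀ := by
  have hne : (Icc 0 T).Nonempty := nonempty_Icc.2 hT
  obtain ⟨s₁, h₁, hs₁⟩ := isCompact_Icc.exists_isMinOn hne huc
  obtain ⟨s₂, h₂, hs₂⟩ := isCompact_Icc.exists_isMaxOn hne huc
  obtain ⟨s₃, h₃, hs₃⟩ := isCompact_Icc.exists_isMinOn hne hvc
  obtain ⟨s₄, h₄, hs₄⟩ := isCompact_Icc.exists_isMaxOn hne hvc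
  refine ⟨min (u s₁) (v s₃), max (u s₂) (v s₄), lt_min (hu s₁ h₁).1 (hv s₃ h₃).1, ?_,
    fun s hs => ⟨(min_le_left _ _).trans (hs₁ hs), (hs₂ hs).trans (le_max_left _ _)⟩,
    fun s hs => ⟨(min_le_right _ _).trans (hs₃ hs), (hs₄ hs).trans (le_max_right _ _)⟩⟩
  rcases max_choice (u s₂) (v s₄) with h | h <;> rw [h]
  exacts [hu s₂ h₂, hv s₄ h₄]

theorem exists_summable_mul_exp {b₀ : ℝ} (hb₀ : b₀ ∈ fugacities g) :
    ∃ γ, 0 < γ ∧ Summable (weight g (b₀ * Real.exp γ)) := by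
  obtain ⟨h0, l, hl, hs⟩ := hb₀
  refine ⟨Real.log (l / b₀), Real.log_pos ((one_lt_div h0).2 hl), ?_⟩
  rwa [Real.exp_log (div_pos (h0.trans hl) h0), mul_div_cancel₀ _ h0.ne']

theorem relEntropy_refProb_le_of_klDiv_le (hgpos : ∀ k, 0 < k → 0 < g k) {a₀ b₀ γ : ℝ}
    (ha₀ : 0 < a₀) (hb₀ : b₀ ∈ fugacities g) (hγ : 0 < γ)
    (hs : Summable (weight g (b₀ * Real.exp γ))) {u v : ℝ} (hu : u ∈ Icc a₀ b₀)
    (hv : v ∈ Icc a₀ b₀) {N : ℕ} (hN : 0 < N) {μ : Measure (Config N)} [IsProbabilityMeasure μ]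
    {C : ℝ} (hC : 0 ≤ C)
    (h : InformationTheory.klDiv μ (refMeasure g N u v) ≤ ENNReal.ofReal (C * N)) :
    relEntropy (fun η => μ.real {η}) (refProb g N u v) ≤ ENNReal.ofReal ((C + (Real.log (b₀ / a₀) *
      (γ⁻¹ * (C + 3 * Real.log (partitionFn g (b₀ * Real.exp γ))))
      + 3 * Real.log (partitionFn g b₀))) * N) := by
  have hN1 : (1 : ℝ) ≤ N := by exact_mod_cast hN
  have hab : a₀ ≤ b₀ := hu.1.trans hu.2
  have hmem : ∀ x : Box N, interp u v (((x : ℤ) : ℝ) / N) ∈ Icc a₀ b₀ := fun x =>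
    interp_mem_Icc hu hv (div_mem_Icc_of_mem_centres (ℓ := 0) (by have := x.2; rw [Finset.mem_Icc] at this ⊢; push_cast; omega))
  have hf := fun x => fugacities_ordConnected ha₀ hb₀ (hmem x)
  have hprob := fun x => isProbabilityMeasure_siteMeasure hgpos (hf x)
  have : IsProbabilityMeasure (refMeasure g N u v) := by unfold refMeasure; infer_instance
  have hsing : ∀ η, refMeasure g N u v {η} = ENNReal.ofReal
      (prodProb g (fun x : Box N => interp u v (((x : ℤ) : ℝ) / N)) η) := fun η =>
    pi_siteMeasure_singleton hgpos hf η
  have h1 := relEntropy_eq_klDiv (ne_top_of_le_ne_top ENNReal.ofReal_ne_top h) fun η => by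
    rw [hsing]; exact (ENNReal.ofReal_pos.2 (prodProb_pos hgpos hf η)).ne'
  have h2 : (fun η => (refMeasure g N u v).real {η})
      = prodProb g (fun x : Box N => interp u v (((x : ℤ) : ℝ) / N)) := by
    ext η
    rw [measureReal_def, hsing, ENNReal.toReal_ofReal (prodProb_pos hgpos hf η).le]
  rw [h2] at h1
  rw [← h1] at h
  have hp1 : ∑' η, ENNReal.ofReal (μ.real {η}) = 1 := by
    have h3 := lintegral_countable' (μ := μ) fun _ => 1
    simp only [lintegral_one, measure_univ, one_mul] at h3
    exact (tsum_congr fun η => ofReal_measureReal).trans h3.symm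
  have hlog := Real.log_nonneg
    (one_le_partitionFn hgpos (mul_nonneg hb₀.1.le (Real.exp_pos γ).le) hs)
  have hlogb := Real.log_nonneg
    (one_le_partitionFn hgpos hb₀.1.le (fugacities_summable hgpos hb₀))
  have hlab : 0 ≤ Real.log (b₀ / a₀) := Real.log_nonneg ((one_le_div ha₀).2 hab)
  refine (relEntropy_prodProb_le hgpos hγ ha₀ hab hb₀ (fun x => profile_box_mem_Icc hu hv x) hmem hs
    (fun η => measureReal_nonneg) hp1).trans ?_
  refine (add_le_add h (add_le_add (mul_le_mul' le_rfl (mul_le_mul' le_rfl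
    (add_le_add h le_rfl))) le_rfl)).trans ?_
  have hc : ((Fintype.card (Box N) : ℕ) : ℝ) ≤ 3 * N := by
    rw [card_box]; push_cast; linarith
  rw [← ENNReal.ofReal_add (by positivity) (by positivity),
    ← ENNReal.ofReal_mul (by positivity), ← ENNReal.ofReal_mul (by positivity),
    ← ENNReal.ofReal_add (by positivity) (by positivity),
    ← ENNReal.ofReal_add (by positivity) (by positivity)]
  refine ENNReal.ofReal_le_ofReal ?_
  calc _ ≤ C * N + (Real.log (b₀ / a₀) * (γ⁻¹ * (C * N
        + 3 * N * Real.log (partitionFn g (b₀ * Real.exp γ))))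
        + 3 * N * Real.log (partitionFn g b₀)) := by gcongr
    _ = _ := by ring

theorem exists_hasEntropyBounds (hg0 : g 0 = 0) (hgpos : ∀ k, 0 < k → 0 < g k) {K : ℝ}
    (hK : ∀ k, |g (k + 1) - g k| ≤ K) {a₀ b₀ γ K' T : ℝ} (ha₀ : 0 < a₀) (hb₀ : b₀ ∈ fugacities g)
    (hγ : 0 < γ) (hs : Summable (weight g (b₀ * Real.exp γ))) (hT : 0 ≤ T) {aL aR : ℝ → ℝ}
    (hd : IsDriving g a₀ b₀ K' T aL aR) {p : ∀ N, ℝ → Config N → ℝ} (hp0 : ∀ N s η, 0 ≤ p N s η)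
    (hp : ∀ N, 0 < N → IsForwardSolution g α aL aR (p N)) {C₀ : ℝ} (hC₀ : 0 ≤ C₀)
    (hent : ∀ N, 0 < N → relEntropy (p N 0) (refProb g N (aL 0) (aR 0))
      ≤ ENNReal.ofReal (C₀ * N)) :
    ∃ C, 0 ≤ C ∧ HasEntropyBounds g α C T aL aR p := by
  obtain ⟨K₂, hK₂0, hK₂⟩ := exists_hasDerivWithinAt_refProb hgpos ha₀ hb₀ K'
  have hK0 : 0 ≤ K := (abs_nonneg _).trans (hK 0)
  have hlog := Real.log_nonneg
    (one_le_partitionFn hgpos (mul_nonneg hb₀.1.le (Real.exp_pos γ).le) hs)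
  set r := growthRate g b₀ γ K₂ with hr
  have hr0 : 0 ≤ r := by rw [hr]; unfold growthRate; positivity
  set C := Real.exp (r * T) * (C₀ + 3 * r * T) with hC
  have hC0 : 0 ≤ C := by positivity
  have key := fun N (hN : 0 < N) => (hp N hN).entropy_dissipation hg0 hgpos hK0
    (le_mul_of_lipschitz hg0 hK) ha₀ hb₀ hγ hs hK₂0 (hK₂ N) hd hN hT
    (mul_nonneg hC₀ (Nat.cast_nonneg N)) (hent N hN) rfl
  have hB : ∀ N : ℕ, 0 < N → Real.exp (r * T) * (C₀ * N + r * (2 * N + 1) * T) ≤ C * N :=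
    fun N hN => by
      have hN1 : (1 : ℝ) ≤ N := by exact_mod_cast hN
      have h3 : (2 * (N : ℝ) + 1) ≤ 3 * N := by linarith
      calc _ ≤ Real.exp (r * T) * (C₀ * N + r * (3 * N) * T) := by gcongr
        _ = _ := by rw [hC]; ring
  refine ⟨C + C / a₀, by positivity, hp0, fun N hN => (hp N hN).tsum_eq_one, fun N hN s hs => ?_,
    fun N hN => ?_⟩
  · refine ((key N hN).1 s hs).trans (ENNReal.ofReal_le_ofReal ((hB N hN).trans ?_))
    have : 0 ≤ C / a₀ := by positivity
    gcongr
    linarith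
  · refine (key N hN).2.trans (ENNReal.ofReal_le_ofReal ?_)
    have hN0 : (0 : ℝ) < N := by exact_mod_cast hN
    have hpow : (0 : ℝ) < (N : ℝ) ^ (2 + α) := Real.rpow_pos_of_pos hN0 _
    calc _ ≤ C * N / ((N : ℝ) ^ (2 + α) * a₀) := by
          exact div_le_div_of_nonneg_right (hB N hN) (by positivity)
      _ = C / a₀ * N / (N : ℝ) ^ (2 + α) := by field_simp
      _ ≤ _ := by
          gcongr
          linarith

theorem hasDerivWithinAt_comp_max {u : ℝ → ℝ} (hu : DifferentiableOn ℝ u (Ici 0)) {s : ℝ}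
    (hs : 0 ≤ s) :
    HasDerivWithinAt (fun r => u (max r 0)) (derivWithin u (Ici 0) s) (Ici s) s :=
  ((hu s hs).hasDerivWithinAt.mono (Ici_subset_Ici.2 hs)).congr
    (fun r hr => by rw [max_eq_left (hs.trans hr)]) (by rw [max_eq_left hs])

theorem tendsto_lintegral_spatialAverage (hg0 : g 0 = 0) (hgpos : ∀ k, 0 < k → 0 < g k)
    (hglip : ∃ K, ∀ k, |g (k + 1) - g k| ≤ K) (hα : 0 < α)
    (hL : ∀ s, 0 ≤ s → lamL s ∈ fugacities g) (hR : ∀ s, 0 ≤ s → lamR s ∈ fugacities g)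
    (hLdiff : DifferentiableOn ℝ lamL (Ici 0)) (hRdiff : DifferentiableOn ℝ lamR (Ici 0))
    (hLbdd : ∃ K, ∀ s, 0 ≤ s → |derivWithin lamL (Ici 0) s| ≤ K)
    (hRbdd : ∃ K, ∀ s, 0 ≤ s → |derivWithin lamR (Ici 0) s| ≤ K)
    {Ω : ℕ → Type*} [∀ N, MeasurableSpace (Ω N)]
    {P : ∀ N, Measure (Ω N)} [∀ N, IsProbabilityMeasure (P N)]
    {η : ∀ N, ℝ≥0 → Ω N → Config N}
    (hη : ∀ N, 0 < N → IsZeroRangeProcess g α lamL lamR N (P N) (η N))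
    (hent : ∃ C : ℝ, ∀ N, 0 < N →
      InformationTheory.klDiv ((P N).map (η N 0)) (refMeasure g N (lamL 0) (lamR 0))
        ≤ ENNReal.ofReal (C * N))
    {ℓ : ℕ} {φ : Config ℓ → ℝ} (hφ : HasExpMoments g φ) {G : ℝ → ℝ} (hG : IsTestFunction G)
    {t : ℝ} (ht : 0 < t) {c : ℝ → ℝ}
    (hc : ∀ s ∈ Icc 0 t,
      c s = ∫ y in (-1 : ℝ)..1, G y * localAverage g φ (interp (lamL s) (lamR s) y)) :
    Tendsto (fun N => ∫⁻ ω, (∫⁻ s in Icc (0 : ℝ) t,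
      ENNReal.ofReal |spatialAverage G φ (η N s.toNNReal ω) - c s|) ∂(P N)) atTop (𝓝 0) := by
  obtain ⟨K, hK⟩ := hglip
  obtain ⟨KL, hKL⟩ := hLbdd
  obtain ⟨KR, hKR⟩ := hRbdd
  obtain ⟨C', hC'⟩ := hent
  set aL : ℝ → ℝ := fun s => lamL (max s 0) with haL
  set aR : ℝ → ℝ := fun s => lamR (max s 0) with haR
  have haL' : ∀ r, 0 ≤ r → aL r = lamL r := fun r hr => by simp only [haL, max_eq_left hr]
  have haR' : ∀ r, 0 ≤ r → aR r = lamR r := fun r hr => by simp only [haR, max_eq_left hr]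
  have hmax : Continuous fun s : ℝ => max s 0 := by fun_prop
  have hcL : Continuous aL := hLdiff.continuousOn.comp_continuous hmax fun s => mem_Ici.2 (le_max_right _ _)
  have hcR : Continuous aR := hRdiff.continuousOn.comp_continuous hmax fun s => mem_Ici.2 (le_max_right _ _)
  have hmL : ∀ s, aL s ∈ fugacities g := fun s => hL _ (le_max_right _ _)
  have hmR : ∀ s, aR s ∈ fugacities g := fun s => hR _ (le_max_right _ _)
  obtain ⟨a₀, b₀, ha₀, hb₀, hrL, hrR⟩ := exists_mem_Icc_of_continuousOn ht.le (fun s _ => hmL s)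
    (fun s _ => hmR s) hcL.continuousOn hcR.continuousOn
  obtain ⟨γ, hγ, hs⟩ := exists_summable_mul_exp hb₀
  have hd : IsDriving g a₀ b₀ (max KL KR) t aL aR :=
    { continuous_left := hcL
      continuous_right := hcR
      mem_left := hmL
      mem_right := hmR
      range_left := hrL
      range_right := hrR
      deriv_left := fun s hs => ⟨_, (hKL s hs.1).trans (le_max_left _ _),
        hasDerivWithinAt_comp_max hLdiff hs.1⟩
      deriv_right := fun s hs => ⟨_, (hKR s hs.1).trans (le_max_right _ _),
        hasDerivWithinAt_comp_max hRdiff hs.1⟩ }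
  have h0 : (0 : ℝ) ∈ Icc 0 t := ⟨le_rfl, ht.le⟩
  have hab : a₀ ≤ b₀ := (hrL 0 h0).1.trans (hrL 0 h0).2
  have hlog := Real.log_nonneg
    (one_le_partitionFn hgpos (mul_nonneg hb₀.1.le (Real.exp_pos γ).le) hs)
  have hlogb := Real.log_nonneg
    (one_le_partitionFn hgpos hb₀.1.le (fugacities_summable hgpos hb₀))
  have hlab : 0 ≤ Real.log (b₀ / a₀) := Real.log_nonneg ((one_le_div ha₀).2 hab)
  obtain ⟨C, hC, hp⟩ := exists_hasEntropyBounds (α := α) hg0 hgpos hK ha₀ hb₀ hγ hs ht.le hd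
    (p := fun N => law (P N) (η N)) (fun N => law_nonneg (P N) (η N))
    (fun N hN => (hη N hN).isForwardSolution hcL hcR haL' haR')
    (C₀ := max C' 0 + (Real.log (b₀ / a₀) *
      (γ⁻¹ * (max C' 0 + 3 * Real.log (partitionFn g (b₀ * Real.exp γ))))
      + 3 * Real.log (partitionFn g b₀))) (by positivity) (fun N hN => by
        have : IsProbabilityMeasure ((P N).map (η N (0 : ℝ).toNNReal)) :=
          Measure.isProbabilityMeasure_map ((hη N hN).measurable _).aemeasurable
        refine relEntropy_refProb_le_of_klDiv_le hgpos ha₀ hb₀ hγ hs (hrL 0 h0) (hrR 0 h0) hN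
          (le_max_right _ _) ?_
        rw [haL' 0 le_rfl, haR' 0 le_rfl, Real.toNNReal_zero]
        refine (hC' N hN).trans (ENNReal.ofReal_le_ofReal ?_)
        gcongr
        exact le_max_left _ _)
  have hc' : ∀ s ∈ Icc 0 t,
      c s = ∫ y in (-1 : ℝ)..1, G y * localAverage g φ (interp (aL s) (aR s) y) := fun s hs => by
    rw [haL' s hs.1, haR' s hs.1]; exact hc s hs
  have hcm := aemeasurable_integral_localAverage hgpos ha₀ hb₀ hrL hrR hcL.continuousOn
    hcR.continuousOn hφ hG hc'
  refine (hp.tendsto_spatialAverage hα hg0 hgpos hK ha₀ hb₀ hγ hs hrL hrR hcL.continuousOn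
    hcR.continuousOn hC ht.le hφ hG hc').congr' ?_
  filter_upwards [eventually_gt_atTop 0] with N hN
  have hmeas : AEMeasurable (Function.uncurry fun (ω : Ω N) (s : ℝ) => ENNReal.ofReal
      |spatialAverage G φ (η N s.toNNReal ω) - c s|) ((P N).prod (volume.restrict (Icc 0 t))) := by
    have h1 : Measurable fun q : Ω N × ℝ => spatialAverage G φ (η N q.2.toNNReal q.1) :=
      (measurable_of_countable (spatialAverage G φ)).comp
        ((hη N hN).measurable_uncurry.comp measurable_swap)
    exact (measurable_abs.comp_aemeasurable
      (h1.aemeasurable.sub hcm.comp_snd)).ennreal_ofReal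
  rw [lintegral_lintegral_swap hmeas]
  refine lintegral_congr fun s => ?_
  rw [lintegral_law (P N) (η N) s ((hη N hN).measurable _)
    fun ξ => ENNReal.ofReal |spatialAverage G φ ξ - c s|]
  exact tsum_congr fun ξ => by rw [ENNReal.ofReal_mul (law_nonneg _ _ _ _)]

/-! ### The empirical density -/

/-- The number of particles at the origin, as a local function. -/
def occupation (ξ : Config 0) : ℝ := ξ (leftEnd 0)

theorem shift_occupation {N : ℕ} (η : Config N) (x : Box N) : shift occupation x η = η x := by
  have h : (x : ℤ) + (leftEnd 0 : Box 0) = x := by simp [leftEnd]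
  unfold shift occupation
  simp only [h]
  exact congrArg Nat.cast (dif_pos x.2)

theorem spatialAverage_occupation {N : ℕ} (G : ℝ → ℝ) (η : Config N) :
    spatialAverage G occupation η = empiricalDensity G η := by
  unfold spatialAverage empiricalDensity
  congr 1
  have h : Finset.Icc (-(N : ℤ) + (0 : ℕ)) ((N : ℤ) - (0 : ℕ)) = Finset.Icc (-(N : ℤ)) N := by simp
  rw [h, ← Finset.sum_coe_sort]
  exact Finset.sum_congr rfl fun x _ => by rw [shift_occupation]

theorem hasExpMoments_occupation (hgpos : ∀ k, 0 < k → 0 < g k)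
    (hZ : ∀ lam, 0 < lam → Summable (weight g lam)) : HasExpMoments g occupation := by
  intro γ hγ lam hlam
  refine ⟨(measurable_of_countable _).aestronglyMeasurable, ?_⟩
  rw [hasFiniteIntegral_iff_ofReal (ae_of_all _ fun ξ => (Real.exp_pos _).le), homMeasure,
    lintegral_pi_siteMeasure hgpos fun _ => hlam]
  have h1 := tsum_prodProb_eval hgpos (lam := fun _ : Box 0 => lam) (fun _ => hlam) (leftEnd 0)
    fun k => ENNReal.ofReal (Real.exp (γ * |(k : ℝ)|))
  refine (le_of_eq h1).trans_lt ?_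
  have h2 := hasSum_siteProb_mul_pow (hZ (lam * Real.exp γ) (mul_pos hlam.1 (Real.exp_pos γ)))
  have h3 : ∀ k : ℕ, ENNReal.ofReal (siteProb g lam k) * ENNReal.ofReal (Real.exp (γ * |(k : ℝ)|))
      = ENNReal.ofReal (siteProb g lam k * Real.exp γ ^ k) := fun k => by
    rw [← ENNReal.ofReal_mul (siteProb_pos hgpos hlam k).le, Nat.abs_cast, mul_comm γ,
      Real.exp_nat_mul]
  simp only [h3]
  rw [← ENNReal.ofReal_tsum_of_nonneg (fun k => mul_nonneg (siteProb_pos hgpos hlam k).le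
    (pow_nonneg (Real.exp_pos γ).le k)) h2.summable]
  exact ENNReal.ofReal_lt_top

theorem localAverage_occupation (hgpos : ∀ k, 0 < k → 0 < g k) {lam : ℝ}
    (hlam : lam ∈ fugacities g) : localAverage g occupation lam = meanDensity g lam := by
  have := isProbabilityMeasure_siteMeasure hgpos hlam
  have h := measurePreserving_eval (fun _ : Box 0 => siteMeasure g lam) (leftEnd 0)
  rw [meanDensity, ← h.map_eq, integral_map h.measurable.aemeasurable
    (measurable_of_countable _).aestronglyMeasurable]
  rfl

end ZeroRange

theorem theorem4 (g : ℕ → ℝ) (hg0 : g 0 = 0) (hgpos : ∀ k, 0 < k → 0 < g k)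
    (hglip : ∃ K, ∀ k, |g (k + 1) - g k| ≤ K)
    (α : ℝ) (hα : 0 < α)
    (lamL lamR : ℝ → ℝ)
    (hL : ∀ s, 0 ≤ s → lamL s ∈ fugacities g) (hR : ∀ s, 0 ≤ s → lamR s ∈ fugacities g)
    (hLdiff : DifferentiableOn ℝ lamL (Ici 0)) (hRdiff : DifferentiableOn ℝ lamR (Ici 0))
    (hLbdd : ∃ K, ∀ s, 0 ≤ s → |derivWithin lamL (Ici 0) s| ≤ K)
    (hRbdd : ∃ K, ∀ s, 0 ≤ s → |derivWithin lamR (Ici 0) s| ≤ K)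
    (Ω : ℕ → Type*) [∀ N, MeasurableSpace (Ω N)]
    (P : ∀ N, Measure (Ω N)) [∀ N, IsProbabilityMeasure (P N)]
    (η : ∀ N, ℝ≥0 → Ω N → Config N)
    (hη : ∀ N, 0 < N → IsZeroRangeProcess g α lamL lamR N (P N) (η N))
    (hent : ∃ C : ℝ, ∀ N, 0 < N →
      InformationTheory.klDiv ((P N).map (η N 0)) (refMeasure g N (lamL 0) (lamR 0))
        ≤ ENNReal.ofReal (C * N)) :
    -- weak local equilibrium
    (∀ (ℓ : ℕ) (φ : Config ℓ → ℝ), HasExpMoments g φ →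
      ∀ G : ℝ → ℝ, IsTestFunction G → ∀ t : ℝ, 0 < t →
        Tendsto (fun N => ∫⁻ ω, (∫⁻ s in Icc (0 : ℝ) t,
            ENNReal.ofReal |spatialAverage G φ (η N s.toNNReal ω)
              - ∫ y in (-1 : ℝ)..1, G y * localAverage g φ (interp (lamL s) (lamR s) y)|) ∂(P N))
          atTop (𝓝 0)) ∧
    -- the associated density profile is the solution of the nonlinear Laplace equation
    (∀ s, 0 ≤ s →
      SolvesLaplace g (lamL s) (lamR s) (fun y => meanDensity g (interp (lamL s) (lamR s) y)) ∧
      ∀ ρ, SolvesLaplace g (lamL s) (lamR s) ρ →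
        EqOn ρ (fun y => meanDensity g (interp (lamL s) (lamR s) y)) (Icc (-1) 1)) ∧
    -- and, if `Z` is finite everywhere, the empirical density follows it
    ((∀ lam, 0 < lam → Summable (weight g lam)) →
      ∀ G : ℝ → ℝ, IsTestFunction G → ∀ t : ℝ, 0 < t →
        Tendsto (fun N => ∫⁻ ω, (∫⁻ s in Icc (0 : ℝ) t,
            ENNReal.ofReal |empiricalDensity G (η N s.toNNReal ω)
              - ∫ y in (-1 : ℝ)..1, G y * meanDensity g (interp (lamL s) (lamR s) y)|) ∂(P N))
          atTop (𝓝 0)) := by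
  refine ⟨fun ℓ φ hφ G hG t ht => ?_, fun s hs => solvesLaplace_iff_eqOn hgpos (hL s hs) (hR s hs),
    fun hZ G hG t ht => ?_⟩
  · exact tendsto_lintegral_spatialAverage hg0 hgpos hglip hα hL hR hLdiff hRdiff hLbdd hRbdd hη hent
      hφ hG ht fun s _ => rfl
  · simp only [← spatialAverage_occupation]
    refine tendsto_lintegral_spatialAverage hg0 hgpos hglip hα hL hR hLdiff hRdiff hLbdd hRbdd hη
      hent (hasExpMoments_occupation hgpos hZ) hG ht fun s hs =>
        intervalIntegral.integral_congr fun y hy => ?_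
    rw [uIcc_of_le (by norm_num)] at hy
    simp only [localAverage_occupation hgpos
      (interp_mem_fugacities (hL s hs.1) (hR s hs.1) hy)]
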